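/- **Theorem (Bound on the Sobolev energy by free homotopy decomposition).** Let $m \ge 1$ be an integer and let $\mathcal{N}$ be a connected (smooth, finite-dimensional) Riemannian manifold with geodesic distance $d_{\mathcal{N}}$. Suppose that $f \in C(\mathbb{S}^m, \mathcal{N})$ has a free homotopy decomposition into $f_1, \dotsc, f_k \in C(\mathbb{S}^m, \mathcal{N})$. Then for every $s \in (0,1]$ and $p \in [m, +\infty)$ such that $p = m/s > 1$, $$ \inf\bigl\{ \mathcal{E}^{s,p}(g) \;\big|\; g \in (C \cap W^{s,p})(\mathbb{S}^m, \mathcal{N}) \text{ is homotopic to } f \bigr\} \;\le\; \sum_{i=1}^k \mathcal{E}^{s,p}(f_i). $$ Here $f$ *has a free homotopy decomposition into* $f_1, \dotsc, f_k$ if there are a map $g \in C(\mathbb{S}^m, \mathcal{N})$ homotopic to $f$ and pairwise disjoint open geodesic balls $B_{\rho_1}(a_1), \dotsc, B_{\rho_k}(a_k) \subset \mathbb{S}^m$ with $0 < \rho_i < \pi$ such that $g$ is constant on $\mathbb{S}^m \setminus \bigcup_{i} B_{\rho_i}(a_i)$ and, for every $i$, the map induced by $g|_{\bar B_{\rho_i}(a_i)}$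 on $\bar B_{\rho_i}(a_i)/\partial B_{\rho_i}(a_i) \simeq \mathbb{S}^m$ is (freely) homotopic to $f_i$; the identification sends the point at geodesic distance $\theta \le \rho_i$ from $a_i$ in a given direction to the point at distance $\pi\theta/\rho_i$ from $a_i$ in the same direction, and thus $\partial B_{\rho_i}(a_i)$ to $-a_i$. For $0 < s < 1$ the energy is $$ \mathcal{E}^{s,p}(f) = \int_{\mathbb{S}^m}\int_{\mathbb{S}^m} \frac{d_{\mathcal{N}}(f(y), f(x))^p}{|y-x|^{m+sp}} \,dy\,dx \in [0, \infty], $$ where $|y - x|$ is the Euclidean distance in $\mathbb{R}^{m+1}$, and a continuous map $f$ belongs to $W^{s,p}(\mathbb{S}^m, \mathcal{N})$ if $\mathcal{E}^{s,p}(f) < \infty$. For $s = 1$ the energy is $\mathcal{E}^{1,p}(f) = \int_{\mathbb{S}^m} |Df|^p$, where $|\cdot|$ is the Euclidean (Hilbert–Schmidt) norm and $Df$ is the weak derivative of $f$, that is, the family of linear maps $Df(x) : T_x\mathbb{S}^m \to T_{f(x)}\mathcal{N}$ such that for every $u \in C^1(\mathcal{N}, \mathbb{R})$ the function $u \circ f$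 has the integrable weak derivative $du(f)\circ Df$; a continuous map $f$ belongs to $W^{1,p}(\mathbb{S}^m, \mathcal{N})$ if it is weakly differentiable and $\int_{\mathbb{S}^m} |Df|^p < \infty$, and $\mathcal{E}^{1,p}(f) = \infty$ if $f$ is not weakly differentiable. -/

import Mathlib

open Bundle Manifold MeasureTheory
open scoped ContDiff ENNReal

noncomputable section

namespace SphereMaps

/-- The Euclidean space `ℝ^{m+1}`. -/
abbrev Amb (m : ℕ) : Type := EuclideanSpace ℝ (Fin (m + 1))

/-- The unit sphere `S^m` of `ℝ^{m+1}`; its metric is the Euclidean distance `|y - x|`. -/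
abbrev Sph (m : ℕ) : Type := Metric.sphere (0 : Amb m) 1

/-- The surface measure of `S^m`. -/
abbrev surf (m : ℕ) : Measure (Sph m) := (volume : Measure (Amb m)).toSphere

/-! ### Free homotopy decompositions -/

/-- The open geodesic ball of `S^m`: the geodesic distance between two points of the unit sphere is
the angle between them. -/
def geodBall {m : ℕ} (a : Sph m) (ρ : ℝ) : Set (Sph m) :=
  {x | InnerProductGeometry.angle (a : Amb m) (x : Amb m) < ρ}

/-- `g` restricted to the closed geodesic ball of centre `a` and radius `ρ` induces the map `h` on
`S^m` under the identification of `S^m` with the closed ball with its boundary collapsed to a point.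
The identification stretches the geodesics issued from `a`: the point at distance `θ ≤ ρ` from `a`
in the unit direction `w` goes to the point at distance `π θ / ρ` from `a` in the direction `w`, so
that the boundary of the ball goes to the antipode `-a`. -/
def InducesOnBall {m : ℕ} {N : Type*} (g : Sph m → N) (a : Sph m) (ρ : ℝ) (h : Sph m → N) : Prop :=
  ∀ (w : Amb m) (θ : ℝ) (x y : Sph m),
    ‖w‖ = 1 → inner ℝ (a : Amb m) w = 0 → 0 ≤ θ → θ ≤ ρ →
    (x : Amb m) = Real.cos θ • (a : Amb m) + Real.sin θ • w →
    (y : Amb m) = Real.cos (Real.pi * θ / ρ) • (a : Amb m) + Real.sin (Real.pi * θ / ρ) • w →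
    g x = h y

/-- `f : S^m → N` has a free homotopy decomposition into `F 0, …, F (k - 1)`. -/
def HasFreeHomotopyDecomposition {m k : ℕ} {N : Type*} [TopologicalSpace N]
    (f : C(Sph m, N)) (F : Fin k → C(Sph m, N)) : Prop :=
  ∃ (g : C(Sph m, N)) (a : Fin k → Sph m) (ρ : Fin k → ℝ),
    g.Homotopic f ∧
    (∀ i, 0 < ρ i ∧ ρ i < Real.pi) ∧
    (∀ i j, i ≠ j → Disjoint (geodBall (a i) (ρ i)) (geodBall (a j) (ρ j))) ∧
    (∃ c : N, ∀ x, (∀ i, x ∉ geodBall (a i) (ρ i)) → g x = c) ∧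
    ∀ i, ∃ h : C(Sph m, N), h.Homotopic (F i) ∧ InducesOnBall g (a i) (ρ i) h

/-! ### Weak derivatives on the sphere

A linear form (or a linear map) on the tangent space `T_x S^m = x^⊥` is represented by the linear
map on `ℝ^{m+1}` which extends it by `0` in the normal direction `x`. -/

/-- The divergence on `S^m`, at the point `x`, of the restriction to `S^m` of a vector field `X`
which is tangent to `S^m`: the trace of the derivative of `X` over the tangent space `x^⊥`. -/
def sphereDiv {m : ℕ} (X : Amb m → Amb m) (x : Amb m) : ℝ :=
  LinearMap.trace ℝ (Amb m) (fderiv ℝ X x : Amb m →ₗ[ℝ] Amb m) - inner ℝ (fderiv ℝ X x x) x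

/-- `A` is the weak derivative of `v : S^m → ℝ`: integration by parts holds against all smooth
tangent vector fields. -/
structure HasWeakDeriv {m : ℕ} (v : Sph m → ℝ) (A : Sph m → Amb m →L[ℝ] ℝ) : Prop where
  integrable : Integrable v (surf m)
  integrable_deriv : Integrable A (surf m)
  normal : ∀ x : Sph m, A x (x : Amb m) = 0
  integral_eq : ∀ X : Amb m → Amb m, ContDiff ℝ ∞ X →
    (∀ x : Sph m, inner ℝ (X x) (x : Amb m) = 0) →
    ∫ x : Sph m, v x * sphereDiv X (x : Amb m) ∂(surf m) =
      - ∫ x : Sph m, A x (X (x : Amb m)) ∂(surf m)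

/-! ### Sobolev energies -/

/-- The fractional energy `∬ d_N(f(y), f(x))^p / |y - x|^{m + sp} dy dx`, for `0 < s < 1`. -/
def energyFrac {m : ℕ} {N : Type*} [MetricSpace N] (s p : ℝ) (f : C(Sph m, N)) : ℝ≥0∞ :=
  ∫⁻ x : Sph m, ∫⁻ y : Sph m,
    edist (f y) (f x) ^ p / edist y x ^ ((m : ℝ) + s * p) ∂(surf m) ∂(surf m)

section Energy

variable {m n : ℕ} {N : Type*} [MetricSpace N] [ChartedSpace (EuclideanSpace ℝ (Fin n)) N]

/-- `D` is the weak derivative of the continuous map `f : S^m → N`: `D x` is a linear map from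
`T_x S^m` to `T_{f x} N`, and for each `C^1` function `u` on `N`, the function `u ∘ f` is weakly
differentiable with weak derivative given by the chain rule. When it exists, `D` is unique up to a
null set. -/
def IsWeakDeriv (f : C(Sph m, N)) (D : ∀ x : Sph m, Amb m →L[ℝ] TangentSpace (𝓡 n) (f x)) : Prop :=
  (∀ x : Sph m, D x (x : Amb m) = 0) ∧
  ∀ u : N → ℝ, ContMDiff (𝓡 n) 𝓘(ℝ, ℝ) 1 u →
    HasWeakDeriv (fun x => u (f x)) (fun x =>
      (NormedSpace.fromTangentSpace (𝕜 := ℝ) (u (f x))).toContinuousLinearMap ∘L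
        mfderiv (𝓡 n) 𝓘(ℝ, ℝ) u (f x) ∘L D x)

variable [RiemannianBundle (fun x : N => TangentSpace (𝓡 n) x)]

/-- `∫_{S^m} |D|^p`, where `|D|` is the Euclidean (Hilbert-Schmidt) norm of
`D x : T_x S^m → T_{f x} N` for the Riemannian metrics. -/
def derivEnergy (p : ℝ) (f : C(Sph m, N))
    (D : ∀ x : Sph m, Amb m →L[ℝ] TangentSpace (𝓡 n) (f x)) : ℝ≥0∞ :=
  ∫⁻ x : Sph m, ENNReal.ofReal
    (√(∑ i : Fin (m + 1), ‖D x (EuclideanSpace.single i (1 : ℝ))‖ ^ 2) ^ p) ∂(surf m)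

variable (n) in
/-- The energy `E^{1,p}(f) = ∫_{S^m} |Df|^p`, with the value `∞` when `f` is not weakly
differentiable. As the weak derivative is unique up to a null set, the infimum is over one value. -/
def energyOne (p : ℝ) (f : C(Sph m, N)) : ℝ≥0∞ :=
  ⨅ (D : ∀ x : Sph m, Amb m →L[ℝ] TangentSpace (𝓡 n) (f x)) (_ : IsWeakDeriv f D),
    derivEnergy p f D

variable (n) in
/-- The Sobolev energy `E^{s,p}(f)`, for `0 < s ≤ 1`. -/
def energy (s p : ℝ) (f : C(Sph m, N)) : ℝ≥0∞ :=
  if s = 1 then energyOne n p f else energyFrac s p f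

variable (n) in
/-- The continuous map `f : S^m → N` belongs to `W^{s,p}(S^m, N)`, for `0 < s ≤ 1`. -/
def MemSobolev (s p : ℝ) (f : C(Sph m, N)) : Prop :=
  if s = 1 then
    ∃ D : ∀ x : Sph m, Amb m →L[ℝ] TangentSpace (𝓡 n) (f x),
      IsWeakDeriv f D ∧ derivEnergy p f D < ⊤
  else energyFrac s p f < ⊤

end Energy

end SphereMaps

end

/-! For `s * p = m` the energy is invariant under conformal dilations of the sphere: distances
satisfy `dist_mob`, the surface measure gains the Jacobian `mobFac ^ m`, and the two effects cancel
(`energyFrac_comp_mob`; for `s = 1`, where `p = m`, inside `exists_isWeakDeriv_join`). A map `B`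
that is constant near `-q` can thus be concentrated by a dilation and inserted near `q` into a map
that takes there the same constant value. The energies add up exactly when `s = 1`. When `s < 1`
there is an interaction term, which tends to `0` as the concentration increases (`EnergyLE.insert`).

To insert a map close in energy to `f_i` into the `i`-th ball, it must be constant near `-a_i`, with
the value `c` that `g` takes outside the balls. Two difficulties arise.

Flatness: composition of `f_i` with a self-map of the manifold that collapses a neighbourhood of a
point and has Lipschitz constant at most `1 + ε` makes `f_i` constant near `-a_i` for almost no
energy (`exists_collapse_point`, `flatApprox_energy`). The collapse relies on a logarithmic cut-off.

Base point: the homotopy between `f_i` and the induced map is free, so the value at `-a_i` has to be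
dragged along a path. The path is cut into `k` pieces, and each one is realised by a bubble, a map
of energy `C (K/k)^p` inserted by a dilation in the flat region of the preceding one. The total cost
`C K^p k^(1-p)` tends to `0` because `p > 1` (`EnergyLE.exists_bubbles`, `FlatApprox.of_homotopic`).
The energy needed to approximate a homotopy class by flat maps is therefore insensitive to the base
point.

The gluing is an induction over the balls (`exists_energyLE_of_decomposition`). The glued map is
homotopic to `g` because collapsing the boundary of a geodesic ball and dilating the sphere from its
centre move points along the same meridians, never to antipodal points, and so can be interpolated
(`homotopicRel_comp_mob`). -/

noncomputable section


namespace SphereMaps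

open EuclideanGeometry Filter Topology

/-! ### Conformal dilations of the sphere -/

section Moebius

variable {m : ℕ}

lemma norm_coe_sph (x : Sph m) : ‖(x : Amb m)‖ = 1 := by simp

/-- The reflection of `ℝ^{m+1}` across the hyperplane orthogonal to `v`. -/
def hyperRefl (v : Amb m) : Amb m ≃ₗᵢ[ℝ] Amb m := (ℝ ∙ v)ᗮ.reflection

lemma hyperRefl_self (v : Amb m) : hyperRefl v v = -v :=
  Submodule.reflection_orthogonalComplement_singleton_eq_neg v

lemma hyperRefl_hyperRefl (v x : Amb m) : hyperRefl v (hyperRefl v x) = x :=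
  Submodule.reflection_reflection _ x

lemma hyperRefl_apply (v x : Amb m) :
    hyperRefl v x = x - (2 * (inner ℝ v x / ‖v‖ ^ 2)) • v := by
  have h : (ℝ ∙ v)ᗮ.reflection x = -(ℝ ∙ v).reflection x :=
    Submodule.reflection_orthogonal_apply _ x
  unfold hyperRefl
  rw [h, Submodule.reflection_singleton_apply, two_smul, mul_smul, two_smul]
  simp only [RCLike.ofReal_real_eq_id, id]
  abel

lemma hyperRefl_neg (v : Amb m) : hyperRefl (-v) = hyperRefl v := by
  ext1 x
  simp only [hyperRefl_apply, inner_neg_left, norm_neg]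
  module

/-- The map of `ℝ^{m+1}` whose restriction to the sphere is the conformal dilation of the sphere
that fixes `a` and `-a` and has the factor `(t + 1) / (t - 1)` at `a`. -/
def mobExt (a : Sph m) (t : ℝ) (x : Amb m) : Amb m :=
  hyperRefl (a : Amb m) (inversion (t • (a : Amb m)) (√(t ^ 2 - 1)) x)

/-- The conformal factor of `mobExt a t`. -/
def mobFac (a : Sph m) (t : ℝ) (x : Amb m) : ℝ := (√(t ^ 2 - 1) / dist x (t • (a : Amb m))) ^ 2

variable {a : Sph m} {t : ℝ}

lemma coe_ne_smul (ht : 1 < t) (x : Sph m) : (x : Amb m) ≠ t • (a : Amb m) := by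
  intro h
  have := congrArg norm h
  rw [norm_smul, norm_coe_sph, norm_coe_sph, Real.norm_eq_abs, abs_of_pos (by linarith)] at this
  linarith

lemma sqrt_pos_of_one_lt (ht : 1 < t) : 0 < √(t ^ 2 - 1) := Real.sqrt_pos.2 (by nlinarith)

lemma mobFac_pos (ht : 1 < t) {x : Amb m} (hx : x ≠ t • (a : Amb m)) : 0 < mobFac a t x :=
  pow_pos (div_pos (sqrt_pos_of_one_lt ht) (dist_pos.2 hx)) 2

lemma mobFac_mul (ht : 1 < t) {x : Amb m} (hx : x ≠ t • (a : Amb m)) :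
    mobFac a t x * dist x (t • (a : Amb m)) ^ 2 = t ^ 2 - 1 := by
  unfold mobFac
  have := (dist_pos.2 hx).ne'
  rw [div_pow, div_mul_cancel₀ _ (by positivity), Real.sq_sqrt (by nlinarith)]

lemma dist_sq_sph (x : Sph m) :
    dist (x : Amb m) (t • (a : Amb m)) ^ 2 = 1 + t ^ 2 - 2 * t * inner ℝ (a : Amb m) x := by
  rw [dist_eq_norm, norm_sub_sq_real, norm_smul, norm_coe_sph, norm_coe_sph, inner_smul_right,
    real_inner_comm, Real.norm_eq_abs, mul_one, sq_abs]
  ring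

lemma mobExt_apply (x : Amb m) :
    mobExt a t x = mobFac a t x • hyperRefl (a : Amb m) (x - t • (a : Amb m)) - t • (a : Amb m) := by
  simp only [mobExt, mobFac, inversion, vsub_eq_sub, vadd_eq_add, map_add, map_smul,
    hyperRefl_self, smul_neg, sub_eq_add_neg]

/-- The squared radius `t ^ 2 - 1` is the power of the centre `t • a` with respect to the unit
sphere, so the sphere of inversion is orthogonal to the unit sphere and the inversion preserves the
latter. -/
lemma norm_mobExt (ht : 1 < t) (x : Sph m) : ‖mobExt a t x‖ = 1 := by
  have h1 := mobFac_mul ht (coe_ne_smul (a := a) ht x)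
  have h2 := dist_sq_sph (a := a) (t := t) x
  have h3 : ‖mobExt a t x‖ ^ 2 = 1 := by
    rw [mobExt, LinearIsometryEquiv.norm_map]
    change ‖mobFac a t x • ((x : Amb m) - t • (a : Amb m)) + t • (a : Amb m)‖ ^ 2 = 1
    rw [norm_add_sq_real, inner_smul_left, inner_sub_left, inner_smul_left, inner_smul_right,
      inner_smul_right, real_inner_self_eq_norm_sq, norm_smul, ← dist_eq_norm, norm_smul,
      norm_coe_sph, real_inner_comm]
    simp only [RCLike.conj_to_real, Real.norm_eq_abs, mul_pow, sq_abs]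
    rw [h2] at h1 ⊢
    linear_combination (mobFac a t ↑x - 1) * h1
  nlinarith [norm_nonneg (mobExt a t (x : Amb m))]

/-- The reflection conjugates the inversion centred at `t • a` to the one centred at `-t • a`, so
the inverse dilation is the dilation with exchanged poles. -/
lemma mobExt_neg_mobExt (ht : 1 < t) (x : Amb m) : mobExt (-a) t (mobExt a t x) = x := by
  have key : ∀ y : Amb m, mobExt (-a) t y = inversion (t • (a : Amb m)) (√(t ^ 2 - 1))
      (hyperRefl (a : Amb m) y) := by
    intro y
    have hd : dist y (t • ((-a : Sph m) : Amb m)) = dist (hyperRefl (a : Amb m) y) (t • (a : Amb m)) := by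
      rw [← (hyperRefl (a : Amb m)).dist_map, map_smul, coe_neg_sphere, map_neg, hyperRefl_self,
        neg_neg]
    rw [mobExt_apply, mobFac, hd, coe_neg_sphere, hyperRefl_neg, inversion]
    simp only [vsub_eq_sub, vadd_eq_add, smul_neg, sub_neg_eq_add]
    rw [map_add, map_smul, hyperRefl_self, smul_neg, ← sub_eq_add_neg]
  rw [key, mobExt, hyperRefl_hyperRefl, inversion_inversion _ (sqrt_pos_of_one_lt ht).ne']

lemma mobExt_mobExt_neg (ht : 1 < t) (x : Amb m) : mobExt a t (mobExt (-a) t x) = x := by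
  simpa using mobExt_neg_mobExt (a := -a) ht x

lemma contDiffOn_inversion_center (c : Amb m) (R : ℝ) : ContDiffOn ℝ ∞ (inversion c R) {c}ᶜ :=
  contDiffOn_const.inversion contDiffOn_const contDiffOn_id fun _ h => h

lemma contDiffOn_mobExt : ContDiffOn ℝ ∞ (mobExt a t) {t • (a : Amb m)}ᶜ :=
  (hyperRefl (a : Amb m)).contDiff.comp_contDiffOn (contDiffOn_inversion_center _ _)

lemma contDiffOn_mobFac : ContDiffOn ℝ ∞ (mobFac a t) {t • (a : Amb m)}ᶜ :=
  (contDiffOn_const.div (contDiffOn_id.dist ℝ contDiffOn_const fun _ h => h)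
    fun _ h => (dist_pos.2 h).ne').pow 2

lemma mobExt_ne (ht : 1 < t) {x : Amb m} (hx : x ≠ t • (a : Amb m)) :
    mobExt a t x ≠ t • ((-a : Sph m) : Amb m) := by
  intro h
  rw [mobExt, coe_neg_sphere, ← hyperRefl_self, ← map_smul] at h
  exact hx ((inversion_eq_center (sqrt_pos_of_one_lt ht).ne').1
    ((hyperRefl (a : Amb m)).injective h))

/-- The linear isometry which is, up to the conformal factor, the derivative of `mobExt a t`. -/
def mobLin (a : Sph m) (t : ℝ) (x : Amb m) : Amb m ≃ₗᵢ[ℝ] Amb m :=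
  (hyperRefl (x - t • (a : Amb m))).trans (hyperRefl (a : Amb m))

lemma hasFDerivAt_mobExt {x : Amb m} (hx : x ≠ t • (a : Amb m)) :
    HasFDerivAt (mobExt a t) (mobFac a t x • (mobLin a t x : Amb m →L[ℝ] Amb m)) x := by
  have := ((hyperRefl (a : Amb m)).toContinuousLinearEquiv.hasFDerivAt
    (x := inversion (t • (a : Amb m)) (√(t ^ 2 - 1)) x)).comp x
    (hasFDerivAt_inversion (R := √(t ^ 2 - 1)) hx)
  refine this.congr_fderiv ?_
  ext1 v
  simp [mobFac, mobLin, hyperRefl]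

/-- A conformal map that preserves the sphere carries its normal to its normal; here the sign is
also right. Tangent vectors consequently go to tangent vectors. -/
lemma mobLin_self (ht : 1 < t) (x : Sph m) : mobLin a t x x = mobExt a t x := by
  have h1 := mobFac_mul ht (coe_ne_smul (a := a) ht x)
  have h2 := dist_sq_sph (a := a) (t := t) x
  have h3 : dist (x : Amb m) (t • (a : Amb m)) ^ 2 ≠ 0 :=
    (pow_pos (dist_pos.2 (coe_ne_smul (a := a) ht x)) 2).ne'
  change hyperRefl (a : Amb m) (hyperRefl _ (x : Amb m)) = _
  rw [mobExt, hyperRefl_apply ((x : Amb m) - _)]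
  congr 1
  change _ = mobFac a t x • ((x : Amb m) - t • (a : Amb m)) + t • (a : Amb m)
  have : 2 * (inner ℝ ((x : Amb m) - t • (a : Amb m)) x / ‖(x : Amb m) - t • (a : Amb m)‖ ^ 2)
      = 1 - mobFac a t x := by
    rw [← dist_eq_norm, inner_sub_left, real_inner_self_eq_norm_sq, norm_coe_sph, inner_smul_left,
      RCLike.conj_to_real, mul_div_assoc', div_eq_iff h3, sub_mul, h1, h2]
    ring
  rw [this, sub_smul, one_smul]
  abel

/-- The conformal dilation of the sphere with the poles `a` and `-a`. -/
def mob (a : Sph m) (t : ℝ) (ht : 1 < t) : Sph m ≃ₜ Sph m where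
  toFun x := ⟨mobExt a t x, by simpa using norm_mobExt ht x⟩
  invFun x := ⟨mobExt (-a) t x, by simpa using norm_mobExt ht x⟩
  left_inv x := Subtype.ext (mobExt_neg_mobExt ht _)
  right_inv x := Subtype.ext (mobExt_mobExt_neg ht _)
  continuous_toFun := by
    refine Continuous.subtype_mk ?_ _
    exact contDiffOn_mobExt.continuousOn.comp_continuous continuous_subtype_val
      fun x => coe_ne_smul ht x
  continuous_invFun := by
    refine Continuous.subtype_mk ?_ _
    exact contDiffOn_mobExt.continuousOn.comp_continuous continuous_subtype_val
      fun x => coe_ne_smul ht x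

@[simp] lemma coe_mob (ht : 1 < t) (x : Sph m) : (mob a t ht x : Amb m) = mobExt a t x := rfl

/-- This exact formula, rather than its infinitesimal version, is what makes the nonlocal energy
conformally invariant. -/
lemma dist_mob (ht : 1 < t) (x y : Sph m) :
    dist (mob a t ht x) (mob a t ht y) ^ 2 = mobFac a t x * mobFac a t y * dist x y ^ 2 := by
  have hx := coe_ne_smul (a := a) ht x
  have hy := coe_ne_smul (a := a) ht y
  rw [Subtype.dist_eq, Subtype.dist_eq, coe_mob, coe_mob, mobExt, mobExt,
    LinearIsometryEquiv.dist_map, dist_inversion_inversion hx hy, mobFac, mobFac]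
  have := (dist_pos.2 hx).ne'
  have := (dist_pos.2 hy).ne'
  field_simp

/-- The dilation preserves the meridians through `a`: the component orthogonal to `a` is only
multiplied by a positive factor. -/
lemma mobExt_eq_combination (x : Sph m) : ∃ s : ℝ,
    mobExt a t x = mobFac a t x • ((x : Amb m) - inner ℝ (a : Amb m) (x : Amb m) • (a : Amb m))
      + s • (a : Amb m) := by
  refine ⟨mobFac a t x * (t - inner ℝ (a : Amb m) (x : Amb m)) - t, ?_⟩
  rw [mobExt_apply, map_sub, map_smul, hyperRefl_self, hyperRefl_apply, norm_coe_sph]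
  module

lemma dist_smul_self (ht : 1 < t) : dist (t • (a : Amb m)) (a : Amb m) = t - 1 := by
  have : t • (a : Amb m) - a = (t - 1) • (a : Amb m) := by module
  rw [dist_eq_norm, this, norm_smul, norm_coe_sph, mul_one, Real.norm_eq_abs,
    abs_of_pos (by linarith)]

/-- Before the reflection, the image is at distance `(t ^ 2 - 1) / dist x (t • a)` from the centre
of inversion, which is at distance `t - 1` from `a`. -/
lemma dist_mob_neg_le (ht : 1 < t) (x : Sph m) :
    dist (mob a t ht x) (-a) ≤ (t - 1) + (t ^ 2 - 1) / dist (x : Amb m) (t • (a : Amb m)) := by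
  have hx := coe_ne_smul (a := a) ht x
  have hneg : ((-a : Sph m) : Amb m) = hyperRefl (a : Amb m) a := by
    rw [hyperRefl_self, coe_neg_sphere]
  rw [Subtype.dist_eq, coe_mob, mobExt, hneg, LinearIsometryEquiv.dist_map]
  refine (dist_triangle _ (t • (a : Amb m)) _).trans ?_
  rw [add_comm, dist_inversion_center, Real.sq_sqrt (by nlinarith)]
  rw [dist_smul_self ht]

lemma mob_self (ht : 1 < t) : mob a t ht a = a := by
  apply Subtype.ext
  have hx := coe_ne_smul (a := a) ht a
  have h1 := mobFac_mul ht hx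
  rw [dist_sq_sph, real_inner_self_eq_norm_sq, norm_coe_sph] at h1
  have h2 : mobFac a t a * (t - 1) = t + 1 := by
    have : (t - 1) ≠ 0 := by linarith
    apply mul_right_cancel₀ this
    linear_combination h1
  rw [coe_mob, mobExt_apply, map_sub, map_smul, hyperRefl_self]
  have : mobFac a t a • (-(a : Amb m) - t • -(a : Amb m)) - t • (a : Amb m)
    = (mobFac a t a * (t - 1) - t) • (a : Amb m) := by module
  rw [this, h2]
  simp

/-- Away from `a`, the dilations concentrate at `-a` as the parameter tends to `1`. -/
lemma exists_mob_mem_ball (a : Sph m) {r δ : ℝ} (hr : 0 < r) (hδ : 0 < δ) :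
    ∃ t₀, 1 < t₀ ∧ ∀ t (ht : 1 < t), t < t₀ → ∀ x : Sph m, r ≤ dist x a →
      dist (mob a t ht x) (-a) < δ := by
  have hc : Tendsto (fun t : ℝ => (t - 1) + (t ^ 2 - 1) / (r / 2)) (𝓝 1) (𝓝 0) := by
    have : Continuous fun t : ℝ => (t - 1) + (t ^ 2 - 1) / (r / 2) := by fun_prop
    simpa using this.tendsto 1
  obtain ⟨e, he, h⟩ := Metric.eventually_nhds_iff.1 (hc.eventually (gt_mem_nhds hδ))
  -- The bound `r / 2` on `t - 1` keeps `t • a` within `r / 2` of `a`, and thus at least `r / 2`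
  -- away from `x`.
  refine ⟨1 + min e (r / 2), by simp [he, hr], fun t ht ht' x hx => ?_⟩
  have h1 : t - 1 < e := by linarith [min_le_left e (r / 2)]
  have h2 : t - 1 < r / 2 := by linarith [min_le_right e (r / 2)]
  refine (dist_mob_neg_le ht x).trans_lt (lt_of_le_of_lt ?_ (h (y := t) ?_))
  · gcongr
    · nlinarith
    · have h3 : dist (t • (a : Amb m)) (a : Amb m) = t - 1 :=
        dist_smul_self ht
      have := dist_triangle (x : Amb m) (t • (a : Amb m)) (a : Amb m)
      rw [Subtype.dist_eq] at hx
      linarith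
  · rw [Real.dist_eq, abs_of_pos (by linarith)]
    exact h1

end Moebius

end SphereMaps

end

noncomputable section


namespace SphereMaps

open Filter Topology

/-! ### The surface measure -/

section SurfaceMeasure

variable {m : ℕ}

lemma hasFDerivAt_norm_of_ne {z : Amb m} (hz : z ≠ 0) :
    HasFDerivAt (fun z : Amb m => ‖z‖) (innerSL ℝ (‖z‖⁻¹ • z)) z := by
  have hz' : ‖z‖ ≠ 0 := norm_ne_zero_iff.2 hz
  have h2 := (hasStrictFDerivAt_norm_sq z).hasFDerivAt
  have h3 := h2.sqrt (pow_ne_zero 2 hz')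
  simp only [Real.sqrt_sq (norm_nonneg _)] at h3
  refine h3.congr_fderiv ?_
  ext v
  simp
  field_simp

lemma hasFDerivAt_inv_norm_smul {z : Amb m} (hz : z ≠ 0) :
    HasFDerivAt (fun z : Amb m => ‖z‖⁻¹ • z)
      (‖z‖⁻¹ • (ContinuousLinearMap.id ℝ (Amb m) -
        (innerSL ℝ (‖z‖⁻¹ • z)).smulRight (‖z‖⁻¹ • z))) z := by
  have hz' : ‖z‖ ≠ 0 := norm_ne_zero_iff.2 hz
  have h1 := hasFDerivAt_norm_of_ne hz
  have h4 := ((hasDerivAt_inv hz').comp_hasFDerivAt z h1).smul (hasFDerivAt_id z)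
  refine h4.congr_fderiv ?_
  ext1 v
  simp only [add_apply, smul_apply,
    sub_apply, ContinuousLinearMap.smulRight_apply, innerSL_apply_apply, id,
    ContinuousLinearMap.id_apply, inner_smul_left, Function.comp, smul_eq_mul, RCLike.conj_to_real]
  match_scalars <;> field_simp

/-- The radial projection onto the sphere, with an arbitrary value at `0`. -/
def radProj (z : Amb m) : Sph m :=
  ⟨if z = 0 then EuclideanSpace.single 0 1 else ‖z‖⁻¹ • z, by
    split_ifs with h
    · simp
    · simp [norm_smul, h]⟩

lemma coe_radProj {z : Amb m} (hz : z ≠ 0) : (radProj z : Amb m) = ‖z‖⁻¹ • z := by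
  simp [radProj, hz]

lemma norm_smul_radProj (z : Amb m) : ‖z‖ • (radProj z : Amb m) = z := by
  rcases eq_or_ne z 0 with rfl | hz
  · simp
  · rw [coe_radProj hz, smul_smul, mul_inv_cancel₀ (norm_ne_zero_iff.2 hz), one_smul]

lemma radProj_smul {r : ℝ} (hr : 0 < r) (x : Sph m) : radProj (r • (x : Amb m)) = x := by
  apply Subtype.ext
  have hx : (x : Amb m) ≠ 0 := by rw [← norm_ne_zero_iff]; simp
  rw [coe_radProj (smul_ne_zero hr.ne' hx), norm_smul, norm_coe_sph, mul_one, Real.norm_eq_abs,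
    abs_of_pos hr, smul_smul, inv_mul_cancel₀ hr.ne', one_smul]

lemma measurable_radProj : Measurable (radProj : Amb m → Sph m) :=
  (Measurable.ite (measurableSet_singleton 0) measurable_const (by fun_prop)).subtype_mk

/-- The surface measure is defined through the volume of cones in the unit ball; as a push-forward,
it becomes accessible to the change of variables formula of the ambient space. -/
lemma surf_eq_map : surf m = ((m + 1 : ℕ) : ℝ≥0∞) •
    ((volume : Measure (Amb m)).restrict (Metric.ball 0 1 \ {0})).map radProj := by
  ext s hs
  rw [surf, Measure.toSphere_apply' _ hs, Measure.smul_apply, Measure.map_apply measurable_radProj hs,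
    Measure.restrict_apply (measurable_radProj hs)]
  simp only [finrank_euclideanSpace, Fintype.card_fin, smul_eq_mul]
  congr 2
  ext z
  simp only [Set.mem_smul, Set.mem_image, Set.mem_inter_iff, Set.mem_preimage, Set.mem_sdiff,
    Metric.mem_ball, dist_zero_right, Set.mem_singleton_iff]
  constructor
  · rintro ⟨r, hr, _, ⟨x, hx, rfl⟩, rfl⟩
    rw [radProj_smul hr.1]
    refine ⟨hx, ?_, ?_⟩
    · rw [norm_smul, norm_coe_sph, mul_one, Real.norm_eq_abs, abs_of_pos hr.1]; exact hr.2
    · refine smul_ne_zero hr.1.ne' ?_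
      rw [← norm_ne_zero_iff]; simp
  · rintro ⟨h1, h2, h3⟩
    exact ⟨‖z‖, ⟨norm_pos_iff.2 h3, h2⟩, _, ⟨_, h1, rfl⟩, norm_smul_radProj z⟩

lemma lintegral_surf {h : Sph m → ℝ≥0∞} (hh : Measurable h) :
    ∫⁻ x, h x ∂(surf m) =
      ((m + 1 : ℕ) : ℝ≥0∞) * ∫⁻ z in Metric.ball (0 : Amb m) 1 \ {0}, h (radProj z) := by
  rw [surf_eq_map, lintegral_smul_measure, lintegral_map hh measurable_radProj, smul_eq_mul]

variable {a : Sph m} {t : ℝ}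

/-- The positively homogeneous extension of `mob a t`. -/
def mobRad (a : Sph m) (t : ℝ) (z : Amb m) : Amb m := ‖z‖ • mobExt a t (‖z‖⁻¹ • z)

lemma mobRad_eq (ht : 1 < t) (z : Amb m) : mobRad a t z = ‖z‖ • (mob a t ht (radProj z) : Amb m) := by
  rcases eq_or_ne z 0 with rfl | hz
  · simp [mobRad]
  · rw [mobRad, coe_mob, coe_radProj hz]

lemma mobRad_smul {r : ℝ} (hr : 0 < r) (ht : 1 < t) (x : Sph m) :
    mobRad a t (r • (x : Amb m)) = r • (mob a t ht x : Amb m) := by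
  rw [mobRad_eq ht, radProj_smul hr, norm_smul, norm_coe_sph, mul_one, Real.norm_eq_abs,
    abs_of_pos hr]

/-- The derivative of `mobRad`. -/
def mobRadDeriv (a : Sph m) (t : ℝ) (x : Amb m) : Amb m →L[ℝ] Amb m :=
  (mobLin a t x : Amb m →L[ℝ] Amb m) ∘L
    (mobFac a t x • ContinuousLinearMap.id ℝ (Amb m) +
      (1 - mobFac a t x) • (innerSL ℝ x).smulRight x)

lemma hasFDerivAt_mobRad (ht : 1 < t) {z : Amb m} (hz : z ≠ 0) :
    HasFDerivAt (mobRad a t) (mobRadDeriv a t (radProj z)) z := by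
  have hz' : ‖z‖ ≠ 0 := norm_ne_zero_iff.2 hz
  have h0 := hasFDerivAt_mobExt (coe_ne_smul (a := a) ht (radProj z))
  have h5 := mobLin_self (a := a) ht (radProj z)
  rw [mobRadDeriv]
  rw [coe_radProj hz] at h0 h5 ⊢
  have h1 := HasFDerivAt.comp (f := fun z : Amb m => ‖z‖⁻¹ • z) z h0 (hasFDerivAt_inv_norm_smul hz)
  have h2 := (hasFDerivAt_norm_of_ne hz).smul h1
  refine h2.congr_fderiv ?_
  ext1 v
  simp only [add_apply, smul_apply,
    sub_apply, ContinuousLinearMap.smulRight_apply, innerSL_apply_apply,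
    ContinuousLinearMap.id_apply, ContinuousLinearMap.comp_apply, Function.comp]
  rw [← h5]
  generalize ‖z‖⁻¹ • z = u
  have hL : ∀ w, (mobLin a t u : Amb m →L[ℝ] Amb m) w = mobLin a t u w := fun _ => rfl
  simp only [hL, map_smul, map_sub, map_add]
  match_scalars <;> field_simp
  ring

/-- Up to an isometry, the derivative is `κ` on the tangent space, of dimension `m`, and `1` in the
radial direction. It is factored as `κ` times a rank-one perturbation of the identity, whose
determinant is `1 + (1 - κ) / κ`. -/
lemma abs_det_mobRadDeriv (ht : 1 < t) (x : Sph m) :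
    |(mobRadDeriv a t x).det| = mobFac a t x ^ m := by
  have hκ := mobFac_pos ht (coe_ne_smul (a := a) ht x)
  set κ := mobFac a t (x : Amb m) with hκdef
  have h1 : (mobRadDeriv a t x : Amb m →ₗ[ℝ] Amb m) =
      ((mobLin a t x).toLinearEquiv : Amb m →ₗ[ℝ] Amb m) ∘ₗ
        (κ • LinearMap.transvection (innerₛₗ ℝ (x : Amb m)) (((1 - κ) / κ) • (x : Amb m))) := by
    ext1 v
    simp only [mobRadDeriv, LinearMap.transvection, ContinuousLinearMap.coe_coe,
      ContinuousLinearMap.comp_apply, LinearMap.comp_apply, LinearMap.smul_apply]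
    simp only [add_apply, smul_apply,
      ContinuousLinearMap.smulRight_apply, innerSL_apply_apply, ContinuousLinearMap.id_apply,
      ← hκdef]
    change mobLin a t x _ = mobLin a t x _
    congr 1
    simp
    match_scalars
    field_simp
  rw [ContinuousLinearMap.det, h1, LinearMap.det_comp, abs_mul]
  have h2 : |LinearMap.det ((mobLin a t (x : Amb m)).toLinearEquiv : Amb m →ₗ[ℝ] Amb m)| = 1 := by
    have h3 : LinearMap.det ((mobLin a t (x : Amb m)).toLinearEquiv : Amb m →ₗ[ℝ] Amb m) =
        LinearMap.det ((ℝ ∙ (a : Amb m))ᗮ.reflection.toLinearMap) *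
        LinearMap.det ((ℝ ∙ ((x : Amb m) - t • (a : Amb m)))ᗮ.reflection.toLinearMap) := by
      rw [← LinearMap.det_comp]
      rfl
    rw [h3, Submodule.det_reflection, Submodule.det_reflection]
    simp
  rw [h2, LinearMap.det_smul, LinearMap.transvection.det]
  simp only [finrank_euclideanSpace, Fintype.card_fin, one_mul]
  have h3 : innerₛₗ ℝ (x : Amb m) (((1 - κ) / κ) • (x : Amb m)) = (1 - κ) / κ := by
    simp
  rw [h3]
  have h4 : κ ^ (m + 1) * (1 + (1 - κ) / κ) = κ ^ m := by
    field_simp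
    ring
  rw [h4, abs_of_pos (by positivity)]

/-- The homogeneous extension preserves norms and covers the dilation, so it maps cones in the ball
to cones in the ball. -/
lemma preimage_radProj_eq_image (ht : 1 < t) (s : Set (Sph m)) :
    mobRad a t '' ((radProj ⁻¹' (mob a t ht ⁻¹' s)) ∩ (Metric.ball 0 1 \ {0})) =
      (radProj ⁻¹' s) ∩ (Metric.ball 0 1 \ {0}) := by
  have hpos : ∀ z : Amb m, z ≠ 0 → 0 < ‖z‖ := fun z hz => norm_pos_iff.2 hz
  ext z
  constructor
  · rintro ⟨y, ⟨hy, hy1, hy0⟩, rfl⟩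
    rw [mobRad_eq ht]
    refine ⟨?_, ?_, ?_⟩
    · rw [Set.mem_preimage, radProj_smul (hpos y hy0)]
      exact hy
    · simpa [norm_smul, -coe_mob] using hy1
    · rw [Set.mem_singleton_iff, ← norm_eq_zero, norm_smul, norm_coe_sph, mul_one, norm_norm]
      exact (hpos y hy0).ne'
  · rintro ⟨hz, hz1, hz0⟩
    have h0 := hpos z hz0
    refine ⟨‖z‖ • ((mob a t ht).symm (radProj z) : Amb m), ⟨?_, ?_, ?_⟩, ?_⟩
    · simpa [radProj_smul h0] using hz
    · simpa [norm_smul] using hz1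
    · rw [Set.mem_singleton_iff, ← norm_eq_zero, norm_smul, norm_coe_sph, mul_one, norm_norm]
      exact h0.ne'
    · rw [mobRad_smul h0 ht, Homeomorph.apply_symm_apply, norm_smul_radProj]

lemma continuous_mobFac (ht : 1 < t) : Continuous fun x : Sph m => mobFac a t x :=
  contDiffOn_mobFac.continuousOn.comp_continuous continuous_subtype_val fun x => coe_ne_smul ht x

lemma measurable_mobFac_pow (ht : 1 < t) :
    Measurable fun x : Sph m => ENNReal.ofReal (mobFac a t x ^ m) :=
  ((continuous_mobFac ht).pow m).measurable.ennreal_ofReal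

lemma injOn_mobRad (ht : 1 < t) : Set.InjOn (mobRad a t) {0}ᶜ := by
  intro y hy z hz h
  have hpos : ∀ z : Amb m, z ≠ 0 → 0 < ‖z‖ := fun z hz => norm_pos_iff.2 hz
  rw [mobRad_eq ht, mobRad_eq ht] at h
  have h1 : ‖y‖ = ‖z‖ := by
    have := congrArg norm h
    simpa [norm_smul, -coe_mob] using this
  have h2 := congrArg radProj h
  rw [radProj_smul (hpos y hy), radProj_smul (hpos z hz)] at h2
  rw [← norm_smul_radProj y, ← norm_smul_radProj z, (mob a t ht).injective h2, h1]

/-- The conformal dilation changes the surface measure by the density `mobFac ^ m`. -/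
lemma map_withDensity_mob (ht : 1 < t) :
    ((surf m).withDensity fun x => ENNReal.ofReal (mobFac a t x ^ m)).map (mob a t ht) = surf m := by
  have hmeas := measurable_mobFac_pow (a := a) ht
  ext s hs
  have hs' : MeasurableSet (mob a t ht ⁻¹' s) := (mob a t ht).measurable hs
  rw [Measure.map_apply (mob a t ht).measurable hs, withDensity_apply _ hs',
    ← lintegral_indicator hs', lintegral_surf (hmeas.indicator hs'), surf_eq_map,
    Measure.smul_apply, Measure.map_apply measurable_radProj hs, smul_eq_mul,
    Measure.restrict_apply (measurable_radProj hs), ← preimage_radProj_eq_image ht]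
  congr 1
  have hB : MeasurableSet ((radProj ⁻¹' (mob a t ht ⁻¹' s)) ∩ (Metric.ball (0 : Amb m) 1 \ {0})) :=
    (measurable_radProj hs').inter (measurableSet_ball.diff (measurableSet_singleton _))
  have key := lintegral_image_eq_lintegral_abs_det_fderiv_mul (volume : Measure (Amb m)) hB
    (fun z hz => (hasFDerivAt_mobRad (a := a) ht hz.2.2).hasFDerivWithinAt)
    ((injOn_mobRad ht).mono fun z hz => hz.2.2) (fun _ => 1)
  simp only [lintegral_one, Measure.restrict_apply_univ, mul_one, abs_det_mobRadDeriv ht] at key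
  rw [key, ← Measure.restrict_restrict (measurable_radProj hs'),
    ← lintegral_indicator (measurable_radProj hs')]
  rfl

lemma lintegral_mob (ht : 1 < t) (h : Sph m → ℝ≥0∞) :
    ∫⁻ x, ENNReal.ofReal (mobFac a t x ^ m) * h (mob a t ht x) ∂(surf m) = ∫⁻ x, h x ∂(surf m) := by
  conv_rhs => rw [← map_withDensity_mob (a := a) ht]
  have := lintegral_map_equiv (μ := (surf m).withDensity fun x => ENNReal.ofReal (mobFac a t x ^ m))
    h (mob a t ht).toMeasurableEquiv
  rw [Homeomorph.toMeasurableEquiv_coe] at this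
  rw [this, lintegral_withDensity_eq_lintegral_mul_non_measurable]
  · rfl
  · exact measurable_mobFac_pow ht
  · simp

lemma integral_mob {E : Type*} [NormedAddCommGroup E] [NormedSpace ℝ E] (ht : 1 < t)
    (h : Sph m → E) :
    ∫ x, mobFac a t x ^ m • h (mob a t ht x) ∂(surf m) = ∫ x, h x ∂(surf m) := by
  conv_rhs => rw [← map_withDensity_mob (a := a) ht]
  have := integral_map_equiv (μ := (surf m).withDensity fun x => ENNReal.ofReal (mobFac a t x ^ m))
    (mob a t ht).toMeasurableEquiv h
  rw [Homeomorph.toMeasurableEquiv_coe] at this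
  rw [this]
  have h2 := integral_withDensity_eq_integral_smul (μ := surf m)
    (f := fun x => Real.toNNReal (mobFac a t x ^ m))
    ((continuous_mobFac ht).pow m).measurable.real_toNNReal (fun x => h (mob a t ht x))
  refine Eq.trans ?_ h2.symm
  refine integral_congr_ae (Eventually.of_forall fun x => ?_)
  simp only [NNReal.smul_def]
  rw [Real.coe_toNNReal _ (pow_nonneg (mobFac_pos ht (coe_ne_smul ht x)).le m)]

lemma quasiMeasurePreserving_mob (ht : 1 < t) :
    Measure.QuasiMeasurePreserving (mob a t ht) (surf m) (surf m) := by
  refine ⟨(mob a t ht).measurable, ?_⟩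
  intro s hs
  obtain ⟨s', hss', hs', h0⟩ := exists_measurable_superset_of_null hs
  rw [← map_withDensity_mob (a := a) ht, Measure.map_apply (mob a t ht).measurable hs',
    withDensity_apply_eq_zero (measurable_mobFac_pow ht)] at h0
  refine measure_mono_null hss' ?_
  rw [Measure.map_apply (mob a t ht).measurable hs']
  convert h0 using 2
  ext x
  simp [pow_pos (mobFac_pos ht (coe_ne_smul (a := a) ht x)) m]

/-- The cone over a point lies in a line, a proper subspace as `m + 1 ≥ 2`. -/
lemma surf_singleton (hm : 1 ≤ m) (q : Sph m) : surf m {q} = 0 := by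
  rw [surf, Measure.toSphere_apply' _ (measurableSet_singleton q)]
  refine mul_eq_zero_of_right _ (measure_mono_null (t := (ℝ ∙ (q : Amb m) : Set (Amb m))) ?_ ?_)
  · rintro _ ⟨r, _, _, ⟨x, rfl, rfl⟩, rfl⟩
    exact Submodule.smul_mem _ _ (Submodule.mem_span_singleton_self _)
  · refine Measure.addHaar_submodule _ _ fun h => ?_
    have h1 := finrank_span_singleton (K := ℝ) (v := (q : Amb m))
      (by rw [← norm_ne_zero_iff]; simp)
    rw [h, finrank_top, finrank_euclideanSpace, Fintype.card_fin] at h1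
    omega

end SurfaceMeasure

end SphereMaps

end

noncomputable section


namespace SphereMaps

open Filter Topology

/-! ### Divergence theorem and weak derivatives on the sphere. -/

section Divergence

variable {m : ℕ}

/-- Polar coordinates, for a product of a radial and an angular function. -/
lemma integral_norm_mul_radProj (g : ℝ → ℝ) (h : Sph m → ℝ) :
    ∫ z : Amb m, g ‖z‖ * h (radProj z) =
      (∫ r in Set.Ioi (0 : ℝ), r ^ m * g r) * ∫ x, h x ∂(surf m) := by
  have e1 : ∀ z : ({0}ᶜ : Set (Amb m)), (homeomorphUnitSphereProd (Amb m) z).1 = radProj (z : Amb m) := by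
    intro z
    apply Subtype.ext
    rw [coe_radProj z.2]
    simp
  calc
    ∫ z : Amb m, g ‖z‖ * h (radProj z)
      = ∫ z : ({0}ᶜ : Set (Amb m)), g ‖z.1‖ * h (radProj z.1) ∂((volume : Measure (Amb m)).comap (↑)) := by
      rw [integral_subtype_comap (measurableSet_singleton _).compl
        fun z : Amb m => g ‖z‖ * h (radProj z), restrict_compl_singleton]
    _ = ∫ x, h x.1 * g x.2 ∂(surf m).prod (.volumeIoiPow m) := by
      have := (volume : Measure (Amb m)).measurePreserving_homeomorphUnitSphereProd.integral_comp
        (Homeomorph.measurableEmbedding _)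
        (fun x : Sph m × Set.Ioi (0 : ℝ) => h x.1 * g x.2)
      rw [finrank_euclideanSpace, Fintype.card_fin, Nat.add_sub_cancel] at this
      rw [← this]
      refine integral_congr_ae (Eventually.of_forall fun z => ?_)
      simp only [e1, homeomorphUnitSphereProd_apply_snd_coe]
      ring
    _ = (∫ x, h x ∂(surf m)) * ∫ r : Set.Ioi (0 : ℝ), g r ∂(.volumeIoiPow m) :=
      integral_prod_mul (fun x => h x) (fun r : Set.Ioi (0 : ℝ) => g r)
    _ = _ := by
      rw [mul_comm]
      congr 1
      simp only [Measure.volumeIoiPow, ENNReal.ofReal]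
      rw [integral_withDensity_eq_integral_smul,
        integral_subtype_comap measurableSet_Ioi fun a ↦ Real.toNNReal (a ^ m) • g a,
        setIntegral_congr_fun measurableSet_Ioi fun x hx ↦ ?_]
      · rw [NNReal.smul_def, Real.coe_toNNReal _ (pow_nonneg hx.out.le _), smul_eq_mul]
      · exact (measurable_subtype_coe.pow_const _).real_toNNReal

lemma integral_fderiv_eq_zero_of_hasCompactSupport {g : Amb m → ℝ} (hg : ContDiff ℝ 1 g)
    (hc : HasCompactSupport g) (v : Amb m) : ∫ z, fderiv ℝ g z v = 0 := by
  have h1 : Continuous fun z => fderiv ℝ g z v :=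
    (hg.continuous_fderiv one_ne_zero).clm_apply continuous_const
  have h2 : HasCompactSupport fun z => fderiv ℝ g z v := by
    refine (hc.fderiv (𝕜 := ℝ)).comp_left (g := fun L : Amb m →L[ℝ] ℝ => L v) ?_
    simp
  have := integral_mul_fderiv_eq_neg_fderiv_mul_of_integrable (μ := (volume : Measure (Amb m)))
    (f := fun _ : Amb m => (1 : ℝ)) (g := g) (v := v) (by simp)
    (by simpa using h1.integrable_of_hasCompactSupport h2)
    (by simpa using hg.continuous.integrable_of_hasCompactSupport hc) (by simp)
    (fun x _ => (hg.differentiable one_ne_zero) x)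
  simpa using this

lemma trace_eq_sum_coord (L : Amb m →ₗ[ℝ] Amb m) :
    LinearMap.trace ℝ (Amb m) L = ∑ i, L (EuclideanSpace.single i 1) i := by
  rw [LinearMap.trace_eq_sum_inner L (EuclideanSpace.basisFun (Fin (m + 1)) ℝ)]
  simp [EuclideanSpace.inner_single_left]

lemma integral_trace_fderiv_eq_zero {Z : Amb m → Amb m} (hZ : ContDiff ℝ 1 Z)
    (hc : HasCompactSupport Z) :
    ∫ z, LinearMap.trace ℝ (Amb m) (fderiv ℝ Z z : Amb m →ₗ[ℝ] Amb m) = 0 := by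
  simp only [trace_eq_sum_coord, ContinuousLinearMap.coe_coe]
  have hcoord : ∀ i, ContDiff ℝ 1 fun z => Z z i := fun i => (contDiff_euclidean.1 hZ) i
  have hsupp : ∀ i, HasCompactSupport fun z => Z z i := fun i =>
    hc.comp_left (g := fun y : Amb m => y i) rfl
  have hd : ∀ z i, fderiv ℝ Z z (EuclideanSpace.single i 1) i =
      fderiv ℝ (fun z => Z z i) z (EuclideanSpace.single i 1) := by
    intro z i
    have h1 := (hZ.differentiable one_ne_zero z).hasFDerivAt
    have h2 := ((EuclideanSpace.proj i : Amb m →L[ℝ] ℝ).hasFDerivAt (x := Z z)).comp z h1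
    have h3 : HasFDerivAt (fun z => Z z i) _ z := h2
    rw [h3.fderiv]
    rfl
  simp only [hd]
  rw [integral_finsetSum]
  · exact Finset.sum_eq_zero fun i _ =>
      integral_fderiv_eq_zero_of_hasCompactSupport (hcoord i) (hsupp i) _
  · intro i _
    have h1 : Continuous fun z => fderiv ℝ (fun z => Z z i) z (EuclideanSpace.single i 1) :=
      ((hcoord i).continuous_fderiv one_ne_zero).clm_apply continuous_const
    refine h1.integrable_of_hasCompactSupport ?_
    refine ((hsupp i).fderiv (𝕜 := ℝ)).comp_left
      (g := fun L : Amb m →L[ℝ] ℝ => L (EuclideanSpace.single i 1)) ?_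
    simp

/-- The divergence theorem on the sphere. -/
lemma integral_sphereDiv {X : Amb m → Amb m} (hX : ∀ x : Sph m, ContDiffAt ℝ 1 X x)
    (hT : ∀ x : Sph m, inner ℝ (X x) (x : Amb m) = 0) :
    ∫ x : Sph m, sphereDiv X x ∂(surf m) = 0 := by
  let η : ContDiffBump (1 : ℝ) := ⟨1 / 4, 1 / 2, by norm_num, by norm_num⟩
  -- The field is extended by degree-zero homogeneity and cut off to an annulus. Its Euclidean
  -- divergence is then a radial factor times the spherical divergence, and integrates to `0`.
  let Z : Amb m → Amb m := fun z => η ‖z‖ • X (‖z‖⁻¹ • z)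
  have hη0 : ∀ r : ℝ, r ≤ 1 / 2 → η r = 0 := fun r hr => by
    refine η.zero_of_le_dist ?_
    change (1 / 2 : ℝ) ≤ _
    rw [Real.dist_eq, abs_sub_comm]
    exact le_trans (by linarith) (le_abs_self _)
  have hη2 : ∀ r : ℝ, 2 ≤ r → η r = 0 := fun r hr => by
    refine η.zero_of_le_dist ?_
    change (1 / 2 : ℝ) ≤ _
    rw [Real.dist_eq]
    exact le_trans (by linarith) (le_abs_self _)
  have hZ : ContDiff ℝ 1 Z := by
    rw [contDiff_iff_contDiffAt]
    intro z
    rcases eq_or_ne z 0 with rfl | hz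
    · refine (contDiffAt_const (c := (0 : Amb m))).congr_of_eventuallyEq ?_
      filter_upwards [Metric.ball_mem_nhds (0 : Amb m) (by norm_num : (0 : ℝ) < 1 / 2)] with y hy
      rw [Metric.mem_ball, dist_zero_right] at hy
      simp [Z, hη0 _ hy.le]
    · have h1 : ContDiffAt ℝ 1 X (‖z‖⁻¹ • z) := by
        rw [← coe_radProj hz]; exact hX _
      have h2 : ContDiffAt ℝ 1 (fun z : Amb m => ‖z‖) z := contDiffAt_norm ℝ hz
      have h3 : ContDiffAt ℝ 1 (fun z : Amb m => ‖z‖⁻¹ • z) z :=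
        (h2.inv (norm_ne_zero_iff.2 hz)).smul contDiffAt_id
      exact (η.contDiff.contDiffAt.comp z h2).smul
        (ContDiffAt.comp (f := fun z : Amb m => ‖z‖⁻¹ • z) z h1 h3)
  have hc : HasCompactSupport Z := by
    refine HasCompactSupport.of_support_subset_isCompact (isCompact_closedBall (0 : Amb m) 2) ?_
    intro z hz
    rw [mem_closedBall_zero_iff]
    by_contra h
    exact hz (by simp [Z, hη2 _ (not_le.1 h).le])
  have htr : ∀ z : Amb m, LinearMap.trace ℝ (Amb m) (fderiv ℝ Z z : Amb m →ₗ[ℝ] Amb m) =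
      (η ‖z‖ * ‖z‖⁻¹) * sphereDiv X (radProj z) := by
    intro z
    rcases eq_or_ne z 0 with rfl | hz
    · have : Z =ᶠ[𝓝 0] fun _ => 0 := by
        filter_upwards [Metric.ball_mem_nhds (0 : Amb m) (by norm_num : (0 : ℝ) < 1 / 2)] with y hy
        rw [Metric.mem_ball, dist_zero_right] at hy
        simp [Z, hη0 _ hy.le]
      rw [this.fderiv_eq]
      simp
    · have hx : HasFDerivAt X (fderiv ℝ X (‖z‖⁻¹ • z)) (‖z‖⁻¹ • z) := by
        have := ((hX (radProj z)).differentiableAt one_ne_zero).hasFDerivAt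
        rwa [coe_radProj hz] at this
      -- Tangency removes the contribution of the derivative of the cut-off, which is radial.
      have hu : inner ℝ (‖z‖⁻¹ • z) (X (‖z‖⁻¹ • z)) = 0 := by
        have := hT (radProj z)
        rwa [coe_radProj hz, real_inner_comm] at this
      have hη : HasFDerivAt (fun z : Amb m => η ‖z‖) _ z :=
        (η.contDiff.differentiable one_ne_zero ‖z‖).hasDerivAt.comp_hasFDerivAt z
          (hasFDerivAt_norm_of_ne hz)
      have h1 := hη.smul (HasFDerivAt.comp (f := fun z : Amb m => ‖z‖⁻¹ • z) z hx
        (hasFDerivAt_inv_norm_smul hz))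
      have h2 : HasFDerivAt Z _ z := h1
      simp only [Function.comp_apply] at h2
      rw [h2.fderiv, sphereDiv, coe_radProj hz]
      generalize ‖z‖⁻¹ • z = u at *
      have key : ∀ (b c : ℝ) (D : Amb m →L[ℝ] Amb m) (v : Amb m), inner ℝ u v = 0 →
          LinearMap.trace ℝ (Amb m) ((b • (D ∘L (‖z‖⁻¹ • (ContinuousLinearMap.id ℝ (Amb m) -
            (innerSL ℝ u).smulRight u))) + (c • innerSL ℝ u).smulRight v : Amb m →L[ℝ] Amb m) :
              Amb m →ₗ[ℝ] Amb m) =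
          b * ‖z‖⁻¹ * (LinearMap.trace ℝ (Amb m) (D : Amb m →ₗ[ℝ] Amb m) - inner ℝ (D u) u) := by
        intro b c D v hv
        have e : ((b • (D ∘L (‖z‖⁻¹ • (ContinuousLinearMap.id ℝ (Amb m) -
            (innerSL ℝ u).smulRight u))) + (c • innerSL ℝ u).smulRight v : Amb m →L[ℝ] Amb m) :
              Amb m →ₗ[ℝ] Amb m) =
            (b * ‖z‖⁻¹) • ((D : Amb m →ₗ[ℝ] Amb m) - (innerₛₗ ℝ u).smulRight (D u)) +
              (c • innerₛₗ ℝ u).smulRight v := by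
          ext1 w
          simp
          module
        rw [e, map_add, map_smul, map_sub, LinearMap.trace_smulRight, LinearMap.trace_smulRight]
        simp [hv, real_inner_comm]
      exact key _ _ _ _ hu
  have h0 := integral_trace_fderiv_eq_zero hZ hc
  simp only [htr] at h0
  have hsup : ∀ r : ℝ, r ≤ 1 / 2 → r ^ m * (η r * r⁻¹) = 0 := fun r hr => by simp [hη0 r hr]
  have h3 := (integral_norm_mul_radProj (fun r => η r * r⁻¹) (fun x : Sph m => sphereDiv X x)).symm.trans h0
  -- The radial integral is positive, so the spherical factor is the one that vanishes.
  refine (mul_eq_zero.1 h3).resolve_left (ne_of_gt ?_)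
  have hcont : Continuous fun r : ℝ => r ^ m * (η r * r⁻¹) := by
    rw [continuous_iff_continuousAt]
    intro r
    rcases lt_or_ge r (1 / 2) with hr | hr
    · refine (continuousAt_const (y := (0 : ℝ))).congr ?_
      filter_upwards [gt_mem_nhds hr] with y hy using (hsup y hy.le).symm
    · exact (continuousAt_id.pow m).mul (η.continuous.continuousAt.mul
        (continuousAt_inv₀ (by linarith)))
  rw [setIntegral_eq_integral_of_forall_compl_eq_zero
    (fun r hr => hsup r (by simp at hr; linarith))]
  refine hcont.integral_pos_of_hasCompactSupport_nonneg_nonzero ?_ (x := 1) ?_ ?_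
  · refine HasCompactSupport.of_support_subset_isCompact (isCompact_Icc (a := 0) (b := 2)) ?_
    intro r hr
    constructor
    · by_contra h
      exact hr (hsup r (by linarith))
    · by_contra h
      exact hr (by simp [hη2 r (by linarith)])
  · intro r
    rcases lt_or_ge r (1 / 2) with hr | hr
    · exact (hsup r hr.le).ge
    · have := η.nonneg (x := r)
      positivity
  · have : η 1 = 1 := η.one_of_mem_closedBall (by simp; norm_num)
    simp [this]

lemma sphereDiv_smul {w : Amb m → ℝ} {X : Amb m → Amb m} {x : Sph m} (hw : DifferentiableAt ℝ w x)
    (hX : DifferentiableAt ℝ X x) (hT : inner ℝ (X x) (x : Amb m) = 0) :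
    sphereDiv (fun z => w z • X z) x = w x * sphereDiv X x + fderiv ℝ w x (X x) := by
  have h := (hw.hasFDerivAt.smul hX.hasFDerivAt).fderiv
  have e : ((w x • fderiv ℝ X x + (fderiv ℝ w x).smulRight (X x) : Amb m →L[ℝ] Amb m) :
      Amb m →ₗ[ℝ] Amb m) = w x • (fderiv ℝ X x : Amb m →ₗ[ℝ] Amb m) +
        (fderiv ℝ w x : Amb m →ₗ[ℝ] ℝ).smulRight (X x) := rfl
  change LinearMap.trace ℝ (Amb m) (fderiv ℝ (w • X) x : Amb m →ₗ[ℝ] Amb m) -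
    inner ℝ (fderiv ℝ (w • X) x x) (x : Amb m) = _
  rw [h, e, map_add, map_smul, LinearMap.trace_smulRight, sphereDiv]
  simp [inner_add_left, inner_smul_left, hT]
  ring

lemma continuous_sphereDiv {X : Amb m → Amb m} (hX : ∀ x : Sph m, ContDiffAt ℝ 1 X x) :
    Continuous fun x : Sph m => sphereDiv X x := by
  have h : Continuous fun x : Sph m => fderiv ℝ X x := by
    rw [continuous_iff_continuousAt]
    intro x
    exact ((hX x).continuousAt_fderiv one_ne_zero).comp continuous_subtype_val.continuousAt
  unfold sphereDiv
  simp only [trace_eq_sum_coord, ContinuousLinearMap.coe_coe]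
  have h2 : ∀ i, Continuous fun x : Sph m =>
      fderiv ℝ X x (EuclideanSpace.single i (1 : ℝ)) i := fun i =>
    (EuclideanSpace.proj i : Amb m →L[ℝ] ℝ).continuous.comp (h.clm_apply continuous_const)
  exact (continuous_finsetSum _ fun i _ => h2 i).sub
    ((h.clm_apply continuous_subtype_val).inner continuous_subtype_val)

lemma contDiffAt_sphereDiv {X : Amb m → Amb m} {x : Amb m} (hX : ContDiffAt ℝ 2 X x) :
    ContDiffAt ℝ 1 (sphereDiv X) x := by
  have h : ContDiffAt ℝ 1 (fderiv ℝ X) x := hX.fderiv_right (by norm_num)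
  have e : sphereDiv X = fun x => ∑ i, fderiv ℝ X x (EuclideanSpace.single i (1 : ℝ)) i -
      inner ℝ (fderiv ℝ X x x) x := by
    ext x
    simp only [sphereDiv, trace_eq_sum_coord, ContinuousLinearMap.coe_coe]
  rw [e]
  have h2 : ∀ i, ContDiffAt ℝ 1 (fun x => fderiv ℝ X x (EuclideanSpace.single i (1 : ℝ)) i) x :=
    fun i => (EuclideanSpace.proj i : Amb m →L[ℝ] ℝ).contDiff.contDiffAt.comp x
      (h.clm_apply contDiffAt_const)
  exact (ContDiffAt.sum fun i _ => h2 i).sub ((h.clm_apply contDiffAt_id).inner ℝ contDiffAt_id)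

lemma Continuous.integrable_surf {F : Type*} [NormedAddCommGroup F] {v : Sph m → F}
    [SecondCountableTopologyEither (Sph m) F] (hv : Continuous v) : Integrable v (surf m) :=
  hv.integrable_of_hasCompactSupport (HasCompactSupport.of_compactSpace v)

lemma continuous_fderiv_apply_sph {F : Type*} [NormedAddCommGroup F] [NormedSpace ℝ F]
    {w : Amb m → F} {X : Amb m → Amb m} (hw : ∀ x : Sph m, ContDiffAt ℝ 1 w x)
    (hX : ∀ x : Sph m, ContinuousAt X x) : Continuous fun x : Sph m => fderiv ℝ w x (X x) := by
  rw [continuous_iff_continuousAt]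
  intro x
  exact (((hw x).continuousAt_fderiv one_ne_zero).comp continuous_subtype_val.continuousAt).clm_apply
    (ContinuousAt.comp (f := ((↑) : Sph m → Amb m)) (hX x) continuous_subtype_val.continuousAt)

lemma integral_mul_sphereDiv {w : Amb m → ℝ} {X : Amb m → Amb m}
    (hw : ∀ x : Sph m, ContDiffAt ℝ 1 w x) (hX : ∀ x : Sph m, ContDiffAt ℝ 1 X x)
    (hT : ∀ x : Sph m, inner ℝ (X x) (x : Amb m) = 0) :
    ∫ x : Sph m, w x * sphereDiv X x ∂(surf m) =
      - ∫ x : Sph m, fderiv ℝ w x (X x) ∂(surf m) := by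
  have h := integral_sphereDiv (X := fun z => w z • X z) (fun x => (hw x).smul (hX x))
    (fun x => by rw [inner_smul_left, hT, mul_zero])
  have h1 : ∀ x : Sph m, sphereDiv (fun z => w z • X z) x =
      w x * sphereDiv X x + fderiv ℝ w x (X x) := fun x =>
    sphereDiv_smul ((hw x).differentiableAt one_ne_zero) ((hX x).differentiableAt one_ne_zero) (hT x)
  have hwc : Continuous fun x : Sph m => w x := by
    rw [continuous_iff_continuousAt]
    intro x
    exact ContinuousAt.comp (f := ((↑) : Sph m → Amb m)) (hw x).continuousAt
      continuous_subtype_val.continuousAt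
  simp only [h1] at h
  have i1 : Integrable (fun x : Sph m => w x * sphereDiv X x) (surf m) :=
    Continuous.integrable_surf (hwc.mul (continuous_sphereDiv hX))
  rw [integral_add i1 (Continuous.integrable_surf
    (continuous_fderiv_apply_sph hw fun x => (hX x).continuousAt))] at h
  linarith

/-- The orthogonal projection on the tangent space of the sphere at `x`. -/
def tanProj (x : Amb m) : Amb m →L[ℝ] Amb m :=
  ContinuousLinearMap.id ℝ (Amb m) - (innerSL ℝ x).smulRight x

lemma tanProj_self (x : Sph m) : tanProj (x : Amb m) x = 0 := by
  simp [tanProj]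

lemma tanProj_of_inner_eq_zero {x v : Amb m} (h : inner ℝ v x = 0) : tanProj x v = v := by
  rw [real_inner_comm] at h
  simp [tanProj, h]

lemma continuous_tanProj : Continuous (tanProj : Amb m → Amb m →L[ℝ] Amb m) := by
  unfold tanProj
  exact continuous_const.sub
    (((ContinuousLinearMap.smulRightL ℝ (Amb m) (Amb m)).continuous₂).comp
      ((innerSL ℝ).continuous.prodMk continuous_id))

/-- Classical derivatives are weak derivatives. -/
lemma hasWeakDeriv_of_contDiffAt {w : Amb m → ℝ} (hw : ∀ x : Sph m, ContDiffAt ℝ 1 w x) :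
    HasWeakDeriv (fun x : Sph m => w x) fun x => fderiv ℝ w x ∘L tanProj (x : Amb m) where
  integrable := by
    refine Continuous.integrable_surf ?_
    rw [continuous_iff_continuousAt]
    intro x
    exact ContinuousAt.comp (f := ((↑) : Sph m → Amb m)) (hw x).continuousAt
      continuous_subtype_val.continuousAt
  integrable_deriv := by
    refine Continuous.integrable_surf ?_
    refine Continuous.clm_comp ?_ (continuous_tanProj.comp continuous_subtype_val)
    rw [continuous_iff_continuousAt]
    intro x
    exact ((hw x).continuousAt_fderiv one_ne_zero).comp continuous_subtype_val.continuousAt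
  normal x := by
    rw [ContinuousLinearMap.comp_apply, tanProj_self, map_zero]
  integral_eq X hX hT := by
    rw [integral_mul_sphereDiv hw (fun x => (hX.of_le (by norm_num)).contDiffAt) hT]
    congr 2
    ext x
    rw [ContinuousLinearMap.comp_apply, tanProj_of_inner_eq_zero (hT x)]

lemma integrable_mul_of_continuous {u v : Sph m → ℝ} (hu : Integrable u (surf m))
    (hv : Continuous v) : Integrable (fun x => u x * v x) (surf m) := by
  obtain ⟨C, hC⟩ := isCompact_univ.exists_bound_of_continuousOn hv.continuousOn
  exact hu.mul_bdd (c := C) hv.aestronglyMeasurable (Eventually.of_forall fun x => hC x trivial)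

lemma integrable_apply_of_continuous {B : Sph m → Amb m →L[ℝ] ℝ} (hB : Integrable B (surf m))
    {X : Sph m → Amb m} (hX : Continuous X) : Integrable (fun x => B x (X x)) (surf m) := by
  obtain ⟨C, hC⟩ := isCompact_univ.exists_bound_of_continuousOn hX.continuousOn
  refine (hB.norm.mul_const C).mono' ?_ (Eventually.of_forall fun x => ?_)
  · exact isBoundedBilinearMap_apply.continuous.comp_aestronglyMeasurable
      (hB.aestronglyMeasurable.prodMk hX.aestronglyMeasurable)
  · exact ((B x).le_opNorm _).trans (mul_le_mul_of_nonneg_left (hC x trivial) (norm_nonneg _))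

lemma HasWeakDeriv.add {v v' : Sph m → ℝ} {A A' : Sph m → Amb m →L[ℝ] ℝ}
    (h : HasWeakDeriv v A) (h' : HasWeakDeriv v' A') :
    HasWeakDeriv (fun x => v x + v' x) (fun x => A x + A' x) where
  integrable := Integrable.add h.integrable h'.integrable
  integrable_deriv := by
    refine (h.integrable_deriv.norm.add h'.integrable_deriv.norm).mono'
      (h.integrable_deriv.aestronglyMeasurable.add h'.integrable_deriv.aestronglyMeasurable)
      (Eventually.of_forall fun x => norm_add_le _ _)
  normal x := by
    rw [add_apply, h.normal, h'.normal, add_zero]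
  integral_eq X hX hT := by
    have hXc : Continuous fun x : Sph m => X x := hX.continuous.comp continuous_subtype_val
    have hdiv : Continuous fun x : Sph m => sphereDiv X x :=
      continuous_sphereDiv fun x => (hX.of_le (by norm_num)).contDiffAt
    simp only [add_mul, add_apply]
    rw [integral_add (integrable_mul_of_continuous h.integrable hdiv)
      (integrable_mul_of_continuous h'.integrable hdiv), h.integral_eq X hX hT,
      h'.integral_eq X hX hT, integral_add (integrable_apply_of_continuous h.integrable_deriv hXc)
      (integrable_apply_of_continuous h'.integrable_deriv hXc)]
    ring

lemma hasWeakDeriv_const (c : ℝ) : HasWeakDeriv (fun _ : Sph m => c) fun _ => 0 := by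
  have := hasWeakDeriv_of_contDiffAt (m := m) (w := fun _ => c) fun _ => contDiffAt_const
  simpa using this

end Divergence

end SphereMaps

end

noncomputable section


namespace SphereMaps

open Filter Topology

/-! ### Pull-back of weak derivatives by conformal dilations. -/

section ConformalWeakDeriv

variable {m : ℕ}

/-- Test fields have to be smooth on the whole ambient space, whereas transported fields are
singular at the centre of an inversion. This centre is off the sphere, so the singularity can be cut
off without changing anything near the sphere. -/
lemma exists_contDiff_eventuallyEq {F : Type*} [NormedAddCommGroup F] [NormedSpace ℝ F]
    {c : Amb m} (hc : 1 < ‖c‖) {Y : Amb m → F} (hY : ContDiffOn ℝ ∞ Y {c}ᶜ) :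
    ∃ Y' : Amb m → F, ContDiff ℝ ∞ Y' ∧ ∀ x : Sph m, Y' =ᶠ[𝓝 (x : Amb m)] Y := by
  let η : ContDiffBump c := ⟨(‖c‖ - 1) / 4, (‖c‖ - 1) / 2, by linarith, by linarith⟩
  refine ⟨fun y => (1 - η y) • Y y, ?_, fun x => ?_⟩
  · rw [contDiff_iff_contDiffAt]
    intro y
    rcases eq_or_ne y c with rfl | hy
    · refine (contDiffAt_const (c := (0 : F))).congr_of_eventuallyEq ?_
      filter_upwards [η.eventuallyEq_one] with z hz
      simp [hz]
    · exact (contDiffAt_const.sub η.contDiff.contDiffAt).smul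
        (hY.contDiffAt (isOpen_compl_singleton.mem_nhds hy))
  · have hx : (‖c‖ - 1) / 2 < dist (x : Amb m) c := by
      have := norm_sub_norm_le c (x : Amb m)
      rw [norm_coe_sph, ← dist_eq_norm, dist_comm] at this
      linarith
    filter_upwards [(continuous_id.dist continuous_const).continuousAt.eventually
      (lt_mem_nhds hx)] with y hy
    have hy' : (‖c‖ - 1) / 2 < dist y c := hy
    rw [η.zero_of_le_dist hy'.le, sub_zero, one_smul]

variable {a : Sph m} {t : ℝ}

lemma norm_smul_coe (ht : 1 < t) : 1 < ‖t • (a : Amb m)‖ := by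
  rwa [norm_smul, norm_coe_sph, mul_one, Real.norm_eq_abs, abs_of_pos (by linarith)]

/-- The push-forward of the vector field `X` by `mob a t`, divided by the Jacobian. -/
def mobPush (a : Sph m) (t : ℝ) (X : Amb m → Amb m) (y : Amb m) : Amb m :=
  ((mobFac a t (mobExt (-a) t y)) ^ m)⁻¹ •
    fderiv ℝ (mobExt a t) (mobExt (-a) t y) (X (mobExt (-a) t y))

lemma contDiffOn_mobPush (ht : 1 < t) {X : Amb m → Amb m} (hX : ContDiff ℝ ∞ X) :
    ContDiffOn ℝ ∞ (mobPush a t X) {t • ((-a : Sph m) : Amb m)}ᶜ := by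
  have hmaps : Set.MapsTo (mobExt (-a) t) {t • ((-a : Sph m) : Amb m)}ᶜ {t • (a : Amb m)}ᶜ := by
    intro y hy
    have := mobExt_ne (a := -a) ht hy
    rwa [neg_neg] at this
  have h1 : ContDiffOn ℝ ∞ (fderiv ℝ (mobExt a t)) {t • (a : Amb m)}ᶜ :=
    contDiffOn_mobExt.fderiv_of_isOpen isOpen_compl_singleton (by norm_num)
  have h2 : ContDiffOn ℝ ∞ (fun y => ((mobFac a t (mobExt (-a) t y)) ^ m)⁻¹)
      {t • ((-a : Sph m) : Amb m)}ᶜ :=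
    ((contDiffOn_mobFac.comp contDiffOn_mobExt hmaps).pow m).inv fun y hy =>
      (pow_pos (mobFac_pos ht (hmaps hy)) m).ne'
  exact h2.smul ((h1.comp contDiffOn_mobExt hmaps).clm_apply (hX.comp_contDiffOn contDiffOn_mobExt))

lemma mobPush_mob (ht : 1 < t) (X : Amb m → Amb m) (x : Sph m) :
    mobPush a t X (mob a t ht x) =
      (mobFac a t x ^ m)⁻¹ • fderiv ℝ (mobExt a t) x (X x) := by
  rw [mobPush, coe_mob, mobExt_neg_mobExt ht]

lemma fderiv_mobExt (ht : 1 < t) (x : Sph m) :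
    fderiv ℝ (mobExt a t) x = mobFac a t x • (mobLin a t x : Amb m →L[ℝ] Amb m) :=
  (hasFDerivAt_mobExt (coe_ne_smul ht x)).fderiv

lemma inner_fderiv_mobExt (ht : 1 < t) (x : Sph m) (v : Amb m) :
    inner ℝ (fderiv ℝ (mobExt a t) x v) (mob a t ht x : Amb m) =
      mobFac a t x * inner ℝ v (x : Amb m) := by
  rw [fderiv_mobExt ht, coe_mob, ← mobLin_self ht]
  change inner ℝ (mobFac a t x • mobLin a t x v) _ = _
  rw [inner_smul_left, LinearIsometryEquiv.inner_map_map]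
  rfl

lemma fderiv_mobExt_self (ht : 1 < t) (x : Sph m) :
    fderiv ℝ (mobExt a t) x x = mobFac a t x • (mob a t ht x : Amb m) := by
  rw [fderiv_mobExt ht, coe_mob, ← mobLin_self ht]
  rfl

lemma inner_mobPush (ht : 1 < t) {X : Amb m → Amb m}
    (hT : ∀ x : Sph m, inner ℝ (X x) (x : Amb m) = 0) (y : Sph m) :
    inner ℝ (mobPush a t X y) (y : Amb m) = 0 := by
  obtain ⟨x, rfl⟩ := (mob a t ht).surjective y
  rw [mobPush_mob, inner_smul_left, inner_fderiv_mobExt, hT, mul_zero, mul_zero]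

lemma contDiffAt_mobExt (ht : 1 < t) (x : Sph m) : ContDiffAt ℝ ∞ (mobExt a t) x :=
  contDiffOn_mobExt.contDiffAt (isOpen_compl_singleton.mem_nhds (coe_ne_smul ht x))

lemma contDiffAt_mobPush (ht : 1 < t) {X : Amb m → Amb m} (hX : ContDiff ℝ ∞ X) (x : Sph m) :
    ContDiffAt ℝ ∞ (mobPush a t X) x :=
  (contDiffOn_mobPush ht hX).contDiffAt (isOpen_compl_singleton.mem_nhds (coe_ne_smul ht x))

/-- The divergence of the Piola transform `mobPush a t X`, tested against functions. -/
lemma integral_comp_mob_mul_sub (ht : 1 < t) {X : Amb m → Amb m} (hX : ContDiff ℝ ∞ X)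
    (hT : ∀ x : Sph m, inner ℝ (X x) (x : Amb m) = 0)
    {w : Amb m → ℝ} (hw : ∀ x : Sph m, ContDiffAt ℝ 1 w x) :
    ∫ x : Sph m, w (mob a t ht x) *
      (mobFac a t x ^ m * sphereDiv (mobPush a t X) (mob a t ht x) - sphereDiv X x) ∂(surf m) = 0 := by
  have hY : ∀ x : Sph m, ContDiffAt ℝ 1 (mobPush a t X) x := fun x =>
    (contDiffAt_mobPush ht hX x).of_le (by norm_num)
  have hX1 : ∀ x : Sph m, ContDiffAt ℝ 1 X x := fun x => (hX.of_le (by norm_num)).contDiffAt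
  have hwm : ∀ x : Sph m, ContDiffAt ℝ 1 (fun z => w (mobExt a t z)) x := fun x =>
    ContDiffAt.comp (f := mobExt a t) (x : Amb m) (hw (mob a t ht x))
      ((contDiffAt_mobExt ht x).of_le (by norm_num))
  have h1 := integral_mul_sphereDiv hw hY (inner_mobPush ht hT)
  rw [← integral_mob (a := a) ht fun x => w x * sphereDiv (mobPush a t X) x,
    ← integral_mob (a := a) ht fun x : Sph m => fderiv ℝ w x (mobPush a t X x)] at h1
  have h2 := integral_mul_sphereDiv hwm hX1 hT
  have h3 : ∀ x : Sph m, mobFac a t x ^ m •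
      fderiv ℝ w (mob a t ht x) (mobPush a t X (mob a t ht x)) =
      fderiv ℝ (fun z => w (mobExt a t z)) x (X x) := by
    intro x
    have e : HasFDerivAt (fun z => w (mobExt a t z)) _ (x : Amb m) :=
      HasFDerivAt.comp (f := mobExt a t) (x : Amb m)
        ((hw (mob a t ht x)).differentiableAt one_ne_zero).hasFDerivAt
        ((contDiffAt_mobExt ht x).differentiableAt (by norm_num)).hasFDerivAt
    rw [e.fderiv, mobPush_mob, map_smul, smul_smul, mul_inv_cancel₀, one_smul]
    · rfl
    · exact (pow_pos (mobFac_pos ht (coe_ne_smul ht x)) m).ne'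
  simp only [h3] at h1
  rw [← h2] at h1
  have hwc : Continuous fun x : Sph m => w x := by
    rw [continuous_iff_continuousAt]
    intro x
    exact ContinuousAt.comp (f := ((↑) : Sph m → Amb m)) (hw x).continuousAt
      continuous_subtype_val.continuousAt
  have hwc' := hwc.comp (mob a t ht).continuous
  have i1 : Integrable (fun x : Sph m => mobFac a t x ^ m •
      (w (mob a t ht x) * sphereDiv (mobPush a t X) (mob a t ht x))) (surf m) :=
    Continuous.integrable_surf (((continuous_mobFac ht).pow m).smul
      (hwc'.mul ((continuous_sphereDiv hY).comp (mob a t ht).continuous)))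
  have i2 : Integrable (fun x : Sph m => w (mobExt a t x) * sphereDiv X x) (surf m) :=
    Continuous.integrable_surf (hwc'.mul (continuous_sphereDiv hX1))
  rw [← sub_eq_zero, ← integral_sub i1 i2] at h1
  rw [← h1]
  congr 1
  ext x
  simp only [smul_eq_mul, coe_mob]
  ring

/-- The Piola identity is obtained by duality instead of by differentiating the Jacobian: the defect
is orthogonal to all `C^1` functions, and it is itself such a function. -/
lemma sphereDiv_mobPush (ht : 1 < t) {X : Amb m → Amb m} (hX : ContDiff ℝ ∞ X)
    (hT : ∀ x : Sph m, inner ℝ (X x) (x : Amb m) = 0) :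
    ∀ᵐ x : Sph m ∂(surf m),
      mobFac a t x ^ m * sphereDiv (mobPush a t X) (mob a t ht x) = sphereDiv X x := by
  let F : Amb m → ℝ := fun z =>
    mobFac a t z ^ m * sphereDiv (mobPush a t X) (mobExt a t z) - sphereDiv X z
  have hF : ∀ x : Sph m, ContDiffAt ℝ 1 F x := by
    intro x
    have h1 : ContDiffAt ℝ 1 (mobFac a t) (x : Amb m) := (contDiffOn_mobFac.contDiffAt
      (isOpen_compl_singleton.mem_nhds (coe_ne_smul ht x))).of_le (by norm_num)
    have h2 : ContDiffAt ℝ 1 (sphereDiv (mobPush a t X)) (mob a t ht x : Amb m) :=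
      contDiffAt_sphereDiv ((contDiffAt_mobPush ht hX _).of_le (by norm_cast))
    exact ((h1.pow m).mul (h2.comp (x : Amb m) ((contDiffAt_mobExt ht x).of_le (by norm_num)))).sub
      (contDiffAt_sphereDiv (hX.of_le (by norm_cast)).contDiffAt)
  -- The test function is the defect `F` composed with the inverse dilation, which turns the pairing
  -- into the integral of `F ^ 2`.
  have h := integral_comp_mob_mul_sub (a := a) ht hX hT (w := fun y => F (mobExt (-a) t y)) fun x =>
    ContDiffAt.comp (f := mobExt (-a) t) (x : Amb m) (hF ((mob a t ht).symm x))
      ((contDiffAt_mobExt ht x).of_le (by norm_num))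
  have hFc : Continuous fun x : Sph m => F x := by
    rw [continuous_iff_continuousAt]
    intro x
    exact ContinuousAt.comp (f := ((↑) : Sph m → Amb m)) (hF x).continuousAt
      continuous_subtype_val.continuousAt
  have e : ∀ x : Sph m, F (mobExt (-a) t (mob a t ht x)) = F x := fun x => by
    rw [coe_mob, mobExt_neg_mobExt ht]
  have h' : ∫ x : Sph m, F x * F x ∂(surf m) = 0 := by
    rw [← h]
    congr 1
    ext x
    rw [e]
    rfl
  rw [integral_eq_zero_iff_of_nonneg (fun x => mul_self_nonneg _)
    (Continuous.integrable_surf (hFc.mul hFc))] at h'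
  filter_upwards [h'] with x hx
  exact sub_eq_zero.1 (mul_self_eq_zero.1 hx)

/-- Integration by parts only sees the germ of the field along the sphere, so it extends to fields
that are singular elsewhere. -/
lemma HasWeakDeriv.congr_eventuallyEq {v : Sph m → ℝ} {A : Sph m → Amb m →L[ℝ] ℝ}
    (h : HasWeakDeriv v A) {X X' : Amb m → Amb m} (hX' : ContDiff ℝ ∞ X')
    (he : ∀ x : Sph m, X' =ᶠ[𝓝 (x : Amb m)] X)
    (hT : ∀ x : Sph m, inner ℝ (X x) (x : Amb m) = 0) :
    ∫ x : Sph m, v x * sphereDiv X x ∂(surf m) = - ∫ x : Sph m, A x (X x) ∂(surf m) := by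
  have h1 := h.integral_eq X' hX' fun x => by rw [(he x).eq_of_nhds]; exact hT x
  have h2 : ∀ x : Sph m, sphereDiv X' x = sphereDiv X x := fun x => by
    rw [sphereDiv, sphereDiv, (he x).fderiv_eq]
  have h3 : ∀ x : Sph m, X' x = X x := fun x => (he x).eq_of_nhds
  simpa only [h2, h3] using h1

/-- Weak derivatives can be pulled back by conformal dilations. -/
lemma HasWeakDeriv.comp_mob {v : Sph m → ℝ} {A : Sph m → Amb m →L[ℝ] ℝ}
    (h : HasWeakDeriv v A) (ht : 1 < t) :
    HasWeakDeriv (fun x => v (mob a t ht x))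
      fun x => A (mob a t ht x) ∘L fderiv ℝ (mobExt a t) x := by
  have hpos : ∀ x : Sph m, 0 < mobFac a t x ^ m := fun x =>
    pow_pos (mobFac_pos ht (coe_ne_smul ht x)) m
  -- A positive lower bound on the Jacobian lets integrability pass through the change of variables.
  obtain ⟨c, hc0, hc⟩ : ∃ c : ℝ, 0 < c ∧ ∀ x : Sph m, c ≤ mobFac a t x ^ m := by
    obtain ⟨x₀, -, hx₀⟩ := isCompact_univ.exists_isMinOn (s := (Set.univ : Set (Sph m))) ⟨a, trivial⟩
      ((continuous_mobFac (a := a) ht).pow m).continuousOn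
    exact ⟨_, hpos x₀, fun x => hx₀ trivial⟩
  have hint : ∀ {F : Type} [NormedAddCommGroup F] {u : Sph m → F}, Integrable u (surf m) →
      Integrable (fun x => u (mob a t ht x)) (surf m) := by
    intro F _ u hu
    refine ⟨hu.aestronglyMeasurable.comp_quasiMeasurePreserving (quasiMeasurePreserving_mob ht), ?_⟩
    rw [HasFiniteIntegral]
    have h1 : ∫⁻ x, ENNReal.ofReal c * ‖u (mob a t ht x)‖ₑ ∂(surf m) < ⊤ := by
      refine lt_of_le_of_lt ?_ ((lintegral_mob (a := a) ht fun x => ‖u x‖ₑ).trans_lt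
        hu.hasFiniteIntegral)
      exact lintegral_mono fun x => mul_le_mul_left (ENNReal.ofReal_le_ofReal (hc x)) _
    rw [lintegral_const_mul' _ _ ENNReal.ofReal_ne_top] at h1
    exact (ENNReal.mul_lt_top_iff.1 h1).elim (fun h => h.2) (fun h => h.elim
      (fun h => absurd h (by simpa using hc0)) (fun h => by rw [h]; exact ENNReal.zero_lt_top))
  have hdc : Continuous fun x : Sph m => fderiv ℝ (mobExt a t) x := by
    rw [continuous_iff_continuousAt]
    intro x
    exact ((((contDiffAt_mobExt ht x).of_le (m := 1) (by norm_num)).continuousAt_fderiv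
      one_ne_zero)).comp continuous_subtype_val.continuousAt
  refine ⟨hint h.integrable, ?_, fun x => ?_, fun X hX hT => ?_⟩
  · have h1 : Integrable (fun x => A (mob a t ht x)) (surf m) := hint h.integrable_deriv
    obtain ⟨C, hC⟩ := isCompact_univ.exists_bound_of_continuousOn hdc.continuousOn
    refine (h1.norm.mul_const C).mono' ?_ (Eventually.of_forall fun x => ?_)
    · exact isBoundedBilinearMap_comp.continuous.comp_aestronglyMeasurable
        (h1.aestronglyMeasurable.prodMk hdc.aestronglyMeasurable)
    · exact (ContinuousLinearMap.opNorm_comp_le _ _).trans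
        (mul_le_mul_of_nonneg_left (hC x trivial) (norm_nonneg _))
  · rw [ContinuousLinearMap.comp_apply, fderiv_mobExt_self ht, map_smul, h.normal, smul_zero]
  · obtain ⟨Y, hY, hYe⟩ := exists_contDiff_eventuallyEq (norm_smul_coe ht)
      (contDiffOn_mobPush (a := a) ht hX)
    have h1 := h.congr_eventuallyEq hY hYe (inner_mobPush ht hT)
    rw [← integral_mob (a := a) ht fun x => v x * sphereDiv (mobPush a t X) x,
      ← integral_mob (a := a) ht fun x => A x (mobPush a t X x)] at h1
    refine Eq.trans (integral_congr_ae ?_) (h1.trans (congrArg _ ?_))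
    · filter_upwards [sphereDiv_mobPush ht hX hT] with x hx
      rw [smul_eq_mul, ← hx]
      ring
    · congr 1
      ext x
      rw [mobPush_mob, map_smul, smul_smul, mul_inv_cancel₀ (hpos x).ne', one_smul]
      rfl

end ConformalWeakDeriv

end SphereMaps

end

noncomputable section


namespace SphereMaps

open Filter Topology

/-! ### Integrability of negative powers of the distance on the sphere. -/

section SingularIntegral

variable {m : ℕ}

lemma lintegral_polar {f : Amb m → ℝ≥0∞} (hf : Measurable f) :
    ∫⁻ z, f z = ∫⁻ x : Sph m, (∫⁻ r in Set.Ioi (0 : ℝ),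
      ENNReal.ofReal (r ^ m) * f (r • (x : Amb m))) ∂(surf m) := by
  have hmeas : Measurable fun x : Sph m × Set.Ioi (0 : ℝ) => f ((x.2 : ℝ) • (x.1 : Amb m)) :=
    hf.comp (by fun_prop)
  calc
    ∫⁻ z, f z = ∫⁻ z : ({0}ᶜ : Set (Amb m)), f z ∂((volume : Measure (Amb m)).comap (↑)) := by
      rw [lintegral_subtype_comap (measurableSet_singleton _).compl, restrict_compl_singleton]
    _ = ∫⁻ x, f ((x.2 : ℝ) • (x.1 : Amb m)) ∂(surf m).prod (.volumeIoiPow m) := by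
      have := (volume : Measure (Amb m)).measurePreserving_homeomorphUnitSphereProd.lintegral_comp_emb
        (Homeomorph.measurableEmbedding _)
        (fun x : Sph m × Set.Ioi (0 : ℝ) => f ((x.2 : ℝ) • (x.1 : Amb m)))
      rw [finrank_euclideanSpace, Fintype.card_fin, Nat.add_sub_cancel] at this
      rw [← this]
      refine lintegral_congr fun z => ?_
      congr 1
      have hz : ‖(z : Amb m)‖ ≠ 0 := norm_ne_zero_iff.2 z.2
      simp [smul_smul, hz]
    _ = ∫⁻ x : Sph m, ∫⁻ r : Set.Ioi (0 : ℝ), f ((r : ℝ) • (x : Amb m)) ∂(.volumeIoiPow m) ∂(surf m) :=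
      lintegral_prod _ hmeas.aemeasurable
    _ = _ := by
      refine lintegral_congr fun x => ?_
      have hx : Measurable fun r : Set.Ioi (0 : ℝ) => f ((r : ℝ) • (x : Amb m)) :=
        hf.comp (by fun_prop)
      rw [Measure.volumeIoiPow, lintegral_withDensity_eq_lintegral_mul _ (by fun_prop) hx]
      exact lintegral_subtype_comap measurableSet_Ioi
        fun r : ℝ => ENNReal.ofReal (r ^ m) * f (r • (x : Amb m))

/-- The integral is compared with that of `‖z‖ ^ (-γ - 1)` on a ball of dimension `m + 1`, finite
because `γ + 1 < m + 1`: thickening `y` radially by a length proportional to `dist y x` keeps the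
distance to `x` comparable and supplies the extra power. Translation invariance makes the bound
uniform in `x`. -/
lemma exists_lintegral_dist_rpow_le {γ : ℝ} (hγ0 : 0 ≤ γ) (hγ : γ < m) :
    ∃ C : ℝ≥0∞, C < ⊤ ∧ ∀ x : Sph m,
      ∫⁻ y : Sph m, ENNReal.ofReal (dist y x ^ (-γ)) ∂(surf m) ≤ C := by
  let g : Amb m → ℝ≥0∞ := fun z =>
    (Metric.ball (0 : Amb m) 3).indicator (fun z => ENNReal.ofReal (‖z‖ ^ (-γ - 1))) z
  have hg : Measurable g := by
    refine Measurable.indicator ?_ measurableSet_ball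
    fun_prop
  have hfin : ∫⁻ z, g z < ⊤ := by
    have h1 : IntegrableOn (fun x : Amb m => ‖x‖ ^ (-γ - 1)) (Metric.ball 0 3) := by
      have := (integrableOn_fun_norm_addHaar (volume : Measure (Amb m))
        (f := fun y : ℝ => y ^ (-γ - 1)) (r := 3)).2
      refine this ?_
      rw [finrank_euclideanSpace, Fintype.card_fin, Nat.add_sub_cancel]
      have h2 : IntegrableOn (fun y : ℝ => y ^ ((m : ℝ) - γ - 1)) (Set.Ioo 0 3) :=
        (intervalIntegral.integrableOn_Ioo_rpow_iff (by norm_num)).2 (by linarith)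
      refine h2.congr_fun (fun y hy => ?_) measurableSet_Ioo
      simp only [smul_eq_mul]
      rw [← Real.rpow_natCast, ← Real.rpow_add hy.1]
      ring_nf
    have h3 := h1.lintegral_lt_top
    rw [← lintegral_indicator measurableSet_ball] at h3
    exact h3
  -- On the segment `1 - d / 4 < r < 1`: `r ≥ 1 / 2`, the length is `d / 4`, and the distance to `x`
  -- is at most `5 d / 4 ≤ 2 d`. As `d ≤ 2`, this distance is also less than the radius `3` of the
  -- ball.
  let c : ℝ := (1 / 2) ^ m * (1 / 4) * 2 ^ (-γ - 1)
  have hc : 0 < c := by positivity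
  refine ⟨(ENNReal.ofReal c)⁻¹ * ∫⁻ z, g z, ENNReal.mul_lt_top (by simp [hc]) hfin, fun x => ?_⟩
  have hgx : Measurable fun z => g (z - (x : Amb m)) := hg.comp (measurable_id.sub_const _)
  rw [← lintegral_sub_right_eq_self g (x : Amb m), lintegral_polar hgx,
    ← lintegral_const_mul' _ _ (by simp [hc])]
  have hx : ∀ᵐ y ∂(surf m), y ≠ x := by
    rw [ae_iff]
    simpa using surf_singleton (by
      have : (0 : ℝ) < m := hγ0.trans_lt hγ
      exact_mod_cast this) x
  refine lintegral_mono_ae (hx.mono fun y hy => ?_)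
  rw [mul_comm, ← div_eq_mul_inv, ENNReal.le_div_iff_mul_le (by simp [hc]) (by simp),
    ← ENNReal.ofReal_mul (by positivity)]
  set d := dist y x with hd
  have hd0 : 0 < d := dist_pos.2 hy
  have hd2 : d ≤ 2 := by
    have := dist_le_norm_add_norm (y : Amb m) (x : Amb m)
    rw [norm_coe_sph, norm_coe_sph, ← Subtype.dist_eq] at this
    linarith
  calc
    ENNReal.ofReal (d ^ (-γ) * c)
      = ∫⁻ r in Set.Ioo (1 - d / 4) 1, ENNReal.ofReal ((1 / 2) ^ m * (2 * d) ^ (-γ - 1)) := by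
      rw [setLIntegral_const, Real.volume_Ioo, ← ENNReal.ofReal_mul (by positivity)]
      congr 1
      rw [Real.mul_rpow (by norm_num) hd0.le, Real.rpow_sub_one hd0.ne']
      simp only [c]
      field_simp
      ring
    _ ≤ ∫⁻ r in Set.Ioo (1 - d / 4) 1, ENNReal.ofReal (r ^ m) * g (r • (y : Amb m) - x) := by
      refine setLIntegral_mono' measurableSet_Ioo fun r hr => ?_
      have hr0 : 1 / 2 ≤ r := by linarith [hr.1]
      have e1 : r • (y : Amb m) - x = ((y : Amb m) - x) - (1 - r) • (y : Amb m) := by module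
      have e2 : ‖(1 - r) • (y : Amb m)‖ = 1 - r := by
        rw [norm_smul, norm_coe_sph, mul_one, Real.norm_eq_abs, abs_of_pos (by linarith [hr.2])]
      have e3 : ‖(y : Amb m) - x‖ = d := by rw [hd, Subtype.dist_eq, dist_eq_norm]
      have h1 : ‖r • (y : Amb m) - x‖ ≤ d + d / 4 := by
        rw [e1]
        refine (norm_sub_le _ _).trans ?_
        rw [e2, e3]
        linarith [hr.1]
      have h2 : d - d / 4 ≤ ‖r • (y : Amb m) - x‖ := by
        rw [e1]
        refine le_trans ?_ (norm_sub_norm_le _ _)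
        rw [e2, e3]
        linarith [hr.1]
      have h3 : g (r • (y : Amb m) - x) = ENNReal.ofReal (‖r • (y : Amb m) - x‖ ^ (-γ - 1)) := by
        refine Set.indicator_of_mem ?_ _
        rw [mem_ball_zero_iff]
        linarith
      rw [h3, ← ENNReal.ofReal_mul (by positivity)]
      refine ENNReal.ofReal_le_ofReal ?_
      refine mul_le_mul (pow_le_pow_left₀ (by norm_num) hr0 m) ?_ (by positivity) (by positivity)
      exact Real.rpow_le_rpow_of_nonpos (by linarith) (by linarith) (by linarith)
    _ ≤ _ := lintegral_mono_set fun r hr => by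
      have := hr.1
      exact Set.mem_Ioi.2 (by linarith)

/-- The fractional energy of the identity is finite. -/
lemma lintegral_edist_rpow_lt_top {p : ℝ} (hm : 1 ≤ m) (hp : m < p) :
    ∫⁻ x : Sph m, ∫⁻ y : Sph m, edist y x ^ p / edist y x ^ ((m : ℝ) + m) ∂(surf m) ∂(surf m) < ⊤ := by
  -- The integrand is `dist y x ^ (p - 2 m)`, singular only if `p < 2 m`; the maximum treats both
  -- cases, and `p > m` gives `γ < m`.
  set γ : ℝ := max 0 (m + m - p) with hγ
  have hm' : (1 : ℝ) ≤ m := by exact_mod_cast hm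
  have hγm : γ < m := max_lt (by linarith) (by linarith)
  obtain ⟨C, hC, h⟩ := exists_lintegral_dist_rpow_le (m := m) (le_max_left 0 (m + m - p)) hγm
  refine lt_of_le_of_lt (b := ∫⁻ _ : Sph m, ENNReal.ofReal (2 ^ (p - m - m + γ)) * C ∂(surf m)) ?_ ?_
  · refine lintegral_mono fun x => ?_
    refine le_trans ?_ (mul_le_mul_right (h x) _)
    rw [← lintegral_const_mul' _ _ ENNReal.ofReal_ne_top]
    refine lintegral_mono fun y => ?_
    rcases eq_or_ne y x with rfl | hy
    · simp [ENNReal.zero_rpow_of_pos (show 0 < p by linarith)]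
    have hd0 : 0 < dist y x := dist_pos.2 hy
    have hd2 : dist y x ≤ 2 := by
      have := dist_le_norm_add_norm (y : Amb m) (x : Amb m)
      rw [norm_coe_sph, norm_coe_sph, ← Subtype.dist_eq] at this
      linarith
    rw [edist_dist, ENNReal.ofReal_rpow_of_pos hd0, ENNReal.ofReal_rpow_of_pos hd0,
      ← ENNReal.ofReal_div_of_pos (by positivity), ← ENNReal.ofReal_mul (by positivity)]
    refine ENNReal.ofReal_le_ofReal ?_
    rw [← Real.rpow_sub hd0]
    have e : p - (m + m) = (p - m - m + γ) + -γ := by ring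
    rw [e, Real.rpow_add hd0]
    gcongr
    linarith [le_max_right 0 (m + m - p)]
  · rw [lintegral_const]
    exact ENNReal.mul_lt_top (ENNReal.mul_lt_top ENNReal.ofReal_lt_top hC) (measure_lt_top _ _)

end SingularIntegral

/-! ### Fractional energy: conformal invariance and superposition. -/

section FractionalEnergy

variable {m : ℕ} {N : Type*} [MetricSpace N] {s p : ℝ}

lemma measurable_edist_rpow_div (f : C(Sph m, N)) (s p : ℝ) :
    Measurable fun z : Sph m × Sph m =>
      edist (f z.2) (f z.1) ^ p / edist z.2 z.1 ^ ((m : ℝ) + s * p) := by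
  have h1 : Continuous fun z : Sph m × Sph m => edist (f z.2) (f z.1) :=
    (f.continuous.comp continuous_snd).edist (f.continuous.comp continuous_fst)
  have h2 : Continuous fun z : Sph m × Sph m => edist z.2 z.1 := continuous_snd.edist continuous_fst
  exact (h1.measurable.pow_const p).div (h2.measurable.pow_const _)

lemma energyFrac_le_of_edist_le {f g : C(Sph m, N)} {K : ℝ≥0∞} (hp : 0 ≤ p) (hK : K ≠ ⊤)
    (h : ∀ x y, edist (g y) (g x) ≤ K * edist (f y) (f x)) :
    energyFrac s p g ≤ K ^ p * energyFrac s p f := by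
  have hK' : K ^ p ≠ ⊤ := ENNReal.rpow_ne_top_of_nonneg hp hK
  unfold energyFrac
  rw [← lintegral_const_mul' _ _ hK']
  refine lintegral_mono fun x => ?_
  rw [← lintegral_const_mul' _ _ hK']
  refine lintegral_mono fun y => ?_
  rw [← mul_div_assoc, ← ENNReal.mul_rpow_of_nonneg _ _ hp]
  gcongr
  exact h x y

lemma energyFrac_le_of_edist_le_edist {g : C(Sph m, N)} {K : ℝ≥0∞} (hp : 0 ≤ p) (hK : K ≠ ⊤)
    (hsp : s * p = m) (h : ∀ x y, edist (g y) (g x) ≤ K * edist y x) :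
    energyFrac s p g ≤ K ^ p *
      ∫⁻ x : Sph m, ∫⁻ y : Sph m, edist y x ^ p / edist y x ^ ((m : ℝ) + m) ∂(surf m) ∂(surf m) := by
  have hK' : K ^ p ≠ ⊤ := ENNReal.rpow_ne_top_of_nonneg hp hK
  unfold energyFrac
  rw [hsp, ← lintegral_const_mul' _ _ hK']
  refine lintegral_mono fun x => ?_
  rw [← lintegral_const_mul' _ _ hK']
  refine lintegral_mono fun y => ?_
  rw [← mul_div_assoc, ← ENNReal.mul_rpow_of_nonneg _ _ hp]
  gcongr
  exact h x y

/-- With `s * p = m` the denominator is a distance to the power `2 m`, which produces one factor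
`mobFac ^ m` at each of the two points: exactly the Jacobians of the double integral. -/
lemma energyFrac_comp_mob {f g : C(Sph m, N)} {a : Sph m} {t : ℝ} (ht : 1 < t) (hsp : s * p = m)
    (hg : ∀ x, g x = f (mob a t ht x)) : energyFrac s p g = energyFrac s p f := by
  symm
  unfold energyFrac
  rw [hsp, ← lintegral_mob (a := a) ht]
  refine lintegral_congr fun x => ?_
  rw [← lintegral_mob (a := a) ht, ← lintegral_const_mul' _ _ ENNReal.ofReal_ne_top]
  refine lintegral_congr fun y => ?_
  have hx := mobFac_pos ht (coe_ne_smul (a := a) ht x)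
  have hy := mobFac_pos ht (coe_ne_smul (a := a) ht y)
  have h2m : (0 : ℝ) ≤ (m : ℝ) + m := by positivity
  have e : edist (mob a t ht y) (mob a t ht x) ^ ((m : ℝ) + m) =
      (ENNReal.ofReal (mobFac a t x ^ m) * ENNReal.ofReal (mobFac a t y ^ m)) *
        edist y x ^ ((m : ℝ) + m) := by
    rw [edist_dist, edist_dist, ENNReal.ofReal_rpow_of_nonneg dist_nonneg h2m,
      ENNReal.ofReal_rpow_of_nonneg dist_nonneg h2m, ← ENNReal.ofReal_mul (by positivity),
      ← ENNReal.ofReal_mul (by positivity)]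
    congr 1
    have e2 : ∀ d : ℝ, d ^ ((m : ℝ) + m) = (d ^ 2) ^ m := fun d => by
      rw [← pow_mul, ← Real.rpow_natCast]
      congr 1
      push_cast
      ring
    rw [e2, e2, dist_mob, mul_pow, mul_pow]
    ring
  rw [hg, hg, e, ← mul_assoc, ← mul_div_assoc, ENNReal.mul_div_mul_left _ _
    (mul_ne_zero (by simp [pow_pos hx m]) (by simp [pow_pos hy m]))
    (ENNReal.mul_ne_top ENNReal.ofReal_ne_top ENNReal.ofReal_ne_top)]

/-- Superposition of two maps, one of which is constant on `U` and the other outside `V`. -/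
lemma energyFrac_le_of_join {A B G : C(Sph m, N)} {U V : Set (Sph m)} {b : N} {δ : ℝ} (hp : 0 ≤ p)
    (hsp : s * p = m) (hVU : V ⊆ U) (hV : MeasurableSet V)
    (hGU : ∀ x ∈ U, G x = B x) (hGA : ∀ x ∉ U, G x = A x)
    (hA : ∀ x ∈ U, A x = b) (hB : ∀ x ∉ V, B x = b)
    (hδ : ∀ x ∈ V, ∀ y ∉ U, δ ≤ dist y x) {M : ℝ≥0∞} (hM : ∀ x y, edist (A y) (B x) ≤ M) :
    energyFrac s p G ≤ energyFrac s p A + energyFrac s p B +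
      2 * (M ^ p / ENNReal.ofReal δ ^ ((m : ℝ) + m)) * (surf m V * surf m Set.univ) := by
  set c : ℝ≥0∞ := M ^ p / ENNReal.ofReal δ ^ ((m : ℝ) + m) with hc
  have hpt : ∀ x y, edist (G y) (G x) ^ p / edist y x ^ ((m : ℝ) + s * p) ≤
      (edist (A y) (A x) ^ p / edist y x ^ ((m : ℝ) + s * p) +
        edist (B y) (B x) ^ p / edist y x ^ ((m : ℝ) + s * p)) +
      (V.indicator (fun _ => c) x + V.indicator (fun _ => c) y) := by
    intro x y
    -- Only pairs with one point in `V` and the other outside `U` need a separate estimate. In the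
    -- other cases, either both values come from `B`, or both come from `A`, since `A` and `B` agree
    -- with `b` on `U \ V`.
    have hcross : ∀ x ∈ V, ∀ y ∉ U, edist (G y) (G x) ^ p / edist y x ^ ((m : ℝ) + s * p) ≤ c := by
      intro x hx y hy
      rw [hsp, hGA y hy, hGU x (hVU hx), hc]
      refine ENNReal.div_le_div (ENNReal.rpow_le_rpow (hM x y) hp) (ENNReal.rpow_le_rpow ?_ (by positivity))
      rw [edist_dist]
      exact ENNReal.ofReal_le_ofReal (hδ x hx y hy)
    by_cases hx : x ∈ U
    · by_cases hy : y ∈ U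
      · rw [hGU x hx, hGU y hy]
        exact le_add_right le_add_self
      · by_cases hxV : x ∈ V
        · refine (hcross x hxV y hy).trans ?_
          rw [Set.indicator_of_mem hxV]
          exact le_add_left le_self_add
        · have e : G x = A x := by rw [hGU x hx, hB x hxV, hA x hx]
          rw [e, hGA y hy]
          exact le_add_right le_self_add
    · by_cases hy : y ∈ U
      · by_cases hyV : y ∈ V
        · rw [edist_comm (G y), edist_comm y]
          refine (hcross y hyV x hx).trans ?_
          rw [Set.indicator_of_mem hyV]
          exact le_add_left le_add_self
        · have e : G y = A y := by rw [hGU y hy, hB y hyV, hA y hy]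
          rw [e, hGA x hx]
          exact le_add_right le_self_add
      · rw [hGA x hx, hGA y hy]
        exact le_add_right le_self_add
  have mA := measurable_edist_rpow_div A s p
  have mB := measurable_edist_rpow_div B s p
  have mc : Measurable (V.indicator fun _ => c) := measurable_const.indicator hV
  have hin : ∀ x, ∫⁻ y, edist (G y) (G x) ^ p / edist y x ^ ((m : ℝ) + s * p) ∂(surf m) ≤
      (∫⁻ y, edist (A y) (A x) ^ p / edist y x ^ ((m : ℝ) + s * p) ∂(surf m) +
        ∫⁻ y, edist (B y) (B x) ^ p / edist y x ^ ((m : ℝ) + s * p) ∂(surf m)) +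
      (V.indicator (fun _ => c) x * surf m Set.univ + c * surf m V) := by
    intro x
    have m1 : Measurable fun y => V.indicator (fun _ => c) x + V.indicator (fun _ => c) y :=
      measurable_const.add mc
    have m2 : Measurable fun y => edist (B y) (B x) ^ p / edist y x ^ ((m : ℝ) + s * p) :=
      mB.comp measurable_prodMk_left
    refine (lintegral_mono fun y => hpt x y).trans (le_of_eq ?_)
    rw [lintegral_add_right _ m1, lintegral_add_right _ m2,
      lintegral_add_left measurable_const, lintegral_const, lintegral_indicator hV,
      setLIntegral_const]
  refine (lintegral_mono hin).trans (le_of_eq ?_)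
  have m3 : Measurable fun x => V.indicator (fun _ => c) x * surf m Set.univ + c * surf m V :=
    (mc.mul_const _).add_const _
  have m4 : Measurable fun x =>
      ∫⁻ y, edist (B y) (B x) ^ p / edist y x ^ ((m : ℝ) + s * p) ∂(surf m) :=
    mB.lintegral_prod_right
  rw [lintegral_add_right _ m3, lintegral_add_right _ m4, lintegral_add_left (mc.mul_const _),
    lintegral_mul_const _ mc, lintegral_indicator hV, setLIntegral_const, lintegral_const]
  unfold energyFrac
  ring

end FractionalEnergy

end SphereMaps

end

noncomputable section


namespace SphereMaps

open Filter Topology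

/-! ### Hilbert-Schmidt norms of derivatives. -/

section HilbertSchmidt

/-- The sum is the trace of the adjoint of `L` composed with `L`, whichever orthonormal basis is
used. -/
lemma sum_norm_sq_comp_isometry {ι E F : Type*} [Fintype ι] [NormedAddCommGroup E]
    [InnerProductSpace ℝ E] [FiniteDimensional ℝ E] [NormedAddCommGroup F] [InnerProductSpace ℝ F]
    [FiniteDimensional ℝ F] (b : OrthonormalBasis ι ℝ E) (O : E ≃ₗᵢ[ℝ] E) (L : E →ₗ[ℝ] F) :
    ∑ i, ‖L (O (b i))‖ ^ 2 = ∑ i, ‖L (b i)‖ ^ 2 := by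
  have h : ∀ c : OrthonormalBasis ι ℝ E,
      ∑ i, ‖L (c i)‖ ^ 2 = LinearMap.trace ℝ E (L.adjoint ∘ₗ L) := by
    intro c
    rw [LinearMap.trace_eq_sum_inner _ c]
    refine Finset.sum_congr rfl fun i _ => ?_
    rw [LinearMap.comp_apply, LinearMap.adjoint_inner_right, real_inner_self_eq_norm_sq]
  have h1 := h (b.map O)
  simp only [OrthonormalBasis.map_apply] at h1
  rw [h1, h b]

variable {m n : ℕ} {N : Type*} [MetricSpace N] [ChartedSpace (EuclideanSpace ℝ (Fin n)) N]

/-- The differential of `u : N → ℝ` at `y`, composed with a linear map to `T_y N`. -/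
def compDiff (u : N → ℝ) (y : N) (L : Amb m →L[ℝ] TangentSpace (𝓡 n) y) : Amb m →L[ℝ] ℝ :=
  (NormedSpace.fromTangentSpace (𝕜 := ℝ) (u y)).toContinuousLinearMap ∘L
    mfderiv (𝓡 n) 𝓘(ℝ, ℝ) u y ∘L L

lemma compDiff_zero (u : N → ℝ) (y : N) :
    compDiff u y (0 : Amb m →L[ℝ] TangentSpace (𝓡 n) y) = 0 := by
  unfold compDiff
  rw [ContinuousLinearMap.comp_zero, ContinuousLinearMap.comp_zero]

/-- All tangent spaces are definitionally the model space, so `L` may be read at `z`; only the data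
depending on the point have to be transported. -/
lemma compDiff_congr (u : N → ℝ) {y z : N} (h : y = z) (L : Amb m →L[ℝ] TangentSpace (𝓡 n) y) :
    compDiff u z (L : Amb m →L[ℝ] TangentSpace (𝓡 n) z) = compDiff u y L := by
  subst h; rfl

variable [RiemannianBundle (fun x : N => TangentSpace (𝓡 n) x)]

/-- The Hilbert-Schmidt norm of a linear map to `T_y N`. -/
def hsNorm (y : N) (L : Amb m →L[ℝ] TangentSpace (𝓡 n) y) : ℝ :=
  √(∑ i : Fin (m + 1), ‖L (EuclideanSpace.single i (1 : ℝ))‖ ^ 2)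

lemma hsNorm_congr {y z : N} (h : y = z) (L : Amb m →L[ℝ] TangentSpace (𝓡 n) y) :
    hsNorm z (L : Amb m →L[ℝ] TangentSpace (𝓡 n) z) = hsNorm y L := by
  subst h; rfl

lemma hsNorm_nonneg (y : N) (L : Amb m →L[ℝ] TangentSpace (𝓡 n) y) : 0 ≤ hsNorm y L :=
  Real.sqrt_nonneg _

lemma derivEnergy_eq (p : ℝ) (f : C(Sph m, N))
    (D : ∀ x : Sph m, Amb m →L[ℝ] TangentSpace (𝓡 n) (f x)) :
    derivEnergy p f D = ∫⁻ x : Sph m, ENNReal.ofReal (hsNorm (f x) (D x) ^ p) ∂(surf m) := rfl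

lemma hsNorm_le_of_norm_le {y z : N} {L : Amb m →L[ℝ] TangentSpace (𝓡 n) y}
    {L' : Amb m →L[ℝ] TangentSpace (𝓡 n) z} {K : ℝ} (hK : 0 ≤ K) (h : ∀ v, ‖L' v‖ ≤ K * ‖L v‖) :
    hsNorm z L' ≤ K * hsNorm y L := by
  unfold hsNorm
  rw [← Real.sqrt_sq hK, ← Real.sqrt_mul (sq_nonneg K), Finset.mul_sum]
  refine Real.sqrt_le_sqrt (Finset.sum_le_sum fun i _ => ?_)
  rw [← mul_pow]
  exact pow_le_pow_left₀ (norm_nonneg _) (h _) 2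

/-- The derivative of the dilation is its conformal factor times an isometry, to which the
Hilbert-Schmidt norm is insensitive. -/
lemma hsNorm_comp_fderiv_mobExt {a : Sph m} {t : ℝ} (ht : 1 < t) (x : Sph m) (y : N)
    (L : Amb m →L[ℝ] TangentSpace (𝓡 n) y) :
    hsNorm y (L ∘L fderiv ℝ (mobExt a t) x) = mobFac a t x * hsNorm y L := by
  have hκ := (mobFac_pos ht (coe_ne_smul (a := a) ht x)).le
  unfold hsNorm
  rw [← Real.sqrt_sq hκ, ← Real.sqrt_mul (sq_nonneg _), Finset.mul_sum]
  have : FiniteDimensional ℝ (TangentSpace (𝓡 n) y) :=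
    inferInstanceAs (FiniteDimensional ℝ (EuclideanSpace ℝ (Fin n)))
  have h := sum_norm_sq_comp_isometry (EuclideanSpace.basisFun (Fin (m + 1)) ℝ) (mobLin a t x)
    (L : Amb m →ₗ[ℝ] TangentSpace (𝓡 n) y)
  simp only [EuclideanSpace.basisFun_apply, ContinuousLinearMap.coe_coe] at h
  congr 1
  rw [← Finset.mul_sum, ← h, Finset.mul_sum]
  refine Finset.sum_congr rfl fun i _ => ?_
  have e : (L ∘L fderiv ℝ (mobExt a t) x) (EuclideanSpace.single i 1) =
      mobFac a t x • L (mobLin a t x (EuclideanSpace.single i 1)) := by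
    rw [ContinuousLinearMap.comp_apply, fderiv_mobExt ht, ← map_smul]
    rfl
  rw [e, norm_smul, mul_pow, Real.norm_eq_abs, sq_abs]

end HilbertSchmidt

/-! ### First-order energy of joins, compositions and maps through curves. -/

section EnergyOne

variable {m n : ℕ} {N : Type*} [MetricSpace N] [ChartedSpace (EuclideanSpace ℝ (Fin n)) N]
  [RiemannianBundle (fun x : N => TangentSpace (𝓡 n) x)] {p : ℝ}

open Classical in
/-- The first-order energy of two maps joined by a conformal dilation. -/
lemma exists_isWeakDeriv_join {A B G : C(Sph m, N)}
    {DA : ∀ x : Sph m, Amb m →L[ℝ] TangentSpace (𝓡 n) (A x)}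
    {DB : ∀ x : Sph m, Amb m →L[ℝ] TangentSpace (𝓡 n) (B x)}
    (hA : IsWeakDeriv A DA) (hB : IsWeakDeriv B DB) (hp : p = m) {a : Sph m} {t : ℝ} (ht : 1 < t)
    {U : Set (Sph m)} (hU : MeasurableSet U) {b : N}
    (hGU : ∀ x ∈ U, G x = B (mob a t ht x)) (hGA : ∀ x ∉ U, G x = A x)
    (hAb : ∀ x ∈ U, A x = b) (hA0 : ∀ x ∈ U, DA x = 0)
    (hBb : ∀ x ∉ U, B (mob a t ht x) = b) (hB0 : ∀ x ∉ U, DB (mob a t ht x) = 0) :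
    ∃ D : ∀ x : Sph m, Amb m →L[ℝ] TangentSpace (𝓡 n) (G x), IsWeakDeriv G D ∧
      derivEnergy p G D ≤ derivEnergy p A DA + derivEnergy p B DB ∧
      (∀ x ∈ U, DB (mob a t ht x) = 0 → D x = 0) ∧ ∀ x ∉ U, DA x = 0 → D x = 0 := by
  let DB' : ∀ x : Sph m, Amb m →L[ℝ] TangentSpace (𝓡 n) (B (mob a t ht x)) := fun x =>
    DB (mob a t ht x) ∘L fderiv ℝ (mobExt a t) x
  let D : ∀ x : Sph m, Amb m →L[ℝ] TangentSpace (𝓡 n) (G x) := fun x =>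
    if x ∈ U then (DB' x : Amb m →L[ℝ] EuclideanSpace ℝ (Fin n))
    else (DA x : Amb m →L[ℝ] EuclideanSpace ℝ (Fin n))
  have hDU : ∀ x ∈ U, D x = (DB' x : Amb m →L[ℝ] EuclideanSpace ℝ (Fin n)) := fun x hx => if_pos hx
  have hDA : ∀ x ∉ U, D x = (DA x : Amb m →L[ℝ] EuclideanSpace ℝ (Fin n)) := fun x hx => if_neg hx
  have hB'0 : ∀ x, DB (mob a t ht x) = 0 → DB' x = 0 := fun x h => by
    simp only [DB', h]
    exact ContinuousLinearMap.zero_comp _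
  refine ⟨D, ⟨fun x => ?_, fun u hu => ?_⟩, ?_, fun x hx h => ?_, fun x hx h => ?_⟩
  · by_cases hx : x ∈ U
    · rw [hDU x hx]
      change DB (mob a t ht x) (fderiv ℝ (mobExt a t) x x) = 0
      rw [fderiv_mobExt_self ht, map_smul, hB.1, smul_zero]
    · rw [hDA x hx]
      exact hA.1 x
  -- At each point at least one of `A` and `B ∘ mob` equals `b`, so `u ∘ G = u ∘ A + u ∘ B ∘ mob - u
  -- b`. No integration by parts across the boundary of `U` is needed.
  · have h1 := ((hA.2 u hu).add ((hB.2 u hu).comp_mob (a := a) ht)).add (hasWeakDeriv_const (-u b))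
    convert h1 using 1
    · funext x
      by_cases hx : x ∈ U
      · rw [hGU x hx, hAb x hx]; ring
      · rw [hGA x hx, hBb x hx]; ring
    · funext x
      change compDiff u (G x) (D x) =
        compDiff u (A x) (DA x) + compDiff u (B (mob a t ht x)) (DB' x) + 0
      by_cases hx : x ∈ U
      · rw [hDU x hx, hA0 x hx, compDiff_zero, zero_add, add_zero]
        exact compDiff_congr u (hGU x hx).symm _
      · rw [hDA x hx, hB'0 x (hB0 x hx), compDiff_zero, add_zero, add_zero]
        exact compDiff_congr u (hGA x hx).symm _
  · rw [derivEnergy_eq, ← lintegral_add_compl _ hU, add_comm]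
    refine add_le_add ?_ ?_
    · refine le_trans (le_of_eq ?_) (setLIntegral_le_lintegral Uᶜ _)
      refine setLIntegral_congr_fun hU.compl fun x hx => ?_
      change ENNReal.ofReal (hsNorm (G x) (D x) ^ p) = ENNReal.ofReal (hsNorm (A x) (DA x) ^ p)
      rw [hDA x hx]
      congr 2
      exact hsNorm_congr (hGA x hx).symm _
    · rw [derivEnergy_eq, ← lintegral_mob (a := a) ht]
      refine le_trans (le_of_eq ?_) (setLIntegral_le_lintegral U _)
      refine setLIntegral_congr_fun hU fun x hx => ?_
      have hκ := mobFac_pos ht (coe_ne_smul (a := a) ht x)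
      have e : hsNorm (G x) (D x) =
          mobFac a t x * hsNorm (B (mob a t ht x)) (DB (mob a t ht x)) := by
        rw [hDU x hx, ← hsNorm_comp_fderiv_mobExt ht]
        exact hsNorm_congr (hGU x hx).symm _
      change ENNReal.ofReal (hsNorm (G x) (D x) ^ p) = _
      -- Since `p = m`, the factor `mobFac ^ p` is the Jacobian.
      rw [e, Real.mul_rpow hκ.le (hsNorm_nonneg _ _), ENNReal.ofReal_mul (by positivity), hp,
        Real.rpow_natCast]
  · rw [hDU x hx, hB'0 x h]
    rfl
  · rw [hDA x hx, h]
    rfl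

/-- The chain rule is built into the definition: a test function `u` for `Ψ ∘ f` is the test
function `u ∘ Ψ` for `f`. -/
lemma IsWeakDeriv.comp {f g : C(Sph m, N)} {D : ∀ x : Sph m, Amb m →L[ℝ] TangentSpace (𝓡 n) (f x)}
    (hf : IsWeakDeriv f D) {Ψ : N → N} (hΨ : ContMDiff (𝓡 n) (𝓡 n) 1 Ψ) (hg : ∀ x, g x = Ψ (f x))
    {K : ℝ} (hK : 0 ≤ K) (hp : 0 ≤ p)
    (hd : ∀ y (v : TangentSpace (𝓡 n) y), ‖mfderiv (𝓡 n) (𝓡 n) Ψ y v‖ ≤ K * ‖v‖) :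
    ∃ D' : ∀ x : Sph m, Amb m →L[ℝ] TangentSpace (𝓡 n) (g x), IsWeakDeriv g D' ∧
      derivEnergy p g D' ≤ ENNReal.ofReal K ^ p * derivEnergy p f D ∧
      ∀ x, mfderiv (𝓡 n) (𝓡 n) Ψ (f x) = 0 → D' x = 0 := by
  obtain rfl : g = ⟨fun x => Ψ (f x), hΨ.continuous.comp f.continuous⟩ := ContinuousMap.ext hg
  refine ⟨fun x => mfderiv (𝓡 n) (𝓡 n) Ψ (f x) ∘L D x, ⟨fun x => ?_, fun u hu => ?_⟩, ?_,
    fun x hx => ?_⟩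
  · rw [ContinuousLinearMap.comp_apply, hf.1, map_zero]
  · have h := hf.2 (u ∘ Ψ) (hu.comp hΨ)
    have e : (fun x => compDiff u (Ψ (f x)) (mfderiv (𝓡 n) (𝓡 n) Ψ (f x) ∘L D x)) =
        fun x => compDiff (u ∘ Ψ) (f x) (D x) := by
      funext x
      unfold compDiff
      rw [mfderiv_comp (f x) (hu.mdifferentiableAt one_ne_zero) (hΨ.mdifferentiableAt one_ne_zero)]
      rfl
    change HasWeakDeriv (fun x => (u ∘ Ψ) (f x))
      (fun x => compDiff u (Ψ (f x)) (mfderiv (𝓡 n) (𝓡 n) Ψ (f x) ∘L D x))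
    rw [e]
    exact h
  · rw [derivEnergy_eq, derivEnergy_eq, ← lintegral_const_mul' _ _
      (ENNReal.rpow_ne_top_of_nonneg hp ENNReal.ofReal_ne_top)]
    refine lintegral_mono fun x => ?_
    rw [ENNReal.ofReal_rpow_of_nonneg hK hp, ← ENNReal.ofReal_mul (by positivity),
      ← Real.mul_rpow hK (hsNorm_nonneg _ _)]
    refine ENNReal.ofReal_le_ofReal (Real.rpow_le_rpow (hsNorm_nonneg _ _) ?_ hp)
    exact hsNorm_le_of_norm_le hK fun v => hd _ _
  · change mfderiv (𝓡 n) (𝓡 n) Ψ (f x) ∘L D x = 0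
    rw [hx]
    exact ContinuousLinearMap.zero_comp _

/-- The first-order energy of a map that factors through a curve. -/
lemma exists_isWeakDeriv_curve {φ : Amb m → ℝ} (hφ : ContDiff ℝ 1 φ) (hp : 0 ≤ p) {σ : ℝ → N}
    (hσ : ContMDiff 𝓘(ℝ, ℝ) (𝓡 n) 1 σ) {K : ℝ} (hK : 0 ≤ K)
    (hd : ∀ τ : ℝ, ‖(mfderiv 𝓘(ℝ, ℝ) (𝓡 n) σ τ : ℝ →L[ℝ] TangentSpace (𝓡 n) (σ τ)) 1‖ ≤ K)
    {P : C(Sph m, N)} (hP : ∀ x, P x = σ (φ x)) :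
    ∃ D : ∀ x : Sph m, Amb m →L[ℝ] TangentSpace (𝓡 n) (P x), IsWeakDeriv P D ∧
      derivEnergy p P D ≤ ENNReal.ofReal K ^ p *
        ∫⁻ x : Sph m, ENNReal.ofReal (√(∑ i : Fin (m + 1),
          ‖fderiv ℝ φ x (tanProj (x : Amb m) (EuclideanSpace.single i (1 : ℝ)))‖ ^ 2) ^ p) ∂(surf m) ∧
      ∀ x : Sph m, fderiv ℝ φ x = 0 → D x = 0 := by
  have hc : Continuous fun x : Sph m => σ (φ x) :=
    hσ.continuous.comp (hφ.continuous.comp continuous_subtype_val)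
  obtain rfl : P = ⟨fun x => σ (φ x), hc⟩ := ContinuousMap.ext hP
  refine ⟨fun x => (mfderiv 𝓘(ℝ, ℝ) (𝓡 n) σ (φ x) : ℝ →L[ℝ] TangentSpace (𝓡 n) (σ (φ x))) ∘L
    fderiv ℝ φ x ∘L tanProj (x : Amb m), ⟨fun x => ?_, fun u hu => ?_⟩, ?_, fun x hx => ?_⟩
  · rw [ContinuousLinearMap.comp_apply, ContinuousLinearMap.comp_apply, tanProj_self, map_zero,
      map_zero]
  -- Tested by `u`, the map is the restriction to the sphere of a `C^1` function, whose classical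
  -- derivative is a weak derivative.
  · have hw : ContDiff ℝ 1 (u ∘ σ) := contMDiff_iff_contDiff.1 (hu.comp hσ)
    have h := hasWeakDeriv_of_contDiffAt (m := m) (w := fun z => (u ∘ σ) (φ z))
      fun x => (hw.comp hφ).contDiffAt
    have e : (fun x : Sph m => compDiff u (σ (φ x))
        ((mfderiv 𝓘(ℝ, ℝ) (𝓡 n) σ (φ x) : ℝ →L[ℝ] TangentSpace (𝓡 n) (σ (φ x))) ∘L
          fderiv ℝ φ x ∘L tanProj (x : Amb m))) =
        fun x : Sph m => fderiv ℝ (fun z => (u ∘ σ) (φ z)) x ∘L tanProj (x : Amb m) := by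
      funext x
      have e1 : fderiv ℝ (fun z => (u ∘ σ) (φ z)) x = fderiv ℝ (u ∘ σ) (φ x) ∘L fderiv ℝ φ x :=
        fderiv_comp (x : Amb m) (hw.differentiable one_ne_zero _) (hφ.differentiable one_ne_zero _)
      rw [e1, ← mfderiv_eq_fderiv (f := u ∘ σ), mfderiv_comp (φ (x : Amb m))
        (hu.mdifferentiableAt one_ne_zero) (hσ.mdifferentiableAt one_ne_zero)]
      rfl
    change HasWeakDeriv (fun x : Sph m => (u ∘ σ) (φ x)) (fun x : Sph m => compDiff u (σ (φ x))
        ((mfderiv 𝓘(ℝ, ℝ) (𝓡 n) σ (φ x) : ℝ →L[ℝ] TangentSpace (𝓡 n) (σ (φ x))) ∘L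
          fderiv ℝ φ x ∘L tanProj (x : Amb m)))
    rw [e]
    exact h
  · rw [derivEnergy_eq, ← lintegral_const_mul' _ _
      (ENNReal.rpow_ne_top_of_nonneg hp ENNReal.ofReal_ne_top)]
    refine lintegral_mono fun x => ?_
    rw [ENNReal.ofReal_rpow_of_nonneg hK hp, ← ENNReal.ofReal_mul (by positivity),
      ← Real.mul_rpow hK (Real.sqrt_nonneg _)]
    refine ENNReal.ofReal_le_ofReal (Real.rpow_le_rpow (hsNorm_nonneg _ _) ?_ hp)
    unfold hsNorm
    rw [← Real.sqrt_sq hK, ← Real.sqrt_mul (sq_nonneg K), Finset.mul_sum]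
    refine Real.sqrt_le_sqrt (Finset.sum_le_sum fun i _ => ?_)
    rw [← mul_pow]
    have hL : ∀ {y : N} (L : ℝ →L[ℝ] TangentSpace (𝓡 n) y) (c : ℝ), ‖L 1‖ ≤ K → ‖L c‖ ≤ K * ‖c‖ := by
      intro y L c h
      have e : L c = c • L 1 := by rw [← map_smul, smul_eq_mul, mul_one]
      rw [e, norm_smul, mul_comm]
      exact mul_le_mul_of_nonneg_right h (norm_nonneg _)
    exact pow_le_pow_left₀ (norm_nonneg _) (hL _ _ (hd _)) 2
  · ext1 v
    have h0 : fderiv ℝ φ x (tanProj (x : Amb m) v) = 0 := by rw [hx]; rfl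
    exact (congrArg (mfderiv 𝓘(ℝ, ℝ) (𝓡 n) σ (φ x) : ℝ →L[ℝ] TangentSpace (𝓡 n) (σ (φ x))) h0).trans
      (map_zero _)

end EnergyOne

/-! ### Uniform treatment of both energies, and insertion of concentrated maps. -/

section Energy

variable {m n : ℕ} {N : Type*} [MetricSpace N] [ChartedSpace (EuclideanSpace ℝ (Fin n)) N]
  [RiemannianBundle (fun x : N => TangentSpace (𝓡 n) x)] {s p : ℝ}

variable (n) in
/-- The energy of `f` is at most `e`; in the first-order case moreover `f` has a weak derivative
that vanishes on `W`. -/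
def EnergyLE (s p : ℝ) (f : C(Sph m, N)) (W : Set (Sph m)) (e : ℝ≥0∞) : Prop :=
  if s = 1 then ∃ D : ∀ x : Sph m, Amb m →L[ℝ] TangentSpace (𝓡 n) (f x),
    IsWeakDeriv f D ∧ derivEnergy p f D ≤ e ∧ ∀ x ∈ W, D x = 0
  else energyFrac s p f ≤ e

lemma EnergyLE.mono {f : C(Sph m, N)} {W W' : Set (Sph m)} {e e' : ℝ≥0∞}
    (h : EnergyLE n s p f W e) (hW : W' ⊆ W) (he : e ≤ e') : EnergyLE n s p f W' e' := by
  unfold EnergyLE at *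
  split_ifs at * with hs
  · obtain ⟨D, h1, h2, h3⟩ := h
    exact ⟨D, h1, h2.trans he, fun x hx => h3 x (hW hx)⟩
  · exact h.trans he

lemma EnergyLE.energy_le {f : C(Sph m, N)} {W : Set (Sph m)} {e : ℝ≥0∞}
    (h : EnergyLE n s p f W e) : energy n s p f ≤ e := by
  unfold EnergyLE at h
  unfold energy
  split_ifs at * with hs
  · obtain ⟨D, h1, h2, -⟩ := h
    exact (iInf₂_le D h1).trans h2
  · exact h

lemma EnergyLE.memSobolev {f : C(Sph m, N)} {W : Set (Sph m)} {e : ℝ≥0∞}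
    (h : EnergyLE n s p f W e) (he : e < ⊤) : MemSobolev n s p f := by
  unfold EnergyLE at h
  unfold MemSobolev
  split_ifs at * with hs
  · obtain ⟨D, h1, h2, -⟩ := h
    exact ⟨D, h1, h2.trans_lt he⟩
  · exact h.trans_lt he

lemma energyLE_of_energy_lt {f : C(Sph m, N)} {e : ℝ≥0∞} (h : energy n s p f < e) :
    EnergyLE n s p f ∅ e := by
  unfold energy at h
  unfold EnergyLE
  split_ifs at * with hs
  · unfold energyOne at h
    simp only [iInf_lt_iff] at h
    obtain ⟨D, h1, h2⟩ := h
    exact ⟨D, h1, h2.le, fun x hx => hx.elim⟩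
  · exact h.le

lemma EnergyLE.comp {f g : C(Sph m, N)} {W W' : Set (Sph m)} {e : ℝ≥0∞}
    (h : EnergyLE n s p f W e) {Ψ : N → N} (hΨ : ContMDiff (𝓡 n) (𝓡 n) 1 Ψ)
    (hg : ∀ x, g x = Ψ (f x)) {K : ℝ} (hK : 0 ≤ K) (hp : 0 ≤ p)
    (hd : ∀ y (v : TangentSpace (𝓡 n) y), ‖mfderiv (𝓡 n) (𝓡 n) Ψ y v‖ ≤ K * ‖v‖)
    (hlip : ∀ y z, edist (Ψ y) (Ψ z) ≤ ENNReal.ofReal K * edist y z)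
    (hW' : ∀ x ∈ W', mfderiv (𝓡 n) (𝓡 n) Ψ (f x) = 0) :
    EnergyLE n s p g W' (ENNReal.ofReal K ^ p * e) := by
  unfold EnergyLE at *
  split_ifs at * with hs
  · obtain ⟨D, h1, h2, -⟩ := h
    obtain ⟨D', h3, h4, h5⟩ := h1.comp hΨ hg hK hp hd
    exact ⟨D', h3, h4.trans (mul_le_mul_right h2 _), fun x hx => h5 x (hW' x hx)⟩
  · refine (energyFrac_le_of_edist_le hp ENNReal.ofReal_ne_top fun x y => ?_).trans
      (mul_le_mul_right h _)
    rw [hg, hg]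
    exact hlip _ _

/-- Insertion of a conformally concentrated copy of `B` near a point at which `A` is constant. -/
lemma EnergyLE.insert {A B : C(Sph m, N)} {WA WB : Set (Sph m)} {eA eB : ℝ≥0∞} (hm : 1 ≤ m)
    (hp : 0 ≤ p) (hsp : s * p = m) (hA : EnergyLE n s p A WA eA) (hB : EnergyLE n s p B WB eB)
    {q : Sph m} {b : N} {R δ : ℝ} (hR : 0 < R) (hδ : 0 < δ)
    (hAb : ∀ x ∈ Metric.ball q R, A x = b) (hBb : ∀ x ∈ Metric.ball (-q) δ, B x = b)
    (hWA : Metric.ball q R ⊆ WA) (hWB : Metric.ball (-q) δ ⊆ WB) {ε : ℝ≥0∞} (hε : 0 < ε) :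
    ∃ t₀, 1 < t₀ ∧ ∀ t (ht : 1 < t), t < t₀ → ∀ G : C(Sph m, N),
      (∀ x ∈ Metric.ball q R, G x = B (mob q t ht x)) → (∀ x ∉ Metric.ball q R, G x = A x) →
      EnergyLE n s p G {x | (x ∈ Metric.ball q R ∧ mob q t ht x ∈ WB) ∨
        (x ∉ Metric.ball q R ∧ x ∈ WA)} (eA + eB + ε) := by
  obtain ⟨t₁, ht₁, h₁⟩ := exists_mob_mem_ball q hR hδ
  by_cases hs : s = 1
  · subst hs
    simp only [EnergyLE, if_true] at *
    obtain ⟨DA, a1, a2, a3⟩ := hA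
    obtain ⟨DB, b1, b2, b3⟩ := hB
    refine ⟨t₁, ht₁, fun t ht htt G hGU hGA => ?_⟩
    have hout : ∀ x ∉ Metric.ball q R, mob q t ht x ∈ Metric.ball (-q) δ := fun x hx =>
      h₁ t ht htt x (by simpa using hx)
    -- The first-order energy is local, so the energies add up without any loss.
    obtain ⟨D, d1, d2, d3, d4⟩ := exists_isWeakDeriv_join a1 b1 ((one_mul p).symm.trans hsp) ht
      measurableSet_ball hGU hGA hAb (fun x hx => a3 x (hWA hx)) (fun x hx => hBb _ (hout x hx))
      (fun x hx => b3 _ (hWB (hout x hx)))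
    refine ⟨D, d1, d2.trans (le_add_right (add_le_add a2 b2)), fun x hx => ?_⟩
    rcases hx with ⟨hx, hx'⟩ | ⟨hx, hx'⟩
    · exact d3 x hx (b3 _ hx')
    · exact d4 x hx (a3 x hx')
  · simp only [EnergyLE, if_neg hs] at *
    obtain ⟨M, hM, hMle⟩ : ∃ M : ℝ≥0∞, M ≠ ⊤ ∧ ∀ x y, edist (A x) (B y) ≤ M := by
      have hc : IsCompact (Set.range A ∪ Set.range B) :=
        (isCompact_range A.continuous).union (isCompact_range B.continuous)
      refine ⟨Metric.ediam (Set.range A ∪ Set.range B), hc.isBounded.ediam_ne_top, fun x y => ?_⟩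
      exact Metric.edist_le_ediam_of_mem (Or.inl ⟨x, rfl⟩) (Or.inr ⟨y, rfl⟩)
    -- The interaction is bounded by `c` times the measure of the inner ball of radius `r`; `r ≤ R /
    -- 2` keeps this ball at distance at least `R / 2` from the complement of the outer one, so that
    -- `c` does not depend on `r`.
    set c : ℝ≥0∞ := 2 * (M ^ p / ENNReal.ofReal (R / 2) ^ ((m : ℝ) + m)) with hc
    have hctop : c * surf m Set.univ ≠ ⊤ := by
      refine ENNReal.mul_ne_top (ENNReal.mul_ne_top (by simp) ?_) (measure_ne_top _ _)
      refine (ENNReal.div_lt_top (ENNReal.rpow_ne_top_of_nonneg hp hM) ?_).ne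
      exact (ENNReal.rpow_pos (ENNReal.ofReal_pos.2 (by linarith)) ENNReal.ofReal_ne_top).ne'
    obtain ⟨r, hr0, hrR, hr⟩ : ∃ r, 0 < r ∧ r ≤ R / 2 ∧
        c * (surf m (Metric.ball q r) * surf m Set.univ) ≤ ε := by
      have hlim : Tendsto (fun k : ℕ => c * surf m Set.univ *
          surf m (Metric.ball q (1 / ((k : ℝ) + 1)))) atTop (𝓝 0) := by
        have h2 : Tendsto (fun k : ℕ => surf m (Metric.ball q (1 / ((k : ℝ) + 1)))) atTop
            (𝓝 (surf m (⋂ k : ℕ, Metric.ball q (1 / ((k : ℝ) + 1))))) := by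
          refine tendsto_measure_iInter_atTop (fun k => measurableSet_ball.nullMeasurableSet) ?_
            ⟨0, measure_ne_top _ _⟩
          intro k l hkl
          refine Metric.ball_subset_ball ?_
          gcongr
        have h3 : (⋂ k : ℕ, Metric.ball q (1 / ((k : ℝ) + 1))) = {q} := by
          ext x
          simp only [Set.mem_iInter, Metric.mem_ball, Set.mem_singleton_iff]
          constructor
          · intro h
            refine dist_le_zero.1 (le_of_tendsto_of_tendsto' tendsto_const_nhds
              tendsto_one_div_add_atTop_nhds_zero_nat fun k => (h k).le)
          · rintro rfl k
            rw [dist_self]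
            positivity
        rw [h3, surf_singleton hm] at h2
        have := ENNReal.Tendsto.const_mul h2 (Or.inr hctop)
        rwa [mul_zero] at this
      obtain ⟨k, hk1, hk2⟩ := ((hlim.eventually (gt_mem_nhds hε)).and
        (tendsto_one_div_add_atTop_nhds_zero_nat.eventually
          (gt_mem_nhds (show (0 : ℝ) < R / 2 by linarith)))).exists
      refine ⟨1 / ((k : ℝ) + 1), by positivity, hk2.le, ?_⟩
      rw [mul_comm (surf m _), ← mul_assoc]
      exact hk1.le
    -- The dilation must already be constant in effect outside the small ball of radius `r`, and not
    -- only outside that of radius `R`.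
    obtain ⟨t₂, ht₂, h₂⟩ := exists_mob_mem_ball q hr0 hδ
    refine ⟨t₂, ht₂, fun t ht htt G hGU hGA => ?_⟩
    let B' : C(Sph m, N) := B.comp ⟨mob q t ht, (mob q t ht).continuous⟩
    have hBB' : energyFrac s p B' = energyFrac s p B := energyFrac_comp_mob ht hsp fun x => rfl
    refine (energyFrac_le_of_join (A := A) (B := B') (U := Metric.ball q R) (V := Metric.ball q r)
      (b := b) (δ := R / 2) hp hsp (Metric.ball_subset_ball (by linarith)) measurableSet_ball hGU hGA
      hAb (fun x hx => hBb _ (h₂ t ht htt x (by simpa using hx))) (fun x hx y hy => ?_)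
      (fun x y => hMle _ _)).trans ?_
    · rw [Metric.mem_ball] at hx hy
      have := dist_triangle y x q
      linarith
    · rw [hBB']
      exact add_le_add (add_le_add hA hB) hr

end Energy

end SphereMaps

end

noncomputable section


namespace SphereMaps

open Filter Topology

/-! ### A transition function whose compositions with curves have a controlled energy. -/

section Bump

lemma dist_sq_eq {m : ℕ} (x y : Sph m) : dist x y ^ 2 = 2 - 2 * inner ℝ (x : Amb m) y := by
  rw [Subtype.dist_eq, dist_eq_norm, norm_sub_sq_real, norm_coe_sph, norm_coe_sph]
  ring

variable {m n : ℕ} {N : Type*} [MetricSpace N] [ChartedSpace (EuclideanSpace ℝ (Fin n)) N]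
  [RiemannianBundle (fun x : N => TangentSpace (𝓡 n) x)] {s p : ℝ}

variable (n N) in
/-- A transition function from `-q` to `q` along which curves have a controlled energy. -/
lemma exists_bump_energyLE (hm : 1 ≤ m) (hs : 0 < s) (hs1 : s ≤ 1) (hsp : s * p = m) (hp : 0 ≤ p)
    (q : Sph m) : ∃ (φ : Amb m → ℝ) (δ : ℝ) (C : ℝ≥0∞), Continuous φ ∧ 0 < δ ∧ C < ⊤ ∧
      (∀ z, 0 ≤ φ z) ∧ (∀ z, φ z ≤ 1) ∧ (∀ x ∈ Metric.ball (-q) δ, φ x = 0) ∧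
      (∀ x ∈ Metric.ball q δ, φ x = 1) ∧
      ∀ (σ : ℝ → N) (K : ℝ), 0 ≤ K → ContMDiff 𝓘(ℝ, ℝ) (𝓡 n) 1 σ →
        (∀ τ : ℝ, ‖(mfderiv 𝓘(ℝ, ℝ) (𝓡 n) σ τ : ℝ →L[ℝ] TangentSpace (𝓡 n) (σ τ)) 1‖ ≤ K) →
        (∀ τ τ', edist (σ τ) (σ τ') ≤ ENNReal.ofReal K * edist τ τ') →
        ∀ P : C(Sph m, N), (∀ x, P x = σ (φ x)) →
          EnergyLE n s p P (Metric.ball (-q) δ ∪ Metric.ball q δ) (ENNReal.ofReal K ^ p * C) := by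
  -- It varies only in the band where the height `inner q z` is between `-1/2` and `1/2`, which
  -- avoids the balls of radius `1/2` around both poles.
  let φ : Amb m → ℝ := fun z => Real.smoothTransition (inner ℝ (q : Amb m) z + 1 / 2)
  have hφ : ContDiff ℝ ∞ φ := Real.smoothTransition.contDiff.comp
    ((contDiff_const.inner ℝ contDiff_id).add contDiff_const)
  have hφ1 : ContDiff ℝ 1 φ := hφ.of_le (by norm_num)
  have h0 : ∀ z : Amb m, inner ℝ (q : Amb m) z ≤ -(1 / 2) → φ z = 0 := fun z hz =>
    Real.smoothTransition.zero_of_nonpos (by linarith)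
  have h1 : ∀ z : Amb m, 1 / 2 ≤ inner ℝ (q : Amb m) z → φ z = 1 := fun z hz =>
    Real.smoothTransition.one_of_one_le (by linarith)
  have hneg : ∀ x ∈ Metric.ball (-q) (1 / 2), inner ℝ (q : Amb m) (x : Amb m) < -(1 / 2) := by
    intro x hx
    rw [Metric.mem_ball, dist_comm] at hx
    have := dist_sq_eq (-q) x
    rw [coe_neg_sphere, inner_neg_left] at this
    nlinarith [dist_nonneg (x := -q) (y := x)]
  have hpos : ∀ x ∈ Metric.ball q (1 / 2), 1 / 2 < inner ℝ (q : Amb m) (x : Amb m) := by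
    intro x hx
    rw [Metric.mem_ball, dist_comm] at hx
    have := dist_sq_eq q x
    nlinarith [dist_nonneg (x := q) (y := x)]
  have hd0 : ∀ x ∈ Metric.ball (-q) (1 / 2) ∪ Metric.ball q (1 / 2), fderiv ℝ φ x = 0 := by
    have hcont : Continuous fun z : Amb m => inner ℝ (q : Amb m) z := by fun_prop
    rintro x (hx | hx)
    · have : φ =ᶠ[𝓝 (x : Amb m)] fun _ => 0 := by
        filter_upwards [hcont.continuousAt.eventually (gt_mem_nhds (hneg x hx))] with z hz
        exact h0 z hz.le
      rw [this.fderiv_eq]; simp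
    · have : φ =ᶠ[𝓝 (x : Amb m)] fun _ => 1 := by
        filter_upwards [hcont.continuousAt.eventually (lt_mem_nhds (hpos x hx))] with z hz
        exact h1 z hz.le
      rw [this.fderiv_eq]; simp
  suffices h : ∃ C : ℝ≥0∞, C < ⊤ ∧ ∀ (σ : ℝ → N) (K : ℝ), 0 ≤ K → ContMDiff 𝓘(ℝ, ℝ) (𝓡 n) 1 σ →
        (∀ τ : ℝ, ‖(mfderiv 𝓘(ℝ, ℝ) (𝓡 n) σ τ : ℝ →L[ℝ] TangentSpace (𝓡 n) (σ τ)) 1‖ ≤ K) →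
        (∀ τ τ', edist (σ τ) (σ τ') ≤ ENNReal.ofReal K * edist τ τ') →
        ∀ P : C(Sph m, N), (∀ x, P x = σ (φ x)) →
          EnergyLE n s p P (Metric.ball (-q) (1 / 2) ∪ Metric.ball q (1 / 2))
            (ENNReal.ofReal K ^ p * C) by
    obtain ⟨C, hC, h⟩ := h
    exact ⟨φ, 1 / 2, C, hφ.continuous, by norm_num, hC,
      fun z => Real.smoothTransition.nonneg _, fun z => Real.smoothTransition.le_one _,
      fun x hx => h0 _ (hneg x hx).le, fun x hx => h1 _ (hpos x hx).le, h⟩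
  by_cases hs' : s = 1
  · refine ⟨∫⁻ x : Sph m, ENNReal.ofReal (√(∑ i : Fin (m + 1),
      ‖fderiv ℝ φ x (tanProj (x : Amb m) (EuclideanSpace.single i (1 : ℝ)))‖ ^ 2) ^ p) ∂(surf m),
      ?_, fun σ K hK hσ hd _ P hP => ?_⟩
    · have hc : Continuous fun x : Sph m => √(∑ i : Fin (m + 1),
          ‖fderiv ℝ φ x (tanProj (x : Amb m) (EuclideanSpace.single i (1 : ℝ)))‖ ^ 2) ^ p := by
        have h2 : Continuous fun x : Sph m => fderiv ℝ φ x :=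
          (hφ1.continuous_fderiv one_ne_zero).comp continuous_subtype_val
        have h3 : Continuous fun x : Sph m => tanProj (x : Amb m) :=
          continuous_tanProj.comp continuous_subtype_val
        refine Continuous.rpow_const ?_ fun x => Or.inr hp
        refine Real.continuous_sqrt.comp (continuous_finsetSum _ fun i _ => ?_)
        exact (h2.clm_apply (h3.clm_apply continuous_const)).norm.pow 2
      exact (Continuous.integrable_surf hc).lintegral_lt_top
    · simp only [EnergyLE, hs', if_true]
      obtain ⟨D, h2, h3, h4⟩ := exists_isWeakDeriv_curve hφ1 hp hσ hK hd hP
      exact ⟨D, h2, h3, fun x hx => h4 x (hd0 x hx)⟩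
  · obtain ⟨B, hB⟩ := (isCompact_closedBall (0 : Amb m) 1).exists_bound_of_continuousOn
      (hφ1.continuous_fderiv one_ne_zero).continuousOn
    have hlip : ∀ x y : Sph m, edist (φ y) (φ x) ≤ ENNReal.ofReal B * edist y x := by
      intro x y
      have h2 := (convex_closedBall (0 : Amb m) 1).norm_image_sub_le_of_norm_fderiv_le
        (fun z _ => hφ1.differentiable one_ne_zero z) hB
        (show (x : Amb m) ∈ Metric.closedBall 0 1 by simp)
        (show (y : Amb m) ∈ Metric.closedBall 0 1 by simp)
      rw [edist_dist, edist_dist, ← ENNReal.ofReal_mul' dist_nonneg, Subtype.dist_eq, dist_eq_norm,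
        dist_eq_norm]
      exact ENNReal.ofReal_le_ofReal h2
    -- For `s < 1` this strict inequality is what gives Lipschitz maps a finite energy.
    have hpm : (m : ℝ) < p := by
      have hs2 : s < 1 := lt_of_le_of_ne hs1 hs'
      have : (1 : ℝ) ≤ m := by exact_mod_cast hm
      nlinarith
    refine ⟨ENNReal.ofReal B ^ p * ∫⁻ x : Sph m, ∫⁻ y : Sph m,
      edist y x ^ p / edist y x ^ ((m : ℝ) + m) ∂(surf m) ∂(surf m), ENNReal.mul_lt_top
        (ENNReal.rpow_lt_top_of_nonneg hp ENNReal.ofReal_ne_top) (lintegral_edist_rpow_lt_top hm hpm),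
        fun σ K hK hσ _ hl P hP => ?_⟩
    simp only [EnergyLE, if_neg hs']
    rw [← mul_assoc, ← ENNReal.mul_rpow_of_nonneg _ _ hp]
    refine energyFrac_le_of_edist_le_edist hp
      (ENNReal.mul_ne_top ENNReal.ofReal_ne_top ENNReal.ofReal_ne_top) hsp fun x y => ?_
    rw [hP, hP, mul_assoc]
    exact (hl _ _).trans (mul_le_mul_right (hlip x y) _)

end Bump

end SphereMaps

end

noncomputable section


namespace SphereMaps

open Filter Topology

/-! ### Gluing of relative homotopies. -/

section Topology

variable {X Y Z : Type*} [TopologicalSpace X] [TopologicalSpace Y] [TopologicalSpace Z]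

lemma homotopicRel_of_continuous {f g : C(X, Z)} {S : Set X} (H : unitInterval × X → Z)
    (hH : Continuous H) (h0 : ∀ x, H (0, x) = f x) (h1 : ∀ x, H (1, x) = g x)
    (hS : ∀ t, ∀ x ∈ S, H (t, x) = f x) : f.HomotopicRel g S :=
  ⟨⟨⟨⟨H, hH⟩, h0, h1⟩, fun t x hx => hS t x hx⟩⟩

open Classical in
/-- The join of two maps is continuous when one of them is constant on an open set and the other
one takes the same constant value outside of this set. -/
lemma continuous_join [T2Space Z] {U : Set Y} (hU : IsOpen U) {P A : Y → Z} {c : Z}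
    (hP : Continuous P) (hA : Continuous A) (hPc : ∀ y ∉ U, P y = c) (hAc : ∀ y ∈ U, A y = c) :
    Continuous fun y => if y ∈ U then P y else A y := by
  refine continuous_if (fun y hy => ?_) hP.continuousOn hA.continuousOn
  have h1 : y ∉ U := fun h => hU.frontier_eq ▸ hy |>.2 h
  have h2 : closure U ⊆ A ⁻¹' {c} :=
    closure_minimal (fun z hz => hAc z hz) (isClosed_singleton.preimage hA)
  rw [hPc y h1, h2 (frontier_subset_closure hy)]

open Classical in
-- Both homotopies run simultaneously. They are stationary with value `c` outside `U` and `V`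
-- respectively, so on the boundary of `U` they agree.
lemma homotopicRel_join [T2Space Z] {U V : Set X} (hU : IsOpen U) (hUV : Disjoint U V) {c : Z}
    {P P' A A' J J' : C(X, Z)} (hP : P.HomotopicRel P' Uᶜ) (hA : A.HomotopicRel A' Vᶜ)
    (hPc : ∀ x ∉ U, P x = c) (hAc : ∀ x ∉ V, A x = c)
    (hJ : ∀ x ∈ U, J x = P x) (hJ1 : ∀ x ∉ U, J x = A x)
    (hJ' : ∀ x ∈ U, J' x = P' x) (hJ1' : ∀ x ∉ U, J' x = A' x) :
    J.HomotopicRel J' (U ∪ V)ᶜ := by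
  obtain ⟨H⟩ := hP
  obtain ⟨K⟩ := hA
  refine homotopicRel_of_continuous
    (fun z => if z ∈ (Prod.snd ⁻¹' U : Set (unitInterval × X)) then H z else K z)
    (continuous_join (hU.preimage continuous_snd) H.continuous K.continuous (c := c)
      (fun z hz => ?_) (fun z hz => ?_)) (fun x => ?_) (fun x => ?_) (fun t x hx => ?_)
  · rw [← hPc z.2 hz]; exact H.eq_fst z.1 hz
  · have h1 : z.2 ∉ V := Set.disjoint_left.1 hUV hz
    rw [← hAc z.2 h1]; exact K.eq_fst z.1 h1
  · by_cases h : x ∈ U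
    · simp [h, hJ]
    · simp [h, hJ1]
  · by_cases h : x ∈ U
    · simp [h, hJ']
    · simp [h, hJ1']
  · rw [Set.mem_compl_iff, Set.mem_union, not_or] at hx
    simp only [Set.mem_preimage, hx.1, if_false, hJ1 x hx.1]
    exact K.eq_fst t hx.2

lemma continuous_ite_prod {U : Set X} [∀ z : Y × X, Decidable (z.2 ∈ U)] (hU : IsOpen U) {K L : Y × X → Z}
    (hK : ContinuousOn K (Set.univ ×ˢ closure U)) (hL : Continuous L)
    (hc : ∀ y, ∀ x ∈ closure U, x ∉ U → K (y, x) = L (y, x)) :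
    Continuous fun z : Y × X => if z.2 ∈ U then K z else L z := by
  have e : {z : Y × X | z.2 ∈ U} = Set.univ ×ˢ U := by ext; simp
  refine continuous_if (p := fun z : Y × X => z.2 ∈ U) (fun z hz => ?_) ?_ hL.continuousOn
  · rw [e, frontier_univ_prod_eq, hU.frontier_eq] at hz
    exact hc z.1 z.2 hz.2.1 hz.2.2
  · rwa [e, closure_prod_eq, closure_univ]

end Topology

/-! ### Radial projection and geodesic contraction of small balls. -/

section Sphere

variable {m : ℕ}

lemma continuousOn_radProj : ContinuousOn (radProj : Amb m → Sph m) {0}ᶜ := by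
  rw [IsInducing.subtypeVal.continuousOn_iff]
  refine ContinuousOn.congr (f := fun z : Amb m => ‖z‖⁻¹ • z) ?_ fun z hz => coe_radProj hz
  exact (continuousOn_id.norm.inv₀ fun z hz => norm_ne_zero_iff.2 hz).smul continuousOn_id

lemma radProj_coe (x : Sph m) : radProj (x : Amb m) = x := by
  simpa using radProj_smul one_pos x

/-- Distance at most `1` means that the inner product of `q` and `x` is at least `1/2`; the segment
then stays in the open half-space directed by `q`. -/
lemma lerp_ne_zero {q x : Sph m} (h : dist x q ≤ 1) {s : ℝ} (h0 : 0 ≤ s) (h1 : s ≤ 1) :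
    (1 - s) • (q : Amb m) + s • (x : Amb m) ≠ 0 := by
  intro h2
  have h3 := congrArg (fun z => inner ℝ (q : Amb m) z) h2
  have h4 := dist_sq_eq x q
  simp only [inner_add_right, inner_smul_right, real_inner_self_eq_norm_sq, norm_coe_sph,
    inner_zero_right] at h3
  rw [real_inner_comm] at h4
  have : dist x q ^ 2 ≤ 1 := by nlinarith [dist_nonneg (x := x) (y := q)]
  nlinarith

/-- The geodesic from `q` to `x` stays in the balls centred at `q` that contain `x`. -/
lemma dist_radProj_lerp_le {q x : Sph m} (h : dist x q ≤ 1) {s : ℝ} (h0 : 0 ≤ s) (h1 : s ≤ 1) :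
    dist (radProj ((1 - s) • (q : Amb m) + s • (x : Amb m))) q ≤ dist x q := by
  set z := (1 - s) • (q : Amb m) + s • (x : Amb m) with hz
  have hz0 : z ≠ 0 := lerp_ne_zero h h0 h1
  refine (sq_le_sq₀ dist_nonneg dist_nonneg).1 ?_
  have h4 := dist_sq_eq x q
  have h5 : dist x q ^ 2 ≤ 1 := by nlinarith [dist_nonneg (x := x) (y := q)]
  rw [dist_sq_eq, dist_sq_eq, coe_radProj hz0, inner_smul_left]
  have hn : ‖z‖ ≤ 1 := by
    refine (norm_add_le _ _).trans ?_
    rw [norm_smul, norm_smul, norm_coe_sph, norm_coe_sph, Real.norm_eq_abs, Real.norm_eq_abs,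
      abs_of_nonneg h0, abs_of_nonneg (by linarith)]
    linarith
  have hi : inner ℝ (x : Amb m) (q : Amb m) ≤ inner ℝ z (q : Amb m) := by
    rw [hz, inner_add_left, inner_smul_left, inner_smul_left, real_inner_self_eq_norm_sq,
      norm_coe_sph]
    simp only [conj_trivial]
    nlinarith [sq_nonneg (dist x q)]
  have hp : 0 < ‖z‖ := norm_pos_iff.2 hz0
  have : inner ℝ z (q : Amb m) ≤ ‖z‖⁻¹ * inner ℝ z (q : Amb m) :=
    le_mul_of_one_le_left (by linarith) ((one_le_inv₀ hp).2 hn)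
  simp only [conj_trivial]
  linarith

end Sphere

/-! ### Change of base point along a free homotopy. -/

section BaseChange

variable {m : ℕ} {N : Type*} [TopologicalSpace N] [T2Space N]

open Classical in
/-- Moving the value at `q` along the trajectory of `q` under a free homotopy. -/
lemma homotopicRel_of_homotopy {A h G : C(Sph m, N)} {q : Sph m} {R : ℝ} (hR : 0 < R) (hR1 : R ≤ 1)
    {b : N} (hA : ∀ x ∈ Metric.ball q R, A x = b) (H : A.Homotopy h) {τ : C(Sph m, ℝ)}
    (h0 : ∀ x, 0 ≤ τ x) (h1 : ∀ x, τ x ≤ 1) (hτ : ∀ x ∉ Metric.ball q R, τ x = 0) (hq : τ q = 1)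
    {σ : ℝ → N} (P : C(unitInterval × unitInterval, N)) (hP0 : ∀ r : unitInterval, P (0, r) = σ r)
    (hP1 : ∀ r, P (1, r) = H (r, q)) (hPb : ∀ s, P (s, 0) = b) (hPb' : ∀ s, P (s, 1) = h q)
    (hG : ∀ x ∈ Metric.ball q R, G x = σ (τ x)) (hG' : ∀ x ∉ Metric.ball q R, G x = A x) :
    G.HomotopicRel h {q} := by
  let T : C(Sph m, unitInterval) := ⟨fun x => ⟨τ x, h0 x, h1 x⟩, by fun_prop⟩
  have hTq : T q = 1 := Subtype.ext hq
  have hT0 : ∀ x ∉ Metric.ball q R, T x = 0 := fun x hx => Subtype.ext (hτ x hx)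
  have hU : IsOpen (Metric.ball q R) := Metric.isOpen_ball
  have hqU : q ∈ Metric.ball q R := Metric.mem_ball_self hR
  have hAcl : ∀ x ∈ closure (Metric.ball q R), A x = b := fun x hx =>
    closure_minimal (t := A ⁻¹' {b}) (fun z hz => hA z hz)
      (isClosed_singleton.preimage A.continuous) hx
  have hcl : ∀ x ∈ closure (Metric.ball q R), dist x q ≤ 1 := fun x hx =>
    (Metric.mem_closedBall.1 (Metric.closure_ball_subset_closedBall hx)).trans hR1
  -- In the ball, the curve `σ ∘ τ` is deformed into the true trajectory `H (τ x, q)` by means of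
  -- `P`. Everything is stationary at `q` because `τ q = 1`.
  let K1 : unitInterval × Sph m → N := fun z =>
    if z.2 ∈ Metric.ball q R then P (z.1, T z.2) else A z.2
  have hK1 : Continuous K1 := by
    refine continuous_ite_prod hU (K := fun z => P (z.1, T z.2)) (L := fun z => A z.2)
      (by fun_prop) (by fun_prop) fun s x hx hx' => ?_
    simp only [hT0 x hx', hPb, hAcl x hx]
  let C : unitInterval × Sph m → Sph m := fun z =>
    radProj ((1 - (z.1 : ℝ)) • (q : Amb m) + (z.1 : ℝ) • (z.2 : Amb m))
  have hC : ContinuousOn C (Set.univ ×ˢ closure (Metric.ball q R)) := by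
    refine continuousOn_radProj.comp (by fun_prop) fun z hz => ?_
    exact lerp_ne_zero (hcl _ hz.2) z.1.2.1 z.1.2.2
  -- The space variable is now moved from `q` to `x` along the geodesic, to reach `H (τ x, x)`. At
  -- the boundary `τ = 0` and the geodesic stays where `A = b`, so this matches `A`.
  let K2 : unitInterval × Sph m → N := fun z =>
    if z.2 ∈ Metric.ball q R then H (T z.2, C z) else A z.2
  have hCcl : ∀ s, ∀ x ∈ closure (Metric.ball q R), A (C (s, x)) = b := by
    have hcl' : ∀ s, ∀ x ∈ Metric.ball q R, A (C (s, x)) = b := fun s x hx => by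
      refine hA _ ((dist_radProj_lerp_le (hcl x (subset_closure hx)) s.2.1 s.2.2).trans_lt ?_)
      exact Metric.mem_ball.1 hx
    intro s x hx
    have hc : ContinuousOn (fun x => A (C (s, x))) (closure (Metric.ball q R)) :=
      A.continuous.comp_continuousOn (hC.comp (by fun_prop) fun x hx => ⟨trivial, hx⟩)
    exact closure_minimal (t := {b}) (Set.image_subset_iff.2 fun z hz => hcl' s z hz)
      isClosed_singleton ((hc.mono subset_rfl).image_closure (Set.mem_image_of_mem _ hx))
  have hK2 : Continuous K2 := by
    refine continuous_ite_prod hU (K := fun z => H (T z.2, C z)) (L := fun z => A z.2)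
      ?_ (by fun_prop) fun s x hx hx' => ?_
    · exact H.continuous.comp_continuousOn (ContinuousOn.prodMk (by fun_prop) hC)
    · simp only [hT0 x hx', H.apply_zero, hAcl x hx]
      exact hCcl s x hx
  -- Finally the time is raised to `1` everywhere; the maximum keeps it equal to `1` at `q`.
  let K3 : unitInterval × Sph m → N := fun z => H (max (T z.2) z.1, z.2)
  have hK3 : Continuous K3 := by fun_prop
  have hC0 : ∀ x, C (0, x) = q := fun x => by simp [C, radProj_coe]
  have hC1 : ∀ x, C (1, x) = x := fun x => by simp [C, radProj_coe]
  have hCq : ∀ s, C (s, q) = q := fun s => by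
    have : (1 - (s : ℝ)) • (q : Amb m) + (s : ℝ) • (q : Amb m) = q := by module
    simp [C, this, radProj_coe]
  let G1 : C(Sph m, N) := ⟨fun x => K1 (1, x), by fun_prop⟩
  let G2 : C(Sph m, N) := ⟨fun x => K2 (1, x), by fun_prop⟩
  have e1 : G.HomotopicRel G1 {q} := by
    refine homotopicRel_of_continuous K1 hK1 (fun x => ?_) (fun x => rfl) fun s x hx => ?_
    · by_cases hx : x ∈ Metric.ball q R
      · simp only [K1, hx, if_true, hP0, hG x hx]; rfl
      · simp only [K1, hx, if_false, hG' x hx]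
    · rw [Set.mem_singleton_iff.1 hx, hG q hqU]
      simp only [K1, hqU, if_true, hTq]
      rw [hPb', hq]
      exact (hPb' 0).symm.trans (hP0 1)
  have e2 : G1.HomotopicRel G2 {q} := by
    refine homotopicRel_of_continuous K2 hK2 (fun x => ?_) (fun x => rfl) fun s x hx => ?_
    · by_cases hx : x ∈ Metric.ball q R
      · simp only [K2, K1, G1, ContinuousMap.coe_mk, hx, if_true, hC0, hP1]
      · simp only [K2, K1, G1, ContinuousMap.coe_mk, hx, if_false]
    · rw [Set.mem_singleton_iff.1 hx]
      simp only [K2, K1, G1, ContinuousMap.coe_mk, hqU, if_true, hTq, hPb', hCq, H.apply_one]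
  have e3 : G2.HomotopicRel h {q} := by
    refine homotopicRel_of_continuous K3 hK3 (fun x => ?_) (fun x => ?_) fun s x hx => ?_
    · by_cases hx : x ∈ Metric.ball q R
      · simp only [K3, K2, G2, ContinuousMap.coe_mk, hx, if_true, hC1]
        rw [max_eq_left (show 0 ≤ T x from (T x).2.1)]
      · simp only [K3, K2, G2, ContinuousMap.coe_mk, hx, if_false, hT0 x hx, max_self,
          H.apply_zero]
    · simp only [K3]
      rw [max_eq_right (show T x ≤ 1 from (T x).2.2), H.apply_one]
    · rw [Set.mem_singleton_iff.1 hx]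
      simp only [K3, K2, G2, ContinuousMap.coe_mk, hqU, if_true, hTq, hC1]
      rw [max_eq_left (show s ≤ 1 from s.2.2)]
  exact (e1.trans e2).trans e3

end BaseChange

end SphereMaps

end

noncomputable section


namespace SphereMaps

open Filter Topology

/-! ### Collapsing a geodesic ball compared with dilating the sphere. -/

section GeodBall

variable {m : ℕ} {a : Sph m} {ρ : ℝ}

lemma continuous_angle_sph (a : Sph m) :
    Continuous fun x : Sph m => InnerProductGeometry.angle (a : Amb m) (x : Amb m) := by
  unfold InnerProductGeometry.angle
  simp only [norm_coe_sph, mul_one, div_one]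
  exact Real.continuous_arccos.comp (by fun_prop)

lemma isOpen_geodBall (a : Sph m) (ρ : ℝ) : IsOpen (geodBall a ρ) :=
  isOpen_Iio.preimage (continuous_angle_sph a)

lemma mem_geodBall_self (hρ : 0 < ρ) : a ∈ geodBall a ρ := by
  have : (a : Amb m) ≠ 0 := by rw [← norm_ne_zero_iff]; simp
  simpa [geodBall, InnerProductGeometry.angle_self this] using hρ

lemma angle_le_of_mem_closure {x : Sph m} (hx : x ∈ closure (geodBall a ρ)) :
    InnerProductGeometry.angle (a : Amb m) x ≤ ρ :=
  closure_lt_subset_le (continuous_angle_sph a) continuous_const hx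

lemma cos_angle_sph (a x : Sph m) :
    Real.cos (InnerProductGeometry.angle (a : Amb m) x) = inner ℝ (a : Amb m) (x : Amb m) := by
  rw [InnerProductGeometry.cos_angle, norm_coe_sph, norm_coe_sph, mul_one, div_one]

/-- The map of the closed geodesic ball onto the sphere that collapses the boundary to `-a`. -/
def collapse (a : Sph m) (ρ : ℝ) (x : Amb m) : Amb m :=
  Real.cos (Real.pi / ρ * InnerProductGeometry.angle (a : Amb m) x) • (a : Amb m) +
    (Real.pi / ρ * Real.sinc (Real.pi / ρ * InnerProductGeometry.angle (a : Amb m) x) /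
      Real.sinc (InnerProductGeometry.angle (a : Amb m) x)) •
      (x - inner ℝ (a : Amb m) x • (a : Amb m))

lemma collapse_self : collapse a ρ a = a := by
  have : (a : Amb m) ≠ 0 := by rw [← norm_ne_zero_iff]; simp
  simp [collapse, InnerProductGeometry.angle_self this]

lemma sinc_pos {θ : ℝ} (h0 : 0 ≤ θ) (h1 : θ < Real.pi) : 0 < Real.sinc θ := by
  rcases h0.eq_or_lt with rfl | h
  · simp
  · rw [Real.sinc_of_ne_zero h.ne']
    exact div_pos (Real.sin_pos_of_pos_of_lt_pi h h1) h

/-- The coefficient `sin (π θ / ρ) / sin θ` is written with `sinc` to be continuous at the centre;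
on the closed ball `θ ≤ ρ < π`, so its denominator does not vanish. -/
lemma continuousOn_collapse (hρ : ρ < Real.pi) :
    ContinuousOn (fun x : Sph m => collapse a ρ x) (closure (geodBall a ρ)) := by
  have h1 := continuous_angle_sph a
  have h2 : Continuous fun x : Sph m => inner ℝ (a : Amb m) (x : Amb m) := by fun_prop
  have h3 : Continuous fun x : Sph m =>
      Real.cos (Real.pi / ρ * InnerProductGeometry.angle (a : Amb m) x) • (a : Amb m) :=
    (Real.continuous_cos.comp (continuous_const.mul h1)).smul continuous_const
  refine h3.continuousOn.add (ContinuousOn.smul (f := fun x : Sph m => (Real.pi / ρ *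
    Real.sinc (Real.pi / ρ * InnerProductGeometry.angle (a : Amb m) x) /
      Real.sinc (InnerProductGeometry.angle (a : Amb m) x))) ?_
    (continuous_subtype_val.sub (h2.smul continuous_const)).continuousOn)
  · refine ContinuousOn.div (Continuous.continuousOn ?_) (Continuous.continuousOn ?_) fun x hx => ?_
    · exact continuous_const.mul (Real.continuous_sinc.comp (continuous_const.mul h1))
    · exact Real.continuous_sinc.comp h1
    · exact (sinc_pos (InnerProductGeometry.angle_nonneg _ _)
        ((angle_le_of_mem_closure hx).trans_lt hρ)).ne'

/-- The direction at `a` of the geodesic from `a` to `x`. -/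
lemma exists_direction (hm : 1 ≤ m) (a x : Sph m)
    (hx : InnerProductGeometry.angle (a : Amb m) x < Real.pi) :
    ∃ w : Amb m, ‖w‖ = 1 ∧ inner ℝ (a : Amb m) w = 0 ∧
      (x : Amb m) - inner ℝ (a : Amb m) (x : Amb m) • (a : Amb m) =
        Real.sin (InnerProductGeometry.angle (a : Amb m) x) • w := by
  set θ := InnerProductGeometry.angle (a : Amb m) x with hθ
  have hc : Real.cos θ = inner ℝ (a : Amb m) (x : Amb m) := cos_angle_sph a x
  set v := (x : Amb m) - inner ℝ (a : Amb m) (x : Amb m) • (a : Amb m) with hv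
  have hav : inner ℝ (a : Amb m) v = 0 := by
    rw [hv, inner_sub_right, inner_smul_right, real_inner_self_eq_norm_sq, norm_coe_sph]; ring
  have hvn : ‖v‖ ^ 2 = Real.sin θ ^ 2 := by
    rw [Real.sin_sq, hc, hv, norm_sub_sq_real, norm_smul, inner_smul_right, norm_coe_sph,
      norm_coe_sph, real_inner_comm (a : Amb m) (x : Amb m), Real.norm_eq_abs, mul_one, sq_abs]
    ring
  have hs : 0 ≤ Real.sin θ := Real.sin_nonneg_of_nonneg_of_le_pi
    (InnerProductGeometry.angle_nonneg _ _) hx.le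
  have hvn' : ‖v‖ = Real.sin θ := by
    rwa [sq_eq_sq₀ (norm_nonneg _) hs] at hvn
  rcases hs.eq_or_lt with h | h
  · have hv0 : v = 0 := by rw [← norm_eq_zero, hvn', h]
    -- At the centre of the ball any unit tangent vector will do; `m ≥ 1` provides one.
    have hfr : 0 < Module.finrank ℝ (ℝ ∙ (a : Amb m))ᗮ := by
      have h1 := Submodule.finrank_add_finrank_orthogonal (ℝ ∙ (a : Amb m))
      have h2 : Module.finrank ℝ (ℝ ∙ (a : Amb m)) ≤ 1 := by
        simpa using finrank_span_le_card (R := ℝ) ({(a : Amb m)} : Set (Amb m))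
      rw [finrank_euclideanSpace, Fintype.card_fin] at h1
      omega
    have : Nontrivial (ℝ ∙ (a : Amb m))ᗮ := Module.nontrivial_of_finrank_pos hfr
    obtain ⟨w, hw⟩ := exists_norm_eq (ℝ ∙ (a : Amb m))ᗮ (zero_le_one (α := ℝ))
    refine ⟨w, by simpa using hw, ?_, by rw [hv0, ← h, zero_smul]⟩
    exact Submodule.mem_orthogonal_singleton_iff_inner_right.1 w.2
  · refine ⟨(Real.sin θ)⁻¹ • v, ?_, ?_, ?_⟩
    · rw [norm_smul, hvn', Real.norm_eq_abs, abs_of_pos (inv_pos.2 h), inv_mul_cancel₀ h.ne']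
    · rw [inner_smul_right, hav, mul_zero]
    · rw [smul_smul, mul_inv_cancel₀ h.ne', one_smul]

lemma sin_div_sinc_mul {α θ : ℝ} (h0 : 0 ≤ θ) (h1 : θ < Real.pi) :
    α * Real.sinc (α * θ) / Real.sinc θ * Real.sin θ = Real.sin (α * θ) := by
  rcases h0.eq_or_lt with rfl | h
  · simp
  · have := Real.sin_pos_of_pos_of_lt_pi h h1
    rw [Real.sinc_of_ne_zero h.ne']
    rcases eq_or_ne α 0 with rfl | hα
    · simp
    rw [Real.sinc_of_ne_zero (mul_ne_zero hα h.ne')]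
    field_simp

lemma collapse_eq {x : Sph m} (hx : InnerProductGeometry.angle (a : Amb m) x < Real.pi) {w : Amb m}
    (hw : (x : Amb m) - inner ℝ (a : Amb m) (x : Amb m) • (a : Amb m) =
        Real.sin (InnerProductGeometry.angle (a : Amb m) x) • w) :
    collapse a ρ x =
      Real.cos (Real.pi * InnerProductGeometry.angle (a : Amb m) x / ρ) • (a : Amb m) +
      Real.sin (Real.pi * InnerProductGeometry.angle (a : Amb m) x / ρ) • w := by
  rw [collapse, hw, smul_smul, sin_div_sinc_mul (InnerProductGeometry.angle_nonneg _ _) hx,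
    div_mul_eq_mul_div]

lemma norm_collapse (hm : 1 ≤ m) {x : Sph m}
    (hx : InnerProductGeometry.angle (a : Amb m) x < Real.pi) : ‖collapse a ρ x‖ = 1 := by
  obtain ⟨w, h1, h2, h3⟩ := exists_direction hm a x hx
  rw [collapse_eq hx h3, ← sq_eq_sq₀ (norm_nonneg _) zero_le_one, norm_add_sq_real, norm_smul,
    norm_smul, inner_smul_left, inner_smul_right, h1, h2, norm_coe_sph, Real.norm_eq_abs,
    Real.norm_eq_abs, mul_one, mul_one, sq_abs, sq_abs]
  simp [Real.cos_sq_add_sin_sq]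

lemma InducesOnBall.eq_collapse {N : Type*} (hm : 1 ≤ m) (hρπ : ρ < Real.pi)
    {g h : Sph m → N} (hind : InducesOnBall g a ρ h) {x : Sph m}
    (hx : InnerProductGeometry.angle (a : Amb m) x ≤ ρ) : g x = h (radProj (collapse a ρ x)) := by
  have hx' := hx.trans_lt hρπ
  obtain ⟨w, h1, h2, h3⟩ := exists_direction hm a x hx'
  refine hind w _ x _ h1 h2 (InnerProductGeometry.angle_nonneg _ _) hx ?_ ?_
  · rw [cos_angle_sph, ← h3]; abel
  · rw [coe_radProj (by rw [← norm_ne_zero_iff, norm_collapse hm hx']; simp),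
      norm_collapse hm hx', inv_one, one_smul, collapse_eq hx' h3]

lemma collapse_of_angle_eq (hρ : 0 < ρ) {x : Sph m}
    (hx : InnerProductGeometry.angle (a : Amb m) x = ρ) : collapse a ρ x = -(a : Amb m) := by
  rw [collapse, hx, div_mul_cancel₀ _ hρ.ne', Real.sinc_of_ne_zero Real.pi_ne_zero]
  simp

lemma angle_eq_of_mem_closure {x : Sph m} (hx : x ∈ closure (geodBall a ρ))
    (hx' : x ∉ geodBall a ρ) : InnerProductGeometry.angle (a : Amb m) x = ρ :=
  le_antisymm (angle_le_of_mem_closure hx) (not_lt.1 hx')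

variable {t : ℝ}

/-- The collapsing map and the Möbius dilation are nowhere in opposite directions. -/
lemma lerp_collapse_ne_zero (hm : 1 ≤ m) (hρ : 0 < ρ) (hρπ : ρ < Real.pi) (ht : 1 < t) {x : Sph m}
    (hx : InnerProductGeometry.angle (a : Amb m) x ≤ ρ) {s : ℝ} (h0 : 0 ≤ s) (h1 : s ≤ 1) :
    (1 - s) • collapse a ρ x + s • (mob a t ht x : Amb m) ≠ 0 := by
  have hx' := hx.trans_lt hρπ
  have hang := InnerProductGeometry.angle_nonneg (a : Amb m) x
  rcases h0.eq_or_lt with rfl | hs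
  · rw [sub_zero, one_smul, zero_smul, add_zero, ← norm_ne_zero_iff, norm_collapse hm hx']
    exact one_ne_zero
  rcases hang.eq_or_lt with h | h
  · have : x = a := by
      apply Subtype.ext
      have h2 : inner ℝ (a : Amb m) (x : Amb m) = 1 := by rw [← cos_angle_sph, ← h, Real.cos_zero]
      exact ((inner_eq_one_iff_of_norm_eq_one (norm_coe_sph a) (norm_coe_sph x)).1 h2).symm
    rw [this, collapse_self, mob_self, ← add_smul, sub_add_cancel, one_smul,
      ← norm_ne_zero_iff, norm_coe_sph]
    exact one_ne_zero
  · intro h2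
    obtain ⟨r, hr⟩ := mobExt_eq_combination (a := a) (t := t) x
    obtain ⟨w, hw, haw, hxw⟩ := exists_direction hm a x hx'
    -- Both images lie on the meridian in the direction `w`: their components along `w` are
    -- nonnegative, and that of the dilation is positive when `x` is not the centre.
    have h3 := congrArg (fun z => inner ℝ w z) h2
    have hwa : inner ℝ w (a : Amb m) = 0 := by rw [real_inner_comm]; exact haw
    rw [collapse_eq hx' hxw, coe_mob, hr, hxw] at h3
    simp only [inner_add_right, inner_smul_right, real_inner_self_eq_norm_sq, hw, hwa,
      inner_zero_right] at h3
    have h4 : 0 ≤ Real.sin (Real.pi * InnerProductGeometry.angle (a : Amb m) x / ρ) := by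
      refine Real.sin_nonneg_of_nonneg_of_le_pi (by positivity) ?_
      rw [div_le_iff₀ hρ]
      exact mul_le_mul_of_nonneg_left hx Real.pi_pos.le
    have h5 := mobFac_pos ht (coe_ne_smul (a := a) ht x)
    have h6 := Real.sin_pos_of_pos_of_lt_pi h hx'
    have h7 : 0 < s * (mobFac a t x * Real.sin (InnerProductGeometry.angle (a : Amb m) x)) := by
      positivity
    have h8 := mul_nonneg (sub_nonneg.2 h1) h4
    norm_num at h3
    linarith

open Classical in
/-- A map obtained by collapsing the complement of a geodesic ball is homotopic to a map obtained
by composition with a Möbius dilation that shrinks this complement. -/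
lemma homotopicRel_comp_mob {N : Type*} [TopologicalSpace N] [T2Space N] (hm : 1 ≤ m) (hρ : 0 < ρ)
    (hρπ : ρ < Real.pi) {c : N} {g p h F : C(Sph m, N)} (hind : InducesOnBall g a ρ h)
    (hp : ∀ x ∈ geodBall a ρ, p x = g x) (hp' : ∀ x ∉ geodBall a ρ, p x = c) (hh : h (-a) = c)
    (hF : F.HomotopicRel h {-a}) {δ : ℝ} (hδ1 : δ ≤ 1)
    (hFc : ∀ x ∈ Metric.ball (-a) δ, F x = c) (ht : 1 < t)
    (hmob : ∀ x ∉ geodBall a ρ, mob a t ht x ∈ Metric.ball (-a) δ) :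
    (F.comp (mob a t ht : C(Sph m, Sph m))).HomotopicRel p (geodBall a ρ)ᶜ := by
  obtain ⟨H⟩ := hF.symm
  have hU := isOpen_geodBall a ρ
  let Q : unitInterval × Sph m → Sph m := fun z =>
    radProj ((1 - (z.1 : ℝ)) • collapse a ρ z.2 + (z.1 : ℝ) • (mob a t ht z.2 : Amb m))
  have hQ : ContinuousOn Q (Set.univ ×ˢ closure (geodBall a ρ)) := by
    refine continuousOn_radProj.comp ?_ fun z hz => ?_
    · have h1 := (continuousOn_collapse (a := a) hρπ).comp
        (continuous_snd (X := unitInterval) (Y := Sph m)).continuousOn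
        (s := Set.univ ×ˢ closure (geodBall a ρ)) fun z hz => hz.2
      have h2 : Continuous fun z : unitInterval × Sph m => (mob a t ht z.2 : Amb m) :=
        continuous_subtype_val.comp ((mob a t ht).continuous.comp continuous_snd)
      have h3 : Continuous fun z : unitInterval × Sph m => (z.1 : ℝ) := by fun_prop
      exact ((continuous_const.sub h3).continuousOn.smul h1).add (h3.smul h2).continuousOn
    · exact lerp_collapse_ne_zero hm hρ hρπ ht (angle_le_of_mem_closure hz.2) z.1.2.1 z.1.2.2
  have hQb : ∀ s, ∀ x ∈ closure (geodBall a ρ), x ∉ geodBall a ρ →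
      Q (s, x) ∈ Metric.ball (-a) δ := fun s x hx hx' => by
    have h1 := hmob x hx'
    have h2 := dist_radProj_lerp_le ((Metric.mem_ball.1 h1).le.trans hδ1) s.2.1 s.2.2
    simp only [Q, collapse_of_angle_eq hρ (angle_eq_of_mem_closure hx hx')]
    rw [coe_neg_sphere] at h2
    exact Metric.mem_ball.2 (h2.trans_lt h1)
  have hQ0 : ∀ x, Q (0, x) = radProj (collapse a ρ x) := fun x => by simp [Q]
  have hQ1 : ∀ x, Q (1, x) = mob a t ht x := fun x => by
    simp only [Q, Set.Icc.coe_one, sub_self, zero_smul, one_smul, zero_add, radProj_coe]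
  -- From `h ∘ collapse` to `F ∘ collapse`: the homotopy is fixed at `-a`, to which the boundary
  -- collapses, so the extension by `c` stays continuous.
  let K1 : unitInterval × Sph m → N := fun z =>
    if z.2 ∈ geodBall a ρ then H (z.1, Q (0, z.2)) else c
  have hK1 : Continuous K1 := by
    refine continuous_ite_prod hU (K := fun z : unitInterval × Sph m => H (z.1, Q (0, z.2)))
      (L := fun _ => c) ?_ continuous_const fun s x hx hx' => ?_
    · refine H.continuous.comp_continuousOn (ContinuousOn.prodMk (by fun_prop) ?_)
      exact hQ.comp (by fun_prop) fun z hz => ⟨trivial, hz.2⟩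
    · have h1 : Q (0, x) = -a := by
        rw [hQ0, collapse_of_angle_eq hρ (angle_eq_of_mem_closure hx hx'), ← coe_neg_sphere,
          radProj_coe]
      simp only [h1]
      rw [H.eq_fst s rfl, hh]
  -- From `F ∘ collapse` to `F ∘ mob`: on the boundary the interpolation moves between `-a` and a
  -- nearby point, in the ball where `F = c`.
  let K2 : unitInterval × Sph m → N := fun z =>
    if z.2 ∈ geodBall a ρ then F (Q z) else c
  have hK2 : Continuous K2 := by
    refine continuous_ite_prod hU (K := fun z : unitInterval × Sph m => F (Q z))
      (L := fun _ => c) (F.continuous.comp_continuousOn hQ) continuous_const fun s x hx hx' => ?_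
    exact hFc _ (hQb s x hx hx')
  let G1 : C(Sph m, N) := ⟨fun x => K1 (1, x), by fun_prop⟩
  have e1 : p.HomotopicRel G1 (geodBall a ρ)ᶜ := by
    refine homotopicRel_of_continuous K1 hK1 (fun x => ?_) (fun x => rfl) fun s x hx => ?_
    · by_cases hx : x ∈ geodBall a ρ
      · simp only [K1, hx, if_true, H.apply_zero, hQ0, hp x hx]
        exact (hind.eq_collapse hm hρπ (le_of_lt hx)).symm
      · simp only [K1, hx, if_false, hp' x hx]
    · have hx' : x ∉ geodBall a ρ := hx
      simp only [K1, hx', if_false, hp' x hx']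
  have e2 : G1.HomotopicRel (F.comp (mob a t ht : C(Sph m, Sph m))) (geodBall a ρ)ᶜ := by
    refine homotopicRel_of_continuous K2 hK2 (fun x => ?_) (fun x => ?_) fun s x hx => ?_
    · by_cases hx : x ∈ geodBall a ρ
      · simp only [K2, G1, K1, ContinuousMap.coe_mk, hx, if_true, H.apply_one]
      · simp only [K2, G1, K1, ContinuousMap.coe_mk, hx, if_false]
    · by_cases hx : x ∈ geodBall a ρ
      · simp only [K2, hx, if_true, hQ1]; rfl
      · simp only [K2, hx, if_false]
        exact (hFc _ (hmob x hx)).symm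
    · have hx' : x ∉ geodBall a ρ := hx
      simp only [K2, G1, K1, ContinuousMap.coe_mk, hx', if_false]
  exact (e1.trans e2).symm

end GeodBall

end SphereMaps

end

noncomputable section


namespace SphereMaps

open Filter Topology

/-! ### From bounds on derivatives to Lipschitz bounds. -/

section Lipschitz

variable {n : ℕ} {N : Type*} [MetricSpace N] [ChartedSpace (EuclideanSpace ℝ (Fin n)) N]
  [RiemannianBundle (fun x : N => TangentSpace (𝓡 n) x)] [IsRiemannianManifold (𝓡 n) N]

/-- The distance is the infimum of the lengths of curves, and `Ψ` multiplies the length of a nearly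
minimal curve by at most `K`. -/
lemma edist_le_of_norm_mfderiv_le {Ψ : N → N} (hΨ : ContMDiff (𝓡 n) (𝓡 n) 1 Ψ) {K : ℝ}
    (hK : 0 ≤ K) (hd : ∀ y v, ‖mfderiv (𝓡 n) (𝓡 n) Ψ y v‖ ≤ K * ‖v‖) (y z : N) :
    edist (Ψ y) (Ψ z) ≤ ENNReal.ofReal K * edist y z := by
  refine ENNReal.le_mul_of_forall_lt (Or.inr (edist_ne_top _ _)) (Or.inl ENNReal.ofReal_ne_top)
    fun K' hK' r hr => ?_
  rw [IsRiemannianManifold.out (I := 𝓡 n) (Ψ y)]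
  rw [gt_iff_lt, IsRiemannianManifold.out (I := 𝓡 n) y] at hr
  obtain ⟨γ, h0, h1, hγ, hl, -⟩ := exists_lt_locally_constant_of_riemannianEDist_lt hr zero_lt_one
  refine (riemannianEDist_le_pathELength (hΨ.comp hγ).contMDiffOn (congrArg Ψ h0)
    (congrArg Ψ h1) zero_le_one).trans ?_
  refine le_trans ?_ (mul_le_mul' hK'.le hl.le)
  rw [pathELength_eq_lintegral_mfderiv_Icc, pathELength_eq_lintegral_mfderiv_Icc,
    ← lintegral_const_mul' _ _ ENNReal.ofReal_ne_top]
  refine lintegral_mono fun t => ?_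
  have h2 := mfderiv_comp t (hΨ.mdifferentiableAt one_ne_zero (x := γ t))
    (hγ.mdifferentiableAt one_ne_zero (x := t))
  simp only [h2, ← ofReal_norm]
  rw [← ENNReal.ofReal_mul hK]
  exact ENNReal.ofReal_le_ofReal (hd _ _)

lemma edist_curve_le {σ : ℝ → N} (hσ : ContMDiff 𝓘(ℝ, ℝ) (𝓡 n) 1 σ) {K : ℝ}
    (hd : ∀ τ : ℝ, ‖(mfderiv 𝓘(ℝ, ℝ) (𝓡 n) σ τ : ℝ →L[ℝ] TangentSpace (𝓡 n) (σ τ)) 1‖ ≤ K)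
    (τ τ' : ℝ) : edist (σ τ) (σ τ') ≤ ENNReal.ofReal K * edist τ τ' := by
  wlog h : τ ≤ τ' generalizing τ τ'
  · rw [edist_comm, edist_comm τ]; exact this τ' τ (le_of_not_ge h)
  rw [IsRiemannianManifold.out (I := 𝓡 n) (σ τ)]
  refine (riemannianEDist_le_pathELength hσ.contMDiffOn rfl rfl h).trans ?_
  rw [pathELength_eq_lintegral_mfderiv_Icc]
  calc _ ≤ ∫⁻ t in Set.Icc τ τ', ENNReal.ofReal K := by
        refine lintegral_mono fun t => ?_
        rw [← ofReal_norm]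
        exact ENNReal.ofReal_le_ofReal (hd t)
    _ = _ := by
        rw [lintegral_const, Measure.restrict_apply_univ, Real.volume_Icc, edist_comm, edist_dist,
          Real.dist_eq, abs_of_nonneg (by linarith)]

end Lipschitz

section Affine

variable {n : ℕ} {N : Type*} [MetricSpace N] [ChartedSpace (EuclideanSpace ℝ (Fin n)) N]

lemma mdifferentiableAt_extChartAt_symm [IsManifold (𝓡 n) ∞ N] {b : N}
    {z : EuclideanSpace ℝ (Fin n)} (hz : z ∈ (extChartAt (𝓡 n) b).target) :
    MDifferentiableAt (𝓡 n) (𝓡 n) (extChartAt (𝓡 n) b).symm z := by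
  have := mdifferentiableWithinAt_extChartAt_symm (I := 𝓡 n) hz
  rwa [ModelWithCorners.range_eq_univ, mdifferentiableWithinAt_univ] at this

lemma mfderiv_affine_comp {κ : N → EuclideanSpace ℝ (Fin n)} {y : N}
    (hκ : MDifferentiableAt (𝓡 n) (𝓡 n) κ y)
    (Λ : EuclideanSpace ℝ (Fin n) →L[ℝ] EuclideanSpace ℝ (Fin n)) (c : EuclideanSpace ℝ (Fin n))
    (v : TangentSpace (𝓡 n) y) :
    mfderiv (𝓡 n) (𝓡 n) (fun y => Λ (κ y - c)) y v = Λ (mfderiv (𝓡 n) (𝓡 n) κ y v) := by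
  have h1 : HasFDerivAt (fun w => Λ (w - c)) Λ (κ y) :=
    Λ.hasFDerivAt.comp (κ y) ((hasFDerivAt_id _).sub_const c)
  have h2 := (HasMFDerivAt.comp (f := κ) (g := fun w => Λ (w - c)) y h1.hasMFDerivAt
    hκ.hasMFDerivAt).mfderiv
  exact congrArg (fun B : TangentSpace (𝓡 n) y →L[ℝ] EuclideanSpace ℝ (Fin n) => B v) h2

lemma mfderiv_comp_affine {φ : EuclideanSpace ℝ (Fin n) → N} {z c : EuclideanSpace ℝ (Fin n)}
    (Λ : EuclideanSpace ℝ (Fin n) →L[ℝ] EuclideanSpace ℝ (Fin n))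
    (hφ : MDifferentiableAt (𝓡 n) (𝓡 n) φ (c + Λ z)) (v : EuclideanSpace ℝ (Fin n)) :
    mfderiv (𝓡 n) (𝓡 n) (fun z => φ (c + Λ z)) z v = mfderiv (𝓡 n) (𝓡 n) φ (c + Λ z) (Λ v) := by
  have h1 : HasFDerivAt (fun w => c + Λ w) Λ z := Λ.hasFDerivAt.const_add _
  have h2 := (HasMFDerivAt.comp (f := fun w => c + Λ w) (g := φ) z hφ.hasMFDerivAt
    h1.hasMFDerivAt).mfderiv
  exact congrArg (fun B : EuclideanSpace ℝ (Fin n) →L[ℝ] TangentSpace (𝓡 n) (φ (c + Λ z)) => B v) h2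

end Affine

/-! ### Almost isometric charts. -/

section Chart

variable {n : ℕ} {N : Type*} [MetricSpace N] [ChartedSpace (EuclideanSpace ℝ (Fin n)) N]
  [IsManifold (𝓡 n) ∞ N] [RiemannianBundle (fun x : N => TangentSpace (𝓡 n) x)]
  [IsContMDiffRiemannianBundle (𝓡 n) ∞ (EuclideanSpace ℝ (Fin n))
      (fun x : N => TangentSpace (𝓡 n) x)]

variable (n) in
-- `Λ` normalises the chart so that its derivative at `b` is an isometry for the metric of the
-- tangent space at `b`. By continuity of the metric, the derivative and its inverse have norms less
-- than `r` nearby.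
lemma exists_equiv_norm_mfderiv_extChartAt_le (b : N) {r : ℝ} (hr : 1 < r) :
    ∃ Λ : EuclideanSpace ℝ (Fin n) ≃L[ℝ] EuclideanSpace ℝ (Fin n),
      (∀ᶠ y in 𝓝 b, ∀ v, ‖Λ (mfderiv (𝓡 n) (𝓡 n) (extChartAt (𝓡 n) b) y v)‖ ≤ r * ‖v‖) ∧
      ∀ᶠ z in 𝓝 (extChartAt (𝓡 n) b b), ∀ v : EuclideanSpace ℝ (Fin n),
        ‖mfderiv (𝓡 n) (𝓡 n) (extChartAt (𝓡 n) b).symm z (Λ.symm v)‖ ≤ r * ‖v‖ := by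
  let E := EuclideanSpace ℝ (Fin n)
  let T := trivializationAt E (fun x : N => TangentSpace (𝓡 n) x) b
  have : IsContinuousRiemannianBundle E (fun x : N => TangentSpace (𝓡 n) x) := by
    obtain ⟨g, hg, hg'⟩ := IsContMDiffRiemannianBundle.exists_contMDiff (IB := 𝓡 n) (n := ∞)
      (F := EuclideanSpace ℝ (Fin n)) (E := fun x : N => TangentSpace (𝓡 n) x)
    exact ⟨g, hg.continuous, hg'⟩
  have h1 := eventually_norm_symmL_trivializationAt_self_comp_lt E
    (fun x : N => TangentSpace (𝓡 n) x) b hr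
  have h2 := eventually_norm_symmL_trivializationAt_comp_self_lt E
    (fun x : N => TangentSpace (𝓡 n) x) b hr
  have hb : b ∈ T.baseSet := FiberBundle.mem_baseSet_trivializationAt' b
  let S : E ≃L[ℝ] TangentSpace (𝓡 n) b := (T.continuousLinearEquivAt ℝ b hb).symm
  have hfr : Module.finrank ℝ (TangentSpace (𝓡 n) b) = n := by
    have := S.toLinearEquiv.finrank_eq
    simp [E] at this
    exact this.symm
  have : FiniteDimensional ℝ (TangentSpace (𝓡 n) b) := S.toLinearEquiv.finiteDimensional
  -- `S` identifies the model space with the tangent space at `b`, whose norm is the Riemannian one;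
  -- `L` is an orthonormal frame there.
  let L : TangentSpace (𝓡 n) b ≃ₗᵢ[ℝ] E :=
    ((stdOrthonormalBasis ℝ (TangentSpace (𝓡 n) b)).reindex (finCongr hfr)).repr
  have hsrc := chart_source_mem_nhds E b
  refine ⟨S.trans L.toContinuousLinearEquiv, ?_, ?_⟩
  · filter_upwards [h1, hsrc] with y hy hys v
    have e : (S.trans L.toContinuousLinearEquiv) (T.continuousLinearMapAt ℝ y v) =
        L ((T.symmL ℝ b ∘L T.continuousLinearMapAt ℝ y) v) := by
      rw [ContinuousLinearMap.comp_apply]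
      exact congrArg L (congrFun (T.symm_continuousLinearEquivAt_eq (R := ℝ) hb) _)
    have h6 := TangentBundle.continuousLinearMapAt_trivializationAt (I := 𝓡 n) (𝕜 := ℝ) hys
    rw [← h6]
    refine (congrArg norm e).le.trans ?_
    rw [L.norm_map]
    exact (ContinuousLinearMap.le_opNorm _ _).trans
      (mul_le_mul_of_nonneg_right hy.le (norm_nonneg _))
  · have h4 : Tendsto (extChartAt (𝓡 n) b).symm (𝓝 (extChartAt (𝓡 n) b b)) (𝓝 b) := by
      have := continuousAt_extChartAt_symm (I := 𝓡 n) b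
      rwa [ContinuousAt, extChartAt_to_inv] at this
    filter_upwards [h4.eventually h2, h4.eventually hsrc,
      extChartAt_target_mem_nhds (I := 𝓡 n) b] with z hz hzs hzt v
    have h6 := TangentBundle.symmL_trivializationAt (I := 𝓡 n) (𝕜 := ℝ) hzs
    rw [ModelWithCorners.range_eq_univ, mfderivWithin_univ] at h6
    have e : T.symmL ℝ ((extChartAt (𝓡 n) b).symm z) ((S.trans L.toContinuousLinearEquiv).symm v) =
        (T.symmL ℝ ((extChartAt (𝓡 n) b).symm z) ∘L T.continuousLinearMapAt ℝ b) (L.symm v) := by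
      rw [ContinuousLinearMap.comp_apply]
      congr 1
      exact congrFun (T.coe_continuousLinearEquivAt_eq (R := ℝ) hb) (L.symm v)
    have h7 : ‖T.symmL ℝ ((extChartAt (𝓡 n) b).symm z)
        ((S.trans L.toContinuousLinearEquiv).symm v)‖ ≤ r * ‖v‖ := by
      rw [e, ← L.symm.norm_map v]
      exact (ContinuousLinearMap.le_opNorm _ _).trans
        (mul_le_mul_of_nonneg_right hz.le (norm_nonneg _))
    rw [h6] at h7
    have h8 := (extChartAt (𝓡 n) b).right_inv hzt
    rw [h8] at h7
    exact h7

variable (n) in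
/-- Charts that are almost isometric. -/
lemma exists_chart (b : N) {r : ℝ} (hr : 1 < r) :
    ∃ (α : EuclideanSpace ℝ (Fin n) → N) (β : N → EuclideanSpace ℝ (Fin n)) (O : Set N) (ρ : ℝ),
      0 < ρ ∧ IsOpen O ∧ b ∈ O ∧ β b = 0 ∧ ContMDiffOn (𝓡 n) (𝓡 n) 1 α (Metric.ball 0 ρ) ∧
      ContMDiffOn (𝓡 n) (𝓡 n) 1 β O ∧ (∀ y ∈ O, β y ∈ Metric.ball 0 ρ ∧ α (β y) = y) ∧
      (∀ z ∈ Metric.ball 0 ρ, α z ∈ O ∧ β (α z) = z) ∧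
      (∀ y ∈ O, ∀ v,
        norm (E := EuclideanSpace ℝ (Fin n)) (mfderiv (𝓡 n) (𝓡 n) β y v) ≤ r * ‖v‖) ∧
      ∀ z ∈ Metric.ball 0 ρ, ∀ v : EuclideanSpace ℝ (Fin n),
        ‖mfderiv (𝓡 n) (𝓡 n) α z v‖ ≤ r * ‖v‖ := by
  obtain ⟨Λ, h1, h2⟩ := exists_equiv_norm_mfderiv_extChartAt_le n b hr
  let E := EuclideanSpace ℝ (Fin n)
  set κ := extChartAt (𝓡 n) b with hκ
  let A : E → E := fun z => κ b + Λ.symm z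
  let A' : E → E := fun w => Λ (w - κ b)
  have hA : ContDiff ℝ 1 A := contDiff_const.add Λ.symm.contDiff
  have hA' : ContDiff ℝ 1 A' := Λ.contDiff.comp (contDiff_id.sub contDiff_const)
  have hAA' : ∀ w, A (A' w) = w := fun w => by simp [A, A']
  have hA'A : ∀ w, A' (A w) = w := fun w => by simp [A, A']
  obtain ⟨ρ, hρ, hball⟩ : ∃ ρ > 0, ∀ z ∈ Metric.ball (0 : E) ρ, A z ∈ κ.target ∧
      (∀ v, ‖Λ (mfderiv (𝓡 n) (𝓡 n) κ (κ.symm (A z)) v)‖ ≤ r * ‖v‖) ∧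
      ∀ v : E, ‖mfderiv (𝓡 n) (𝓡 n) κ.symm (A z) (Λ.symm v)‖ ≤ r * ‖v‖ := by
    have h3 : Tendsto A (𝓝 0) (𝓝 (κ b)) := by
      have := hA.continuous.tendsto 0
      simpa [A] using this
    have h4 : Tendsto κ.symm (𝓝 (κ b)) (𝓝 b) := by
      have := continuousAt_extChartAt_symm (I := 𝓡 n) b
      rwa [ContinuousAt, extChartAt_to_inv] at this
    have h5 := h3.eventually (extChartAt_target_mem_nhds (I := 𝓡 n) b)
    exact Metric.eventually_nhds_iff_ball.1
      (h5.and (((h4.comp h3).eventually h1).and (h3.eventually h2)))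
  have hsrc : ∀ y ∈ κ.source, y ∈ (chartAt E b).source := fun y hy => by
    rwa [hκ, extChartAt_source] at hy
  let O := κ.source ∩ (fun y => A' (κ y)) ⁻¹' Metric.ball 0 ρ
  have hO1 : ∀ y ∈ O, κ.symm (A (A' (κ y))) = y := fun y hy => by
    rw [hAA']; exact κ.left_inv hy.1
  refine ⟨fun z => κ.symm (A z), fun y => A' (κ y), O, ρ, hρ, ?_, ?_, ?_, ?_, ?_, ?_, ?_, ?_, ?_⟩
  · exact (hA'.continuous.comp_continuousOn (continuousOn_extChartAt b)).isOpen_inter_preimage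
      (isOpen_extChartAt_source b) Metric.isOpen_ball
  · exact ⟨mem_extChartAt_source b, by simpa [A'] using hρ⟩
  · simp [A']
  · exact (contMDiffOn_extChartAt_symm b).comp hA.contMDiff.contMDiffOn fun z hz => (hball z hz).1
  · refine hA'.contMDiff.comp_contMDiffOn ((contMDiffOn_extChartAt (x := b)).mono fun y hy => ?_)
    exact hsrc y hy.1
  · exact fun y hy => ⟨hy.2, hO1 y hy⟩
  · intro z hz
    have h3 := κ.right_inv (hball z hz).1
    have h4 : A' (κ (κ.symm (A z))) = z := by rw [h3, hA'A]
    exact ⟨⟨κ.map_target (hball z hz).1, by simpa only [Set.mem_preimage, h4] using hz⟩, h4⟩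
  · intro y hy v
    have h3 := (hball _ hy.2).2.1
    rw [hO1 y hy] at h3
    have h4 := mfderiv_affine_comp (mdifferentiableAt_extChartAt (I := 𝓡 n) (hsrc y hy.1))
      (Λ : E →L[ℝ] E) (κ b) v
    exact (congrArg (norm (E := E)) h4).le.trans (h3 v)
  · intro z hz v
    have hs := (hball z hz).1
    have h4 := mfderiv_comp_affine (Λ.symm : E →L[ℝ] E) (mdifferentiableAt_extChartAt_symm hs) v
    exact (congrArg norm h4).le.trans ((hball z hz).2.2 v)

end Chart

end SphereMaps

end

noncomputable section


namespace SphereMaps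

open Filter Topology

/-! ### Logarithmic cut-off in Euclidean space. -/

section Cutoff

lemma exists_abs_deriv_smoothTransition_le :
    ∃ C > 0, ∀ x, |deriv Real.smoothTransition x| ≤ C := by
  have hc : Continuous (deriv Real.smoothTransition) :=
    (Real.smoothTransition.contDiff (n := 1)).continuous_deriv le_rfl
  obtain ⟨C, hC⟩ := isCompact_Icc.exists_bound_of_continuousOn (s := Set.Icc (0 : ℝ) 1)
    hc.continuousOn
  refine ⟨max C 1, by positivity, fun x => ?_⟩
  by_cases h0 : x < 0
  · have : Real.smoothTransition =ᶠ[𝓝 x] fun _ => 0 := by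
      filter_upwards [gt_mem_nhds h0] with y hy
      exact Real.smoothTransition.zero_of_nonpos hy.le
    rw [this.deriv_eq]; simp
  by_cases h1 : 1 < x
  · have : Real.smoothTransition =ᶠ[𝓝 x] fun _ => 1 := by
      filter_upwards [lt_mem_nhds h1] with y hy
      exact Real.smoothTransition.one_of_one_le hy.le
    rw [this.deriv_eq]; simp
  · exact (hC x ⟨not_lt.1 h0, not_lt.1 h1⟩).trans (le_max_left _ _)

/-- A map that collapses a neighbourhood of the origin, with a derivative of norm close to `1`. -/
lemma exists_collapse_origin {E : Type*} [NormedAddCommGroup E] [InnerProductSpace ℝ E] {ρ ε : ℝ}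
    (hρ : 0 < ρ) (hε : 0 < ε) :
    ∃ (μ : E → E) (ρ₁ ρ₂ : ℝ), 0 < ρ₁ ∧ 0 < ρ₂ ∧ ρ₂ < ρ ∧ ContDiff ℝ 1 μ ∧
      (∀ z, ‖z‖ < ρ₁ → μ z = 0) ∧ (∀ z, ρ₂ ≤ ‖z‖ → μ z = z) ∧ (∀ z, ‖μ z‖ ≤ ‖z‖) ∧
      ∀ z v, ‖fderiv ℝ μ z v‖ ≤ (1 + ε) * ‖v‖ := by
  obtain ⟨C, hC, hCb⟩ := exists_abs_deriv_smoothTransition_le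
  obtain ⟨η, hη, hηε⟩ : ∃ η > 0, C * η * 2 = ε := ⟨ε / (2 * C), by positivity, by field_simp⟩
  -- The derivative of `u` has norm `2 η / ‖z‖`, so in the derivative of `μ` the cut-off contributes
  -- at most `2 C η = ε`, independently of the scale. Here `u ≥ 1` for `‖z‖ ≥ ρ / 2`, and `u ≤ 0`
  -- below `ρ₁`.
  let u : E → ℝ := fun z => η * Real.log (‖z‖ ^ 2) + (1 - η * Real.log ((ρ / 2) ^ 2))
  let μ : E → E := fun z => Real.smoothTransition (u z) • z
  let ρ₁ := ρ / 2 * Real.exp (-(1 / (2 * η)))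
  have hρ₁ : 0 < ρ₁ := by positivity
  have h1 : ∀ z, ‖z‖ < ρ₁ → μ z = 0 := fun z hz => by
    rcases eq_or_ne z 0 with rfl | h0
    · simp [μ]
    have hz0 : 0 < ‖z‖ := norm_pos_iff.2 h0
    have h3 : Real.log (‖z‖ ^ 2) ≤ Real.log ((ρ / 2) ^ 2) - 1 / η := by
      rw [Real.log_pow, Real.log_pow]
      have h4 := Real.log_le_log hz0 hz.le
      rw [Real.log_mul (by positivity) (Real.exp_pos _).ne', Real.log_exp] at h4
      have : 1 / η = 2 * (1 / (2 * η)) := by field_simp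
      push_cast
      linarith
    have h5 : u z ≤ 0 := by
      have := mul_le_mul_of_nonneg_left h3 hη.le
      have h6 : η * (1 / η) = 1 := by field_simp
      simp only [u]
      linarith
    simp [μ, Real.smoothTransition.zero_of_nonpos h5]
  have h2 : ∀ z, ρ / 2 ≤ ‖z‖ → μ z = z := fun z hz => by
    have h3 : Real.log ((ρ / 2) ^ 2) ≤ Real.log (‖z‖ ^ 2) :=
      Real.log_le_log (by positivity) (by gcongr)
    have h5 : 1 ≤ u z := by
      have := mul_le_mul_of_nonneg_left h3 hη.le
      simp only [u]
      linarith
    simp [μ, Real.smoothTransition.one_of_one_le h5]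
  have hμ0 : μ =ᶠ[𝓝 0] fun _ => 0 := by
    filter_upwards [Metric.ball_mem_nhds (0 : E) hρ₁] with z hz
    exact h1 z (by simpa using hz)
  have hu : ∀ z, z ≠ 0 → ContDiffAt ℝ 1 u z := fun z hz => by
    have : ContDiffAt ℝ 1 (fun z : E => ‖z‖ ^ 2) z := (contDiff_norm_sq ℝ).contDiffAt
    exact (contDiffAt_const.mul (this.log (by positivity))).add contDiffAt_const
  refine ⟨μ, ρ₁, ρ / 2, hρ₁, by positivity, by linarith, ?_, h1, h2, fun z => ?_, fun z v => ?_⟩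
  · rw [contDiff_iff_contDiffAt]
    intro z
    rcases eq_or_ne z 0 with rfl | h0
    · exact contDiffAt_const.congr_of_eventuallyEq hμ0
    · exact (Real.smoothTransition.contDiff.contDiffAt.comp z (hu z h0)).smul contDiffAt_id
  · rw [norm_smul, Real.norm_eq_abs, abs_of_nonneg (Real.smoothTransition.nonneg _)]
    exact mul_le_of_le_one_left (norm_nonneg _) (Real.smoothTransition.le_one _)
  · rcases eq_or_ne z 0 with rfl | h0
    · rw [hμ0.fderiv_eq]
      simp only [fderiv_fun_const, Pi.zero_apply, zero_apply, norm_zero]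
      positivity
    have hz0 : 0 < ‖z‖ := norm_pos_iff.2 h0
    have e1 : HasFDerivAt u (η • ((‖z‖ ^ 2)⁻¹ • ((2 : ℝ) • innerSL ℝ z))) z := by
      have h3 : HasFDerivAt (fun z : E => ‖z‖ ^ 2) ((2 : ℝ) • innerSL ℝ z) z := by
        have := (hasStrictFDerivAt_norm_sq z).hasFDerivAt
        rwa [two_nsmul, ← two_smul ℝ] at this
      exact ((h3.log (by positivity)).const_mul η).add_const _
    have e2 : HasFDerivAt (fun z => Real.smoothTransition (u z))
        (deriv Real.smoothTransition (u z) • (η • ((‖z‖ ^ 2)⁻¹ • ((2 : ℝ) • innerSL ℝ z)))) z :=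
      (((Real.smoothTransition.contDiff (n := 1)).differentiable
        one_ne_zero (u z)).hasDerivAt).comp_hasFDerivAt z e1
    have e3 := e2.smul (hasFDerivAt_id z)
    have e4 : fderiv ℝ μ z v = Real.smoothTransition (u z) • v +
        (deriv Real.smoothTransition (u z) * (η * ((‖z‖ ^ 2)⁻¹ * (2 * inner ℝ z v)))) • z := by
      rw [show fderiv ℝ μ z = _ from e3.fderiv]
      simp
    rw [e4, ← hηε]
    refine (norm_add_le _ _).trans ?_
    rw [norm_smul, norm_smul, Real.norm_eq_abs, Real.norm_eq_abs,
      abs_of_nonneg (Real.smoothTransition.nonneg _), abs_mul, abs_mul, abs_mul, abs_mul,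
      abs_of_pos hη, abs_of_pos (inv_pos.2 (pow_pos hz0 2)), abs_two]
    have e5 : Real.smoothTransition (u z) * ‖v‖ ≤ ‖v‖ :=
      mul_le_of_le_one_left (norm_nonneg _) (Real.smoothTransition.le_one _)
    have e6 := abs_real_inner_le_norm z v
    calc _ ≤ ‖v‖ + C * (η * ((‖z‖ ^ 2)⁻¹ * (2 * (‖z‖ * ‖v‖)))) * ‖z‖ := by
          gcongr
          exact hCb _
      _ = _ := by field_simp

end Cutoff

/-! ### Collapsing a neighbourhood of a point of the manifold. -/

section Collapse

variable {n : ℕ} {N : Type*} [MetricSpace N] [ChartedSpace (EuclideanSpace ℝ (Fin n)) N]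
  [IsManifold (𝓡 n) ∞ N] [RiemannianBundle (fun x : N => TangentSpace (𝓡 n) x)]
  [IsContMDiffRiemannianBundle (𝓡 n) ∞ (EuclideanSpace ℝ (Fin n))
      (fun x : N => TangentSpace (𝓡 n) x)]

omit [IsManifold (𝓡 n) ∞ N] [RiemannianBundle (fun x : N => TangentSpace (𝓡 n) x)]
  [IsContMDiffRiemannianBundle (𝓡 n) ∞ (EuclideanSpace ℝ (Fin n))
      (fun x : N => TangentSpace (𝓡 n) x)] in
lemma mfderiv_comp_comp {α : EuclideanSpace ℝ (Fin n) → N} {β : N → EuclideanSpace ℝ (Fin n)}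
    {μ : EuclideanSpace ℝ (Fin n) → EuclideanSpace ℝ (Fin n)} {y : N}
    (hβ : MDifferentiableAt (𝓡 n) (𝓡 n) β y) (hμ : DifferentiableAt ℝ μ (β y))
    (hα : MDifferentiableAt (𝓡 n) (𝓡 n) α (μ (β y))) (v : TangentSpace (𝓡 n) y) :
    mfderiv (𝓡 n) (𝓡 n) (fun y => α (μ (β y))) y v =
      mfderiv (𝓡 n) (𝓡 n) α (μ (β y)) (fderiv ℝ μ (β y) (mfderiv (𝓡 n) (𝓡 n) β y v)) := by
  have h1 := HasMFDerivAt.comp (f := β) (g := μ) y hμ.hasFDerivAt.hasMFDerivAt hβ.hasMFDerivAt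
  have h2 := (HasMFDerivAt.comp (f := fun y => μ (β y)) (g := α) y hα.hasMFDerivAt h1).mfderiv
  exact congrArg (fun B : TangentSpace (𝓡 n) y →L[ℝ] TangentSpace (𝓡 n) (α (μ (β y))) => B v) h2

omit [IsManifold (𝓡 n) ∞ N] [IsContMDiffRiemannianBundle (𝓡 n) ∞ (EuclideanSpace ℝ (Fin n))
      (fun x : N => TangentSpace (𝓡 n) x)] in
-- The two derivatives take values in tangent spaces at points that are only propositionally equal,
-- and the norm depends on the point.
lemma norm_mfderiv_congr {Ψ Φ : N → N} {y : N} (h : Ψ =ᶠ[𝓝 y] Φ) (v : TangentSpace (𝓡 n) y) :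
    ‖mfderiv (𝓡 n) (𝓡 n) Ψ y v‖ = ‖mfderiv (𝓡 n) (𝓡 n) Φ y v‖ := by
  have key : ∀ {a a' : N} (_ : a = a') (w : TangentSpace (𝓡 n) a) (w' : TangentSpace (𝓡 n) a'),
      (show EuclideanSpace ℝ (Fin n) from w) = w' → ‖w‖ = ‖w'‖ := by
    rintro a a' rfl w w' h'
    exact congrArg norm h'
  refine key h.self_of_nhds _ _ ?_
  exact congrArg (fun B : TangentSpace (𝓡 n) y →L[ℝ] EuclideanSpace ℝ (Fin n) => B v) h.mfderiv_eq

open Classical in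
variable (n) in
/-- Collapsing a neighbourhood of a point, with a derivative of norm close to `1`. -/
lemma exists_collapse_point (b : N) {ε : ℝ} (hε : 0 < ε) :
    ∃ Ψ : N → N, ContMDiff (𝓡 n) (𝓡 n) 1 Ψ ∧
      (∀ y v, ‖mfderiv (𝓡 n) (𝓡 n) Ψ y v‖ ≤ (1 + ε) * ‖v‖) ∧
      (∀ᶠ y in 𝓝 b, Ψ y = b ∧ mfderiv (𝓡 n) (𝓡 n) Ψ y = 0) ∧
      ∃ H : C(unitInterval × N, N), (∀ y, H (0, y) = y) ∧ (∀ y, H (1, y) = Ψ y) ∧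
        ∀ s, H (s, b) = b := by
  -- The chart, the cut-off and the inverse chart each cost a factor `1 + e`, and `(1 + e) ^ 3 ≤ 1 +
  -- 7 e` for `e ≤ 1`.
  let e := min 1 (ε / 7)
  have he : 0 < e := by positivity
  have he' : (1 + e) * ((1 + e) * (1 + e)) ≤ 1 + ε := by
    have h1 : e ≤ 1 := min_le_left _ _
    have h2 : e ≤ ε / 7 := min_le_right _ _
    have h3 : e ^ 2 ≤ e := by nlinarith
    have h4 : e ^ 3 ≤ e := by nlinarith
    nlinarith
  obtain ⟨α, β, O, ρ, hρ, hO, hbO, hβb, hα, hβ, hβO, hαO, hβd, hαd⟩ :=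
    exists_chart n b (lt_add_of_pos_right 1 he)
  obtain ⟨μ, ρ₁, ρ₂, hρ₁, hρ₂, hρ₂', hμ, hμ0, hμ1, hμn, hμd⟩ :=
    exists_collapse_origin (E := EuclideanSpace ℝ (Fin n)) hρ he
  obtain ⟨ρ₃, h23, h3⟩ := exists_between hρ₂'
  have hμball : ∀ z ∈ Metric.ball (0 : EuclideanSpace ℝ (Fin n)) ρ, μ z ∈ Metric.ball 0 ρ :=
    fun z hz => by
      rw [mem_ball_zero_iff] at hz ⊢
      exact (hμn z).trans_lt hz
  let U : Set N := O ∩ β ⁻¹' Metric.ball 0 ρ₃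
  have hU : IsOpen U := hβ.continuousOn.isOpen_inter_preimage hO Metric.isOpen_ball
  -- The image of a closed ball is compact, hence closed in `N`. This keeps the closure of `U`
  -- inside the chart domain, so that the extension by the identity is `C^1`.
  have hcl : closure U ⊆ α '' Metric.closedBall 0 ρ₃ := by
    refine closure_minimal (fun y hy => ⟨β y, Metric.ball_subset_closedBall hy.2, (hβO y hy.1).2⟩) ?_
    refine ((isCompact_closedBall _ _).image_of_continuousOn ?_).isClosed
    exact hα.continuousOn.mono (Metric.closedBall_subset_ball h3)
  have hclO : closure U ⊆ O := fun y hy => by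
    obtain ⟨z, hz, rfl⟩ := hcl hy
    exact (hαO z (Metric.closedBall_subset_ball h3 hz)).1
  have hout : ∀ y ∈ O, y ∉ U → μ (β y) = β y := fun y hy hyU => by
    refine hμ1 _ (h23.le.trans (not_lt.1 fun h => hyU ⟨hy, ?_⟩))
    simpa using h
  let Ψ : N → N := fun y => if y ∈ U then α (μ (β y)) else y
  have hΨ1 : ∀ y ∈ O, Ψ =ᶠ[𝓝 y] fun y => α (μ (β y)) := fun y hy => by
    filter_upwards [hO.mem_nhds hy] with w hw
    by_cases hwU : w ∈ U
    · simp [Ψ, hwU]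
    · simp only [Ψ, hwU, if_false]
      rw [hout w hw hwU, (hβO w hw).2]
  have hΨ2 : ∀ y ∉ O, Ψ =ᶠ[𝓝 y] id := fun y hy => by
    filter_upwards [isClosed_closure.isOpen_compl.mem_nhds fun h => hy (hclO h)] with w hw
    have hwU : w ∉ U := fun h => hw (subset_closure h)
    simp [Ψ, hwU]
  have hβat : ∀ y ∈ O, ContMDiffAt (𝓡 n) (𝓡 n) 1 β y := fun y hy =>
    hβ.contMDiffAt (hO.mem_nhds hy)
  have hαat : ∀ z ∈ Metric.ball 0 ρ, ContMDiffAt (𝓡 n) (𝓡 n) 1 α z := fun z hz =>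
    hα.contMDiffAt (Metric.isOpen_ball.mem_nhds hz)
  refine ⟨Ψ, fun y => ?_, fun y v => ?_, ?_, ?_⟩
  · by_cases hy : y ∈ O
    · refine ContMDiffAt.congr_of_eventuallyEq ?_ (hΨ1 y hy)
      exact (hαat _ (hμball _ (hβO y hy).1)).comp y
        (hμ.contMDiff.contMDiffAt.comp y (hβat y hy))
    · exact contMDiffAt_id.congr_of_eventuallyEq (hΨ2 y hy)
  · by_cases hy : y ∈ O
    · have h1 := mfderiv_comp_comp ((hβat y hy).mdifferentiableAt one_ne_zero)
        (hμ.differentiable one_ne_zero (β y))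
        ((hαat _ (hμball _ (hβO y hy).1)).mdifferentiableAt one_ne_zero) v
      have h2 : ‖mfderiv (𝓡 n) (𝓡 n) Ψ y v‖ =
          ‖mfderiv (𝓡 n) (𝓡 n) (fun y => α (μ (β y))) y v‖ := norm_mfderiv_congr (hΨ1 y hy) v
      rw [h2, h1]
      refine (hαd _ (hμball _ (hβO y hy).1) _).trans ?_
      calc _ ≤ (1 + e) * ((1 + e) * ((1 + e) * ‖v‖)) := by
            refine mul_le_mul_of_nonneg_left ((hμd _ _).trans ?_) (by positivity)
            exact mul_le_mul_of_nonneg_left (hβd y hy v) (by positivity)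
        _ = ((1 + e) * ((1 + e) * (1 + e))) * ‖v‖ := by ring
        _ ≤ _ := mul_le_mul_of_nonneg_right he' (norm_nonneg _)
    · have h2 : ‖mfderiv (𝓡 n) (𝓡 n) Ψ y v‖ = ‖v‖ := by
        rw [norm_mfderiv_congr (hΨ2 y hy), mfderiv_id]; rfl
      rw [h2]
      nlinarith [norm_nonneg v]
  · have h1 : ∀ᶠ y in 𝓝 b, Ψ y = b := by
      have h2 : Tendsto β (𝓝 b) (𝓝 0) := by
        have := (hβat b hbO).continuousAt
        rwa [ContinuousAt, hβb] at this
      filter_upwards [hΨ1 b hbO, h2.eventually (Metric.ball_mem_nhds _ hρ₁)] with y hy hy'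
      rw [hy, hμ0 _ (by simpa using hy'), ← hβb, (hβO b hbO).2]
    filter_upwards [eventually_eventually_nhds.2 h1] with y hy
    refine ⟨hy.self_of_nhds, ?_⟩
    have h3 : Ψ =ᶠ[𝓝 y] fun _ => b := hy
    exact h3.mfderiv_eq.trans mfderiv_const
  -- The homotopy to the identity is linear in the chart; `b` is the origin, which it fixes.
  · let L : unitInterval × N → EuclideanSpace ℝ (Fin n) := fun z =>
      (1 - (z.1 : ℝ)) • β z.2 + (z.1 : ℝ) • μ (β z.2)
    have hLb : ∀ s, ∀ y ∈ O, L (s, y) ∈ Metric.ball 0 ρ := fun s y hy =>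
      convex_ball (0 : EuclideanSpace ℝ (Fin n)) ρ (hβO y hy).1 (hμball _ (hβO y hy).1)
        (sub_nonneg.2 s.2.2) s.2.1 (sub_add_cancel _ _)
    have hLc : ContinuousOn L (Set.univ ×ˢ closure U) := by
      have h1 : ContinuousOn (fun z : unitInterval × N => β z.2) (Set.univ ×ˢ closure U) :=
        hβ.continuousOn.comp continuous_snd.continuousOn fun z hz => hclO hz.2
      have h2 : Continuous fun z : unitInterval × N => (z.1 : ℝ) := by fun_prop
      exact ((continuous_const.sub h2).continuousOn.smul h1).add
        (h2.continuousOn.smul (hμ.continuous.comp_continuousOn h1))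
    have hK : Continuous fun z : unitInterval × N => if z.2 ∈ U then α (L z) else z.2 := by
      refine continuous_ite_prod hU (K := fun z => α (L z)) (L := fun z => z.2) ?_ continuous_snd
        fun s y hy hyU => ?_
      · exact hα.continuousOn.comp hLc fun z hz => hLb z.1 z.2 (hclO hz.2)
      · have : L (s, y) = β y := by
          simp only [L, hout y (hclO hy) hyU]
          module
        simp only [this, (hβO y (hclO hy)).2]
    refine ⟨⟨_, hK⟩, fun y => ?_, fun y => ?_, fun s => ?_⟩
    · by_cases hy : y ∈ U
      · simp [hy, L, (hβO y hy.1).2]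
      · simp [hy]
    · simp [Ψ, L]
    · have hb0 : μ 0 = 0 := hμ0 0 (by simpa using hρ₁)
      have : b ∈ U := ⟨hbO, by simp [hβb, hρ₂.trans h23]⟩
      simp only [ContinuousMap.coe_mk, this, if_true, L, hβb, hb0, smul_zero, add_zero]
      rw [← hβb, (hβO b hbO).2]

end Collapse

end SphereMaps

end

noncomputable section


namespace SphereMaps

open Filter Topology

/-! ### Smoothing of paths within a chart. -/

section Curve

variable {n : ℕ} {N : Type*} [MetricSpace N] [ChartedSpace (EuclideanSpace ℝ (Fin n)) N]
  [RiemannianBundle (fun x : N => TangentSpace (𝓡 n) x)]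

lemma norm_mfderiv_curve_comp_affine_le {σ : ℝ → N} (hσ : ContMDiff 𝓘(ℝ, ℝ) (𝓡 n) 1 σ) {K : ℝ}
    (hd : ∀ τ : ℝ, ‖(mfderiv 𝓘(ℝ, ℝ) (𝓡 n) σ τ : ℝ →L[ℝ] TangentSpace (𝓡 n) (σ τ)) 1‖ ≤ K)
    (u : ℝ) {d : ℝ} (h0 : 0 ≤ d) (τ : ℝ) :
    ‖(mfderiv 𝓘(ℝ, ℝ) (𝓡 n) (fun τ => σ (u + d * τ)) τ :
      ℝ →L[ℝ] TangentSpace (𝓡 n) (σ (u + d * τ))) 1‖ ≤ K * d := by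
  have h1 : HasFDerivAt (fun τ => u + d * τ) (ContinuousLinearMap.toSpanSingleton ℝ d) τ := by
    have := ((hasDerivAt_id τ).const_mul d).const_add u
    simpa using this.hasFDerivAt
  have h2 := (HasMFDerivAt.comp (f := fun τ => u + d * τ) (g := σ) τ
    (hσ.mdifferentiableAt one_ne_zero).hasMFDerivAt h1.hasMFDerivAt).mfderiv
  have h3 := congrArg (fun B : ℝ →L[ℝ] TangentSpace (𝓡 n) (σ (u + d * τ)) => B 1) h2
  have h4 : (mfderiv 𝓘(ℝ, ℝ) (𝓡 n) (fun τ => σ (u + d * τ)) τ :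
      ℝ →L[ℝ] TangentSpace (𝓡 n) (σ (u + d * τ))) 1 =
      d • (mfderiv 𝓘(ℝ, ℝ) (𝓡 n) σ (u + d * τ) :
        ℝ →L[ℝ] TangentSpace (𝓡 n) (σ (u + d * τ))) 1 := by
    have key : ∀ B : ℝ →L[ℝ] TangentSpace (𝓡 n) (σ (u + d * τ)),
        B (ContinuousLinearMap.toSpanSingleton ℝ d 1) = d • B 1 := fun B => by
      rw [← map_smul, ContinuousLinearMap.toSpanSingleton_apply, one_smul, smul_eq_mul, mul_one]
    exact h3.trans (key _)
  rw [h4, norm_smul, Real.norm_eq_abs, abs_of_nonneg h0, mul_comm]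
  exact mul_le_mul_of_nonneg_right (hd _) h0

variable [IsManifold (𝓡 n) ∞ N] [IsContMDiffRiemannianBundle (𝓡 n) ∞ (EuclideanSpace ℝ (Fin n))
      (fun x : N => TangentSpace (𝓡 n) x)]

variable (n) in
/-- Every point has a neighbourhood in which each path can be deformed into a `C^1` curve. -/
lemma exists_curve_homotopy (b : N) : ∃ O : Set N, IsOpen O ∧ b ∈ O ∧
    ∀ γ : C(unitInterval, N), (∀ r, γ r ∈ O) → ∃ (σ : ℝ → N) (K : ℝ), 0 ≤ K ∧
      ContMDiff 𝓘(ℝ, ℝ) (𝓡 n) 1 σ ∧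
      (∀ τ : ℝ, ‖(mfderiv 𝓘(ℝ, ℝ) (𝓡 n) σ τ : ℝ →L[ℝ] TangentSpace (𝓡 n) (σ τ)) 1‖ ≤ K) ∧
      ∃ P : C(unitInterval × unitInterval, N), (∀ r : unitInterval, P (0, r) = σ r) ∧
        (∀ r, P (1, r) = γ r) ∧ (∀ s, P (s, 0) = γ 0) ∧ ∀ s, P (s, 1) = γ 1 := by
  obtain ⟨α, β, O, ρ, hρ, hO, hbO, hβb, hα, hβ, hβO, hαO, hβd, hαd⟩ :=
    exists_chart n b one_lt_two
  obtain ⟨C, hC, hCb⟩ := exists_abs_deriv_smoothTransition_le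
  refine ⟨O, hO, hbO, fun γ hγ => ?_⟩
  let E := EuclideanSpace ℝ (Fin n)
  let z : E := β (γ 0)
  let w : E := β (γ 1) - β (γ 0)
  -- The chord between the end points, in the chart. The transition function extends it to all of
  -- `ℝ`, stationary outside the unit interval, which bounds its speed.
  let c : ℝ → E := fun τ => z + Real.smoothTransition τ • w
  have hcball : ∀ τ, c τ ∈ Metric.ball 0 ρ := fun τ => by
    have := convex_ball (0 : E) ρ (hβO _ (hγ 0)).1 (hβO _ (hγ 1)).1
      (sub_nonneg.2 (Real.smoothTransition.le_one τ)) (Real.smoothTransition.nonneg τ)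
      (sub_add_cancel _ _)
    convert this using 1
    simp only [c, z, w]
    module
  have hc : ContDiff ℝ 1 c :=
    contDiff_const.add (Real.smoothTransition.contDiff.smul contDiff_const)
  have hcd : ∀ τ, HasFDerivAt c (ContinuousLinearMap.toSpanSingleton ℝ
      (deriv Real.smoothTransition τ • w)) τ := fun τ => by
    have h1 := ((Real.smoothTransition.contDiff (n := 1)).differentiable
        one_ne_zero τ).hasDerivAt
    exact ((h1.smul_const w).const_add z).hasFDerivAt
  have hαat : ∀ z ∈ Metric.ball 0 ρ, ContMDiffAt (𝓡 n) (𝓡 n) 1 α z := fun z hz =>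
    hα.contMDiffAt (Metric.isOpen_ball.mem_nhds hz)
  refine ⟨fun τ => α (c τ), 2 * (C * ‖w‖), by positivity, fun τ => ?_, fun τ => ?_, ?_⟩
  · exact (hαat _ (hcball τ)).comp τ hc.contMDiff.contMDiffAt
  · have h2 := (HasMFDerivAt.comp (f := c) (g := α) τ
      ((hαat _ (hcball τ)).mdifferentiableAt one_ne_zero).hasMFDerivAt (hcd τ).hasMFDerivAt).mfderiv
    have h3 := congrArg (fun B : ℝ →L[ℝ] TangentSpace (𝓡 n) (α (c τ)) => B 1) h2
    refine (congrArg norm h3).le.trans ?_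
    refine (hαd _ (hcball τ) _).trans (mul_le_mul_of_nonneg_left ?_ zero_le_two)
    have h4 : ContinuousLinearMap.toSpanSingleton ℝ (deriv Real.smoothTransition τ • w) (1 : ℝ) =
        deriv Real.smoothTransition τ • w := by
      rw [ContinuousLinearMap.toSpanSingleton_apply, one_smul]
    refine (congrArg (norm (E := E)) h4).le.trans ?_
    rw [norm_smul]
    exact mul_le_mul_of_nonneg_right (hCb τ) (norm_nonneg _)
  · let L : unitInterval × unitInterval → E := fun x =>
      (1 - (x.1 : ℝ)) • c x.2 + (x.1 : ℝ) • β (γ x.2)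
    have hβγ : Continuous fun x : unitInterval × unitInterval => β (γ x.2) :=
      hβ.continuousOn.comp_continuous (by fun_prop) fun x => hγ x.2
    have hL : Continuous L := by
      have h1 : Continuous fun x : unitInterval × unitInterval => c x.2 :=
        hc.continuous.comp (by fun_prop)
      have h2 : Continuous fun x : unitInterval × unitInterval => (x.1 : ℝ) := by fun_prop
      exact ((continuous_const.sub h2).smul h1).add (h2.smul hβγ)
    have hLb : ∀ x, L x ∈ Metric.ball 0 ρ := fun x =>
      convex_ball (0 : E) ρ (hcball x.2) (hβO _ (hγ x.2)).1
        (sub_nonneg.2 x.1.2.2) x.1.2.1 (sub_add_cancel _ _)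
    refine ⟨⟨fun x => α (L x), hα.continuousOn.comp_continuous hL hLb⟩, fun r => ?_, fun r => ?_,
      fun s => ?_, fun s => ?_⟩
    · simp [L]
    · simp [L, (hβO _ (hγ r)).2]
    · have : L (s, 0) = β (γ 0) := by
        simp only [L, c, z, Set.Icc.coe_zero, Real.smoothTransition.zero]
        module
      simp only [ContinuousMap.coe_mk, this, (hβO _ (hγ 0)).2]
    · have : L (s, 1) = β (γ 1) := by
        simp only [L, c, z, w, Set.Icc.coe_one, Real.smoothTransition.one]
        module
      simp only [ContinuousMap.coe_mk, this, (hβO _ (hγ 1)).2]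

end Curve

/-! ### Chains of bubbles along a curve. -/

section Bubbles

variable {m n : ℕ} {N : Type*} [MetricSpace N] [ChartedSpace (EuclideanSpace ℝ (Fin n)) N]
  [RiemannianBundle (fun x : N => TangentSpace (𝓡 n) x)] [IsRiemannianManifold (𝓡 n) N] {s p : ℝ}

open Classical in
/-- Prolonging a map that is constant near `q` along a curve, in `j` steps of parameter length
`d`. -/
lemma EnergyLE.exists_bubbles (hm : 1 ≤ m) (hp : 0 ≤ p) (hsp : s * p = m) {q : Sph m}
    {φ : Amb m → ℝ} {δ : ℝ} {C : ℝ≥0∞} (hφ : Continuous φ) (hδ : 0 < δ) (hφ0 : ∀ z, 0 ≤ φ z)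
    (hφ1 : ∀ z, φ z ≤ 1) (hφn : ∀ x ∈ Metric.ball (-q) δ, φ x = 0)
    (hφp : ∀ x ∈ Metric.ball q δ, φ x = 1)
    (hE : ∀ (σ : ℝ → N) (K : ℝ), 0 ≤ K → ContMDiff 𝓘(ℝ, ℝ) (𝓡 n) 1 σ →
        (∀ τ : ℝ, ‖(mfderiv 𝓘(ℝ, ℝ) (𝓡 n) σ τ : ℝ →L[ℝ] TangentSpace (𝓡 n) (σ τ)) 1‖ ≤ K) →
        (∀ τ τ', edist (σ τ) (σ τ') ≤ ENNReal.ofReal K * edist τ τ') →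
        ∀ P : C(Sph m, N), (∀ x, P x = σ (φ x)) →
          EnergyLE n s p P (Metric.ball (-q) δ ∪ Metric.ball q δ) (ENNReal.ofReal K ^ p * C))
    {σ : ℝ → N} {K : ℝ} (hK : 0 ≤ K) (hσ : ContMDiff 𝓘(ℝ, ℝ) (𝓡 n) 1 σ)
    (hσd : ∀ τ : ℝ, ‖(mfderiv 𝓘(ℝ, ℝ) (𝓡 n) σ τ : ℝ →L[ℝ] TangentSpace (𝓡 n) (σ τ)) 1‖ ≤ K)
    {A : C(Sph m, N)} {e : ℝ≥0∞} {R : ℝ} (hR : 0 < R) (hA : EnergyLE n s p A (Metric.ball q R) e)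
    (hAσ : ∀ x ∈ Metric.ball q R, A x = σ 0) {d : ℝ} (hd : 0 ≤ d) {ε : ℝ≥0∞} (hε : 0 < ε) (j : ℕ) :
    ∃ (G : C(Sph m, N)) (τ : C(Sph m, ℝ)) (r : ℝ), 0 < r ∧ r ≤ R ∧
      EnergyLE n s p G (Metric.ball q r) (e + j * (ENNReal.ofReal (K * d) ^ p * C + ε)) ∧
      (∀ x, 0 ≤ τ x) ∧ (∀ x, τ x ≤ j * d) ∧ (∀ x ∈ Metric.ball q r, τ x = j * d) ∧
      (∀ x ∉ Metric.ball q R, τ x = 0) ∧ (∀ x ∈ Metric.ball q R, G x = σ (τ x)) ∧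
      ∀ x ∉ Metric.ball q R, G x = A x := by
  induction j with
  | zero =>
    refine ⟨A, 0, R, hR, le_rfl, by simpa using hA, ?_⟩
    simpa using hAσ
  | succ j ih =>
    obtain ⟨G, τ, r, hr, hrR, hG, h0, h1, hτ, hτ0, hGσ, hGA⟩ := ih
    -- The next bubble covers the parameters from `j * d` to `(j + 1) * d`; rescaled to the unit
    -- interval, the curve has speed at most `K * d`.
    let σ' : ℝ → N := fun t => σ (j * d + d * t)
    have hσ' : ContMDiff 𝓘(ℝ, ℝ) (𝓡 n) 1 σ' := hσ.comp
      (contMDiff_iff_contDiff.2 (contDiff_const.add (contDiff_const.mul contDiff_id)))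
    have hσd' := norm_mfderiv_curve_comp_affine_le hσ hσd (j * d) hd
    let P : C(Sph m, N) := ⟨fun x => σ' (φ x),
      hσ'.continuous.comp (hφ.comp continuous_subtype_val)⟩
    have hP := hE σ' (K * d) (mul_nonneg hK hd) hσ' hσd' (edist_curve_le hσ' hσd') P fun x => rfl
    have hGr : ∀ x ∈ Metric.ball q r, G x = σ (j * d) := fun x hx => by
      rw [hGσ x (Metric.ball_subset_ball hrR hx), hτ x hx]
    have hPn : ∀ x ∈ Metric.ball (-q) δ, P x = σ (j * d) := fun x hx => by
      simp [P, σ', hφn x hx]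
    obtain ⟨t₀, ht₀, hins⟩ := EnergyLE.insert hm hp hsp hG hP hr hδ hGr hPn subset_rfl
      Set.subset_union_left hε
    obtain ⟨t₁, ht₁, hmob⟩ := exists_mob_mem_ball q hr hδ
    obtain ⟨t, ht, htt⟩ := exists_between (lt_min ht₀ ht₁)
    have hmob' : ∀ x ∉ Metric.ball q r, mob q t ht x ∈ Metric.ball (-q) δ := fun x hx =>
      hmob t ht (htt.trans_le (min_le_right _ _)) x (not_lt.1 hx)
    have hφm : Continuous fun x => φ (mob q t ht x) :=
      hφ.comp (continuous_subtype_val.comp (mob q t ht).continuous)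
    let τ' : C(Sph m, ℝ) := ⟨fun x => if x ∈ Metric.ball q r then j * d + d * φ (mob q t ht x)
      else τ x, continuous_join Metric.isOpen_ball (c := j * d)
        (continuous_const.add (continuous_const.mul hφm)) τ.continuous
        (fun x hx => by rw [hφn _ (hmob' x hx), mul_zero, add_zero]) hτ⟩
    let G' : C(Sph m, N) := ⟨fun x => if x ∈ Metric.ball q r then P (mob q t ht x) else G x,
      continuous_join Metric.isOpen_ball (c := σ (j * d))
        (P.continuous.comp (mob q t ht).continuous) G.continuous
        (fun x hx => hPn _ (hmob' x hx)) hGr⟩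
    have hG'in : ∀ x ∈ Metric.ball q r, G' x = P (mob q t ht x) := fun x hx => by
      simp only [G', ContinuousMap.coe_mk, hx, if_true]
    have hG'out : ∀ x ∉ Metric.ball q r, G' x = G x := fun x hx => by
      simp only [G', ContinuousMap.coe_mk, hx, if_false]
    have hτ'in : ∀ x ∈ Metric.ball q r, τ' x = j * d + d * φ (mob q t ht x) := fun x hx => by
      simp only [τ', ContinuousMap.coe_mk, hx, if_true]
    have hτ'out : ∀ x ∉ Metric.ball q r, τ' x = τ x := fun x hx => by
      simp only [τ', ContinuousMap.coe_mk, hx, if_false]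
    have hjd : (0 : ℝ) ≤ j * d := by positivity
    have hE' := hins t ht (htt.trans_le (min_le_left _ _)) G' hG'in hG'out
    -- The dilation fixes `q`, so it maps a small ball around `q` to the region where `φ = 1`. The
    -- new map is flat there, with the value `σ ((j + 1) * d)`, ready for the next bubble.
    obtain ⟨r', hr', hball⟩ := Metric.isOpen_iff.1 (Metric.isOpen_ball.inter
      ((Metric.isOpen_ball (x := q) (ε := δ)).preimage (mob q t ht).continuous)) q
      ⟨Metric.mem_ball_self hr, by
        rw [Set.mem_preimage, mob_self]; exact Metric.mem_ball_self hδ⟩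
    refine ⟨G', τ', min r' R, lt_min hr' hR, min_le_right _ _, hE'.mono ?_ ?_, fun x => ?_,
      fun x => ?_, ?_, ?_, ?_, ?_⟩
    · intro x hx
      have := hball (Metric.ball_subset_ball (min_le_left _ _) hx)
      exact Or.inl ⟨this.1, Or.inr this.2⟩
    · push_cast
      rw [add_mul, one_mul, add_assoc, add_assoc]
    · by_cases hx : x ∈ Metric.ball q r
      · rw [hτ'in x hx]
        have := mul_nonneg hd (hφ0 (mob q t ht x))
        linarith
      · rw [hτ'out x hx]; exact h0 x
    · push_cast
      by_cases hx : x ∈ Metric.ball q r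
      · rw [hτ'in x hx]
        have := mul_le_mul_of_nonneg_left (hφ1 (mob q t ht x)) hd
        linarith
      · rw [hτ'out x hx]
        linarith [h1 x]
    · intro x hx
      have := hball (Metric.ball_subset_ball (min_le_left _ _) hx)
      rw [hτ'in x this.1, hφp _ this.2]
      push_cast; ring
    · intro x hx
      rw [hτ'out x fun h => hx (Metric.ball_subset_ball hrR h), hτ0 x hx]
    · intro x hx
      by_cases hxr : x ∈ Metric.ball q r
      · rw [hG'in x hxr, hτ'in x hxr]; rfl
      · rw [hG'out x hxr, hτ'out x hxr, hGσ x hx]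
    · intro x hx
      rw [hG'out x fun h => hx (Metric.ball_subset_ball hrR h), hGA x hx]

end Bubbles

end SphereMaps

end

noncomputable section


namespace SphereMaps

open Filter Topology

/-! ### Choice of the small parameters. -/

section Estimates

/-- `k (K / k) ^ p = K ^ p k ^ (1 - p)` tends to `0` since `p > 1`: many short bubbles are cheap.
The insertion losses `η` are chosen after `k`. -/
lemma exists_nat_mul_rpow_le {p : ℝ} (hp : 1 < p) {K : ℝ} (hK : 0 ≤ K) {C ε : ℝ≥0∞} (hC : C < ⊤)
    (hε : 0 < ε) : ∃ (k : ℕ) (η : ℝ≥0∞), 0 < k ∧ 0 < η ∧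
      k * (ENNReal.ofReal (K * (1 / k)) ^ p * C + η) ≤ ε := by
  obtain ⟨e, he, heε⟩ : ∃ e : ℝ, 0 < e ∧ ENNReal.ofReal e ≤ ε :=
    ⟨(min ε 1).toReal, ENNReal.toReal_pos (lt_min hε one_pos).ne'
      (min_lt_of_right_lt ENNReal.one_lt_top).ne,
      by rw [ENNReal.ofReal_toReal (min_lt_of_right_lt ENNReal.one_lt_top).ne]; exact min_le_left _ _⟩
  have h1 : Tendsto (fun k : ℕ => K ^ p * C.toReal * (k : ℝ) ^ (-(p - 1))) atTop (𝓝 0) := by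
    have := ((tendsto_rpow_neg_atTop (sub_pos.2 hp)).comp tendsto_natCast_atTop_atTop).const_mul
      (K ^ p * C.toReal)
    simpa using this
  obtain ⟨k, hk, hk0⟩ := ((h1.eventually (gt_mem_nhds (half_pos he))).and
    (eventually_gt_atTop 0)).exists
  have hk' : (0 : ℝ) < k := by exact_mod_cast hk0
  refine ⟨k, ENNReal.ofReal (e / 2 / k), hk0, ENNReal.ofReal_pos.2 (by positivity), ?_⟩
  have h3 : ENNReal.ofReal (k * ((K * (1 / k)) ^ p * C.toReal + e / 2 / k)) ≤ ENNReal.ofReal e := by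
    have h2 : (k : ℝ) * ((K * (1 / k)) ^ p * C.toReal) =
        K ^ p * C.toReal * (k : ℝ) ^ (-(p - 1)) := by
      rw [Real.mul_rpow hK (by positivity), one_div, Real.inv_rpow hk'.le, ← Real.rpow_neg hk'.le,
        neg_sub, sub_eq_add_neg, Real.rpow_add hk', Real.rpow_one]
      ring
    rw [mul_add, h2, mul_div_cancel₀ _ hk'.ne']
    exact ENNReal.ofReal_le_ofReal (by linarith)
  refine le_trans (le_of_eq ?_) (h3.trans heε)
  rw [ENNReal.ofReal_mul hk'.le, ENNReal.ofReal_add (by positivity) (by positivity),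
      ENNReal.ofReal_mul (p := (K * (1 / k)) ^ p) (by positivity), ENNReal.ofReal_toReal hC.ne,
      ENNReal.ofReal_natCast,
      ENNReal.ofReal_rpow_of_nonneg (by positivity) (by linarith)]

lemma exists_rpow_mul_add_le (p : ℝ) {e ε : ℝ≥0∞} (he : e < ⊤) (hε : 0 < ε) :
    ∃ η : ℝ, 0 < η ∧ ENNReal.ofReal (1 + η) ^ p * (e + ENNReal.ofReal η) ≤ e + ε := by
  obtain ⟨d, hd, hdε⟩ : ∃ d : ℝ, 0 < d ∧ ENNReal.ofReal d ≤ ε :=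
    ⟨(min ε 1).toReal, ENNReal.toReal_pos (lt_min hε one_pos).ne'
      (min_lt_of_right_lt ENNReal.one_lt_top).ne,
      by rw [ENNReal.ofReal_toReal (min_lt_of_right_lt ENNReal.one_lt_top).ne]; exact min_le_left _ _⟩
  have hc : ContinuousAt (fun η : ℝ => (1 + η) ^ p * (e.toReal + η)) 0 := by
    refine ContinuousAt.mul ?_ (by fun_prop)
    exact ContinuousAt.rpow_const (by fun_prop) (Or.inl (by norm_num))
  have h1 : ∀ᶠ η in 𝓝[>] (0 : ℝ), (1 + η) ^ p * (e.toReal + η) < e.toReal + d :=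
    (hc.eventually (gt_mem_nhds (by simpa using hd))).filter_mono nhdsWithin_le_nhds
  obtain ⟨η, h2, h3⟩ := (h1.and self_mem_nhdsWithin).exists
  have h3 : 0 < η := h3
  refine ⟨η, h3, ?_⟩
  calc _ = ENNReal.ofReal ((1 + η) ^ p * (e.toReal + η)) := by
        rw [ENNReal.ofReal_mul (by positivity), ENNReal.ofReal_rpow_of_pos (by positivity),
          ENNReal.ofReal_add (by positivity) h3.le, ENNReal.ofReal_toReal he.ne]
    _ ≤ ENNReal.ofReal (e.toReal + d) := ENNReal.ofReal_le_ofReal h2.le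
    _ ≤ e + ε := by
        rw [ENNReal.ofReal_add (by positivity) hd.le, ENNReal.ofReal_toReal he.ne]
        exact add_le_add_right hdε _

end Estimates

/-! ### Approximation by maps that are constant near a point. -/

section FlatApprox

variable {m n : ℕ} {N : Type*} [MetricSpace N] [ChartedSpace (EuclideanSpace ℝ (Fin n)) N]
  [RiemannianBundle (fun x : N => TangentSpace (𝓡 n) x)] {s p : ℝ}

variable (n) in
/-- The map `g` is homotopic, relatively to `{q}`, to maps of energy arbitrarily close to `e` that
are constant near `q`. -/
def FlatApprox (s p : ℝ) (e : ℝ≥0∞) (q : Sph m) (g : C(Sph m, N)) : Prop :=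
  ∀ ε : ℝ≥0∞, 0 < ε → ∃ (f : C(Sph m, N)) (δ : ℝ), 0 < δ ∧
    EnergyLE n s p f (Metric.ball q δ) (e + ε) ∧ (∀ x ∈ Metric.ball q δ, f x = g q) ∧
      f.HomotopicRel g {q}

variable [IsManifold (𝓡 n) ∞ N] [IsContMDiffRiemannianBundle (𝓡 n) ∞ (EuclideanSpace ℝ (Fin n))
      (fun x : N => TangentSpace (𝓡 n) x)] [IsRiemannianManifold (𝓡 n) N]

/-- Composition with the collapse of a neighbourhood of `f q` flattens `f` near `q` and costs a
factor close to `1`. -/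
lemma flatApprox_energy (hp : 0 ≤ p) (q : Sph m) {f : C(Sph m, N)} (hf : energy n s p f < ⊤) :
    FlatApprox n s p (energy n s p f) q f := by
  intro ε hε
  obtain ⟨η, hη, hηε⟩ := exists_rpow_mul_add_le p hf hε
  obtain ⟨Ψ, hΨ, hd, hflat, H, hH0, hH1, hHb⟩ := exists_collapse_point n (f q) hη
  have h1 := f.continuous.continuousAt.eventually hflat
  obtain ⟨δ, hδ, hball⟩ := Metric.eventually_nhds_iff_ball.1 h1
  have hfE : EnergyLE n s p f ∅ (energy n s p f + ENNReal.ofReal η) :=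
    energyLE_of_energy_lt (ENNReal.lt_add_right hf.ne (ENNReal.ofReal_pos.2 hη).ne')
  let g : C(Sph m, N) := ⟨fun x => Ψ (f x), hΨ.continuous.comp f.continuous⟩
  refine ⟨g, δ, hδ, (hfE.comp hΨ (g := g) (W' := Metric.ball q δ) (fun x => rfl) (by positivity) hp hd
    (edist_le_of_norm_mfderiv_le hΨ (by positivity) hd) fun x hx => (hball x hx).2).mono subset_rfl
    hηε, fun x hx => (hball x hx).1, ContinuousMap.HomotopicRel.symm ?_⟩
  refine homotopicRel_of_continuous (fun z => H (z.1, f z.2)) (by fun_prop) (fun x => hH0 _)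
    (fun x => hH1 _) fun t x hx => ?_
  rw [Set.mem_singleton_iff.1 hx, hHb]

omit [IsManifold (𝓡 n) ∞ N] [IsContMDiffRiemannianBundle (𝓡 n) ∞ (EuclideanSpace ℝ (Fin n))
      (fun x : N => TangentSpace (𝓡 n) x)] in
-- A flat approximation of `g` is prolonged by bubbles along a `C^1` curve homotopic to the
-- trajectory of `q`. That the trajectory stays in `O` is what supplies this curve.
lemma FlatApprox.of_homotopy (hm : 1 ≤ m) (hs : 0 < s) (hs1 : s ≤ 1) (hsp : s * p = m) (hp : 1 < p)
    {e : ℝ≥0∞} {q : Sph m} {g g' : C(Sph m, N)} (hg : FlatApprox n s p e q g) (H : g.Homotopy g')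
    {O : Set N} (hO : ∀ γ : C(unitInterval, N), (∀ r, γ r ∈ O) → ∃ (σ : ℝ → N) (K : ℝ), 0 ≤ K ∧
      ContMDiff 𝓘(ℝ, ℝ) (𝓡 n) 1 σ ∧
      (∀ τ : ℝ, ‖(mfderiv 𝓘(ℝ, ℝ) (𝓡 n) σ τ : ℝ →L[ℝ] TangentSpace (𝓡 n) (σ τ)) 1‖ ≤ K) ∧
      ∃ P : C(unitInterval × unitInterval, N), (∀ r : unitInterval, P (0, r) = σ r) ∧
        (∀ r, P (1, r) = γ r) ∧ (∀ s, P (s, 0) = γ 0) ∧ ∀ s, P (s, 1) = γ 1)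
    (hHO : ∀ t, H (t, q) ∈ O) : FlatApprox n s p e q g' := by
  intro ε hε
  have hp0 : 0 ≤ p := by linarith
  obtain ⟨A, δ, hδ, hA, hAb, ⟨K₀⟩⟩ := hg (ε / 2) (ENNReal.half_pos hε.ne')
  obtain ⟨φ, δ', C, hφ, hδ', hC, hφ0, hφ1, hφn, hφp, hE⟩ :=
    exists_bump_energyLE n N hm hs hs1 hsp hp0 q
  -- The first half is relative to `{q}`, so the trajectory of `q` rests at `g q` before following
  -- that of `H`.
  let L : A.Homotopy g' := K₀.toHomotopy.trans H
  let γ : C(unitInterval, N) := ⟨fun r => L (r, q), by fun_prop⟩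
  have hAq : A q = g q := K₀.fst_eq_snd rfl
  have hγO : ∀ r, γ r ∈ O := fun r => by
    simp only [γ, L, ContinuousMap.coe_mk, ContinuousMap.Homotopy.trans_apply]
    split_ifs with h
    · have h1 : K₀.toHomotopy (⟨2 * r, (unitInterval.mul_pos_mem_iff zero_lt_two).2 ⟨r.2.1, h⟩⟩, q) =
          H (0, q) := by
        rw [H.apply_zero, ← hAq]
        exact K₀.eq_fst _ rfl
      rw [h1]
      exact hHO 0
    · exact hHO _
  obtain ⟨σ, K, hK, hσ, hσd, P, hP0, hP1, hPz, hPo⟩ := hO γ hγO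
  have hγ0 : γ 0 = A q := L.apply_zero q
  have hγ1 : γ 1 = g' q := L.apply_one q
  have hσ0 : σ 0 = A q := by
    rw [← hγ0, ← hPz 0, hP0]; rfl
  have hσ1 : σ 1 = g' q := by
    rw [← hγ1, ← hPo 0, hP0]; rfl
  obtain ⟨k, η, hk, hη, hkη⟩ := exists_nat_mul_rpow_le hp hK hC (ENNReal.half_pos hε.ne')
  have hk' : (0 : ℝ) < k := by exact_mod_cast hk
  have hR1 : min δ 1 ≤ δ := min_le_left _ _
  have hAσ : ∀ x ∈ Metric.ball q (min δ 1), A x = σ 0 := fun x hx => by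
    rw [hσ0, hAq, hAb x (Metric.ball_subset_ball hR1 hx)]
  obtain ⟨G, τ, r, hr, hrR, hG, h0, h1, hτ, hτ0, hGσ, hGA⟩ := EnergyLE.exists_bubbles hm hp0 hsp hφ
    hδ' hφ0 hφ1 hφn hφp hE hK hσ hσd (lt_min hδ one_pos)
    (hA.mono (Metric.ball_subset_ball hR1) le_rfl) hAσ (d := 1 / k) (by positivity) hη k
  have hkk : (k : ℝ) * (1 / k) = 1 := by field_simp
  rw [hkk] at h1 hτ
  refine ⟨G, r, hr, hG.mono subset_rfl ?_, fun x hx => ?_, ?_⟩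
  · calc _ ≤ e + ε / 2 + ε / 2 := add_le_add_right hkη _
      _ = _ := by rw [add_assoc, ENNReal.add_halves]
  · rw [hGσ x (Metric.ball_subset_ball hrR hx), hτ x hx, hσ1]
  · refine homotopicRel_of_homotopy (lt_min hδ one_pos) (min_le_right _ _) hAσ L h0 h1 hτ0
      (hτ q (Metric.mem_ball_self hr)) P hP0 hP1 (fun t => ?_) (fun t => ?_) hGσ hGA
    · rw [hPz, hγ0, hσ0]
    · rw [hPo, hγ1]

/-- The approximation by flat maps does not depend on the base point. -/
lemma FlatApprox.of_homotopic (hm : 1 ≤ m) (hs : 0 < s) (hs1 : s ≤ 1) (hsp : s * p = m)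
    (hp : 1 < p) {e : ℝ≥0∞} {q : Sph m} {g g' : C(Sph m, N)} (hg : FlatApprox n s p e q g)
    (h : g.Homotopic g') : FlatApprox n s p e q g' := by
  obtain ⟨H⟩ := h
  have hcurry : ∀ t x, H.curry t x = H (t, x) := fun t x => rfl
  have h01 : ∀ (r t t' : unitInterval), (1 - (r : ℝ)) * t + r * t' ∈ Set.Icc (0 : ℝ) 1 :=
    fun r t t' => convex_Icc (0 : ℝ) 1 t.2 t'.2 (sub_nonneg.2 r.2.2) r.2.1 (sub_add_cancel _ _)
  have key : ∀ t t' : unitInterval, FlatApprox n s p e q (H.curry t) ↔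
      FlatApprox n s p e q (H.curry t') := by
    -- A long trajectory need not lie in one chart. The property is locally constant in the time of
    -- the homotopy, hence constant by connectedness of the interval.
    refine PreconnectedSpace.induction₂' (fun t t' : unitInterval =>
      FlatApprox n s p e q (H.curry t) ↔ FlatApprox n s p e q (H.curry t'))
      (fun t₀ => ?_) ⟨fun _ _ _ h1 h2 => Iff.trans h1 h2⟩
    obtain ⟨O, hO, hbO, hcurve⟩ := exists_curve_homotopy n (H (t₀, q))
    have hc : Continuous fun t : unitInterval => H (t, q) := by fun_prop
    obtain ⟨η, hη, hball⟩ := Metric.eventually_nhds_iff_ball.1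
      (hc.continuousAt.eventually (hO.mem_nhds hbO))
    have step : ∀ t ∈ Metric.ball t₀ η, ∀ t' ∈ Metric.ball t₀ η,
        FlatApprox n s p e q (H.curry t) → FlatApprox n s p e q (H.curry t') := by
      intro t ht t' ht' hft
      let L : (H.curry t).Homotopy (H.curry t') :=
        { toFun := fun z => H (⟨(1 - (z.1 : ℝ)) * t + z.1 * t', h01 _ _ _⟩, z.2)
          continuous_toFun := by fun_prop
          map_zero_left := fun x => by simp
          map_one_left := fun x => by simp }
      refine FlatApprox.of_homotopy hm hs hs1 hsp hp hft L hcurve fun r => ?_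
      refine hball _ ?_
      rw [Metric.mem_ball, Subtype.dist_eq]
      exact convex_ball (t₀ : ℝ) η ht ht' (sub_nonneg.2 r.2.2) r.2.1 (sub_add_cancel _ _)
    filter_upwards [Metric.ball_mem_nhds t₀ hη] with t ht
    have h1 : FlatApprox n s p e q (H.curry t₀) ↔ FlatApprox n s p e q (H.curry t) :=
      ⟨step _ (Metric.mem_ball_self hη) _ ht, step _ ht _ (Metric.mem_ball_self hη)⟩
    exact ⟨h1, h1.symm⟩
  have h0 : H.curry 0 = g := ContinuousMap.ext fun x => H.apply_zero x
  have h1 : H.curry 1 = g' := ContinuousMap.ext fun x => H.apply_one x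
  have := key 0 1
  rw [h0, h1] at this
  exact this.1 hg

end FlatApprox

end SphereMaps

end

noncomputable section


namespace SphereMaps

open Filter Topology

/-! ### Gluing over the balls of the decomposition, and the theorem. -/

section Decomposition

variable {m n : ℕ} {N : Type*} [MetricSpace N]

omit [MetricSpace N] in
-- The boundary of the ball is sent to `-a`, and `g = c` on it. It is not empty: the sphere is
-- connected as `m ≥ 1`, and the ball contains `a` but not `-a`.
lemma InducesOnBall.apply_neg (hm : 1 ≤ m) {a : Sph m} {ρ : ℝ} (hρ : 0 < ρ) (hρπ : ρ < Real.pi)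
    {c : N} {g h : Sph m → N} (hind : InducesOnBall g a ρ h)
    (hc : ∀ x ∈ closure (geodBall a ρ), x ∉ geodBall a ρ → g x = c) : h (-a) = c := by
  have hconn : IsPreconnected (Set.univ : Set (Sph m)) := by
    have h1 : 1 < Module.rank ℝ (Amb m) := by
      rw [← Module.finrank_eq_rank, finrank_euclideanSpace, Fintype.card_fin]
      exact_mod_cast Nat.lt_succ_of_le hm
    have := (isConnected_sphere h1 (0 : Amb m) zero_le_one).isPreconnected
    exact (isPreconnected_iff_preconnectedSpace.1 this).isPreconnected_univ
  obtain ⟨x, hx, hx'⟩ : ∃ x, x ∈ closure (geodBall a ρ) ∧ x ∉ geodBall a ρ := by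
    by_contra! hno
    have : PreconnectedSpace (Sph m) := ⟨hconn⟩
    have hclopen : IsClopen (geodBall a ρ) :=
      ⟨isClosed_of_closure_subset hno, isOpen_geodBall a ρ⟩
    have huniv := hclopen.eq_univ ⟨a, mem_geodBall_self hρ⟩
    have h2 : -a ∈ geodBall a ρ := huniv ▸ Set.mem_univ _
    have h3 : (a : Amb m) ≠ 0 := by rw [← norm_ne_zero_iff]; simp
    rw [geodBall, Set.mem_ofPred_eq, coe_neg_sphere,
      InnerProductGeometry.angle_self_neg_of_nonzero h3] at h2
    linarith
  rw [← hc x hx hx', hind.eq_collapse hm hρπ (angle_le_of_mem_closure hx),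
    collapse_of_angle_eq hρ (angle_eq_of_mem_closure hx hx'), ← coe_neg_sphere, radProj_coe]

open Classical in
/-- Extending a map by a constant outside of an open set. -/
lemma exists_extend_const {X : Type*} [TopologicalSpace X] {V : Set X} (hV : IsOpen V) {c : N}
    (g : C(X, N)) (hg : ∀ x ∈ closure V, x ∉ V → g x = c) :
    ∃ f : C(X, N), (∀ x ∈ V, f x = g x) ∧ ∀ x ∉ V, f x = c := by
  refine ⟨⟨fun x => if x ∈ V then g x else c, continuous_if (fun x hx => ?_)
    g.continuous.continuousOn continuousOn_const⟩, fun x hx => ?_, fun x hx => ?_⟩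
  · have h1 : x ∈ frontier V := hx
    rw [hV.frontier_eq] at h1
    exact hg x h1.1 h1.2
  · simp [hx]
  · simp [hx]

variable [ChartedSpace (EuclideanSpace ℝ (Fin n)) N]
  [RiemannianBundle (fun x : N => TangentSpace (𝓡 n) x)] {s p : ℝ}

lemma energyLE_const (hp : 0 < p) (c : N) (W : Set (Sph m)) :
    EnergyLE n s p (ContinuousMap.const (Sph m) c) W 0 := by
  unfold EnergyLE
  split_ifs with hs
  · refine ⟨fun _ => 0, ⟨fun x => rfl, fun u hu => ?_⟩, ?_, fun x _ => rfl⟩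
    · have e : (fun _ : Sph m => compDiff u c (0 : Amb m →L[ℝ] TangentSpace (𝓡 n) c)) =
          fun _ => 0 := by
        funext x
        exact compDiff_zero u c
      exact (congrArg (HasWeakDeriv fun _ : Sph m => u c) e).mpr (hasWeakDeriv_const (u c))
    · have h0 : hsNorm c (0 : Amb m →L[ℝ] TangentSpace (𝓡 n) c) = 0 := by
        unfold hsNorm
        simp only [zero_apply, norm_zero]
        simp
      rw [derivEnergy_eq]
      refine ((lintegral_congr fun x => ?_).trans lintegral_zero).le
      exact (congrArg (fun r => ENNReal.ofReal (r ^ p)) h0).trans (by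
        rw [Real.zero_rpow hp.ne', ENNReal.ofReal_zero])
  · simp [energyFrac, ENNReal.zero_rpow_of_pos hp]

variable [IsManifold (𝓡 n) ∞ N] [IsContMDiffRiemannianBundle (𝓡 n) ∞ (EuclideanSpace ℝ (Fin n))
      (fun x : N => TangentSpace (𝓡 n) x)] [IsRiemannianManifold (𝓡 n) N]

open Classical in
/-- Gluing maps of almost minimal energies into pairwise disjoint balls. -/
lemma exists_energyLE_of_decomposition {ι : Type*} (hm : 1 ≤ m) (hs : 0 < s) (hs1 : s ≤ 1)
    (hsp : s * p = m) (hp : 1 < p) {g : C(Sph m, N)} {a : ι → Sph m} {ρ : ι → ℝ} {c : N}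
    {h F : ι → C(Sph m, N)} (hρ : ∀ i, 0 < ρ i) (hρπ : ∀ i, ρ i < Real.pi)
    (hdisj : ∀ i j, i ≠ j → Disjoint (geodBall (a i) (ρ i)) (geodBall (a j) (ρ j)))
    (hc : ∀ x, (∀ i, x ∉ geodBall (a i) (ρ i)) → g x = c) (hF : ∀ i, (F i).Homotopic (h i))
    (hind : ∀ i, InducesOnBall g (a i) (ρ i) (h i)) (hfin : ∀ i, energy n s p (F i) < ⊤)
    (S : Finset ι) : ∀ ε : ℝ≥0∞, 0 < ε → ∃ G : C(Sph m, N),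
      EnergyLE n s p G (⋃ i ∈ S, geodBall (a i) (ρ i))ᶜ (∑ i ∈ S, energy n s p (F i) + ε) ∧
      (∀ x ∉ ⋃ i ∈ S, geodBall (a i) (ρ i), G x = c) ∧
      ∀ f : C(Sph m, N), (∀ x ∈ ⋃ i ∈ S, geodBall (a i) (ρ i), f x = g x) →
        (∀ x ∉ ⋃ i ∈ S, geodBall (a i) (ρ i), f x = c) →
        G.HomotopicRel f (⋃ i ∈ S, geodBall (a i) (ρ i))ᶜ := by
  have hp0 : 0 ≤ p := by linarith
  have hVopen : ∀ S : Finset ι, IsOpen (⋃ i ∈ S, geodBall (a i) (ρ i)) := fun S =>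
    isOpen_biUnion fun i _ => isOpen_geodBall _ _
  have hVdisj : ∀ (S : Finset ι) (i : ι), i ∉ S →
      Disjoint (geodBall (a i) (ρ i)) (⋃ j ∈ S, geodBall (a j) (ρ j)) := fun S i hi =>
    Set.disjoint_iUnion₂_right.2 fun j hj => hdisj i j fun hij => hi (hij ▸ hj)
  -- A boundary point of the union of some balls lies in none of the others, since an open set
  -- disjoint from the union is disjoint from its closure.
  have hcV : ∀ S : Finset ι, ∀ x ∈ closure (⋃ i ∈ S, geodBall (a i) (ρ i)),
      x ∉ (⋃ i ∈ S, geodBall (a i) (ρ i)) → g x = c := fun S x hx hx' => by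
    refine hc x fun i hi => ?_
    by_cases hiS : i ∈ S
    · exact hx' (Set.mem_biUnion hiS hi)
    · exact Set.disjoint_left.1 ((hVdisj S i hiS).closure_right (isOpen_geodBall _ _)) hi hx
  have hcU : ∀ i, ∀ x ∈ closure (geodBall (a i) (ρ i)), x ∉ geodBall (a i) (ρ i) → g x = c :=
    fun i x hx hx' => by
      have := hcV {i} x
      simp only [Finset.mem_singleton, Set.iUnion_iUnion_eq_left] at this
      exact this hx hx'
  induction S using Finset.induction_on with
  | empty =>
    intro ε hε
    refine ⟨ContinuousMap.const _ c, (energyLE_const (by linarith) c _).mono subset_rfl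
      zero_le, fun x _ => rfl, fun f _ hf => ?_⟩
    have : f = ContinuousMap.const _ c := ContinuousMap.ext fun x => hf x (by simp)
    exact this ▸ ContinuousMap.HomotopicRel.refl _
  | insert i S hi ih =>
    intro ε hε
    -- One third each for the map already glued, for the flat approximation of the new one, and for
    -- the insertion.
    have hε3 : 0 < ε / 3 := ENNReal.div_pos hε.ne' (by simp)
    obtain ⟨G, hG, hGc, hGf⟩ := ih (ε / 3) hε3
    have hha : h i (-(a i)) = c := (hind i).apply_neg hm (hρ i) (hρπ i) (hcU i)
    -- Flatness is required at `-(a i)`, where the dilation sends the complement of the ball; the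
    -- value of `h i` there is `c`, which is what `G` takes on the new ball.
    obtain ⟨B, δ, hδ, hB, hBc, hBh⟩ := (FlatApprox.of_homotopic hm hs hs1 hsp hp
      (flatApprox_energy hp0 (-(a i)) (hfin i)) (hF i)) (ε / 3) hε3
    rw [hha] at hBc
    set U := geodBall (a i) (ρ i) with hU
    set V := ⋃ j ∈ S, geodBall (a j) (ρ j) with hV
    have hUo : IsOpen U := isOpen_geodBall _ _
    have hUV : Disjoint U V := hVdisj S i hi
    rw [Finset.set_biUnion_insert, ← hV, ← hU, Finset.sum_insert hi]
    obtain ⟨R, hR, hRU⟩ := Metric.isOpen_iff.1 hUo (a i) (mem_geodBall_self (hρ i))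
    have hGU : ∀ x ∈ U, G x = c := fun x hx => hGc x (Set.disjoint_left.1 hUV hx)
    have hδ' : 0 < min δ 1 := lt_min hδ one_pos
    have hBc' : ∀ x ∈ Metric.ball (-(a i)) (min δ 1), B x = c := fun x hx =>
      hBc x (Metric.ball_subset_ball (min_le_left _ _) hx)
    obtain ⟨t₀, ht₀, hins⟩ := EnergyLE.insert hm hp0 hsp hG hB hR hδ'
      (fun x hx => hGU x (hRU hx)) hBc' (fun x hx => Set.disjoint_left.1 hUV (hRU hx))
      (Metric.ball_subset_ball (min_le_left _ _)) hε3
    obtain ⟨t₁, ht₁, hmob⟩ := exists_mob_mem_ball (a i) hR hδ'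
    obtain ⟨t, ht, htt⟩ := exists_between (lt_min ht₀ ht₁)
    have hmob' : ∀ x ∉ Metric.ball (a i) R, mob (a i) t ht x ∈ Metric.ball (-(a i)) (min δ 1) :=
      fun x hx => hmob t ht (htt.trans_le (min_le_right _ _)) x (not_lt.1 hx)
    have hmobU : ∀ x ∉ U, mob (a i) t ht x ∈ Metric.ball (-(a i)) (min δ 1) :=
      fun x hx => hmob' x fun h => hx (hRU h)
    let J : C(Sph m, N) := ⟨fun x => if x ∈ U then B (mob (a i) t ht x) else G x,
      continuous_join hUo (B.continuous.comp (mob (a i) t ht).continuous) G.continuous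
        (fun x hx => hBc' _ (hmobU x hx)) hGU⟩
    have hJin : ∀ x ∈ U, J x = B (mob (a i) t ht x) := fun x hx => by
      simp only [J, ContinuousMap.coe_mk, hx, if_true]
    have hJout : ∀ x ∉ U, J x = G x := fun x hx => by
      simp only [J, ContinuousMap.coe_mk, hx, if_false]
    have hJE := hins t ht (htt.trans_le (min_le_left _ _)) J (fun x hx => hJin x (hRU hx))
      fun x hx => by
        by_cases hxU : x ∈ U
        · rw [hJin x hxU, hBc' _ (hmob' x hx), hGU x hxU]
        · exact hJout x hxU
    refine ⟨J, hJE.mono (fun x hx => ?_) (le_of_eq ?_), fun x hx => ?_, fun f hf hf' => ?_⟩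
    · rw [Set.mem_compl_iff, Set.mem_union, not_or] at hx
      exact Or.inr ⟨fun h => hx.1 (hRU h), hx.2⟩
    · calc _ = energy n s p (F i) + ∑ j ∈ S, energy n s p (F j) + (ε / 3 + ε / 3 + ε / 3) := by ring
        _ = _ := by rw [ENNReal.add_thirds]
    · rw [Set.mem_union, not_or] at hx
      rw [hJout x hx.1, hGc x hx.2]
    -- The target `f` is the join of the restriction of `g` to the new ball and of its restriction
    -- to the previous ones, each extended by `c`; the two homotopies are joined in the same way.
    · obtain ⟨P, hP, hP'⟩ := exists_extend_const hUo g (hcU i)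
      obtain ⟨f', hf1, hf2⟩ := exists_extend_const (hVopen S) g (hcV S)
      refine homotopicRel_join hUo hUV (homotopicRel_comp_mob hm (hρ i) (hρπ i) (hind i) hP hP' hha
        hBh (min_le_right _ _) hBc' ht hmobU) (hGf f' hf1 hf2) (fun x hx => hBc' _ (hmobU x hx)) hGc
        hJin hJout (fun x hx => ?_) fun x hx => ?_
      · rw [hf x (Or.inl hx), hP x hx]
      · by_cases hxV : x ∈ V
        · rw [hf x (Or.inr hxV), hf1 x hxV]
        · rw [hf' x (by simp [hx, hxV]), hf2 x hxV]

end Decomposition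

end SphereMaps

end

theorem mainTheorem2 {m n k : ℕ} (hm : 1 ≤ m) {N : Type*} [MetricSpace N]
    [ChartedSpace (EuclideanSpace ℝ (Fin n)) N] [IsManifold (𝓡 n) ∞ N]
    [RiemannianBundle (fun x : N => TangentSpace (𝓡 n) x)]
    [IsContMDiffRiemannianBundle (𝓡 n) ∞ (EuclideanSpace ℝ (Fin n))
      (fun x : N => TangentSpace (𝓡 n) x)]
    [IsRiemannianManifold (𝓡 n) N] [ConnectedSpace N]
    (f : C(SphereMaps.Sph m, N)) (F : Fin k → C(SphereMaps.Sph m, N))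
    (hf : SphereMaps.HasFreeHomotopyDecomposition f F)
    (s p : ℝ) (hs : 0 < s) (hs1 : s ≤ 1) (hp : p = m / s) (hp1 : 1 < p) :
    sInf {e : ℝ≥0∞ | ∃ g : C(SphereMaps.Sph m, N),
        SphereMaps.MemSobolev n s p g ∧ g.Homotopic f ∧ e = SphereMaps.energy n s p g} ≤
      ∑ i, SphereMaps.energy n s p (F i) := by
  have hsp : s * p = m := by rw [hp, mul_div_cancel₀ _ hs.ne']
  obtain ⟨g, a, ρ, hgf, hρ, hdisj, ⟨c, hc⟩, hdec⟩ := hf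
  choose h hh hind using hdec
  -- Only a finite sum has to be considered, so every `F i` has finite energy.
  refine ENNReal.le_of_forall_pos_le_add fun ε hε hfin => ?_
  have hfin' : ∀ i, SphereMaps.energy n s p (F i) < ⊤ := fun i =>
    (ENNReal.sum_lt_top.1 hfin) i (Finset.mem_univ i)
  obtain ⟨G, hG, -, hGg⟩ := SphereMaps.exists_energyLE_of_decomposition hm hs hs1 hsp hp1
    (fun i => (hρ i).1) (fun i => (hρ i).2) hdisj hc (fun i => (hh i).symm) hind hfin' Finset.univ
    ε (by exact_mod_cast hε)
  have hGf : G.Homotopic f := (hGg g (fun x _ => rfl) fun x hx => hc x fun i hi =>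
    hx (Set.mem_biUnion (Finset.mem_univ i) hi)).homotopic.trans hgf
  exact sInf_le_of_le ⟨G, hG.memSobolev (ENNReal.add_lt_top.2 ⟨hfin, ENNReal.coe_lt_top⟩), hGf, rfl⟩
    hG.energy_le
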